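/- Let $m\ge 1$ and $l>m+1$ be integers, and let $E_1,\dots,E_{m-1}$ be skew-symmetric real $l\times l$ matrices with $E_i^2=-I$ and $E_iE_j=-E_jE_i$ for $i\ne j$ (a representation of the Clifford algebra $C_{m-1}$ on $\mathbf R^l$). Let $$V_2(C_{m-1})=\{(u,v)\in S^{2l-1}\subset\mathbf R^l\times\mathbf R^l : |u|=|v|=\tfrac1{\sqrt2},\ u\cdot v=0,\ E_iu\cdot v=0,\ 1\le i\le m-1\}$$ be the Clifford–Stiefel manifold. Let $\alpha,\beta>0$ with $\alpha^2+\beta^2=1$ and $\alpha\ne 1/\sqrt2$, let $T_{\alpha,\beta}(u,v)=\sqrt2\,(\alpha u,\beta v)$, and let $V=V_2^{\alpha,\beta}=T_{\alpha,\beta}(V_2(C_{m-1}))$. Conventions. A Legendre submanifold is a $(2l-2)$-dimensional submanifold $B$ of the space of contact elements $(x,\xi)$ of $S^{2l-1}$ (pairs of orthogonal unit vectors) on which $dx\cdot\xi=0$. The contact element $(x,\xi)$ corresponds to the projective line $[(1,x,0),(0,\xi,1)]$ on the Lie quadric $\{-z_1^2+z_2^2+\dots+z_{2l+1}^2-z_{2l+2}^2=0\}$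 in ${\bf P}^{2l+1}$. A number $\kappa\in\mathbf R\cup\{\infty\}$ is a principal curvature of $B$ at $(x,\xi)$ if $d\xi=-\kappa\,dx$ (for $\kappa=\infty$: $dx=0$) on some nonzero tangent vector of $B$. The vectors with this property, together with $0$, form its principal space, and $[\kappa(1,x,0)+(0,\xi,1)]$ (for $\kappa=\infty$: $[(1,x,0)]$) is its curvature sphere. A curvature surface is a connected submanifold of $B$ whose tangent space at each point is a principal space. $B$ is proper Dupin if the corresponding curvature sphere is constant along each curvature surface and the number $g$ of distinct principal curvatures is constant on $B$. If $g=4$ and $\lambda_1<\lambda_2<\lambda_3<\lambda_4\le\infty$ are the principal curvatures, the Lie curvature is $$\Psi=[\lambda_1,\lambda_2;\lambda_3,\lambda_4]=\frac{(\lambda_1-\lambda_2)(\lambda_4-\lambda_3)}{(\lambda_1-\lambda_3)(\lambda_4-\lambda_2)},$$ which is $(\lambda_1-\lambda_2)/(\lambda_1-\lambda_3)$ if $\lambda_4=\infty$. A submanifold of codimension greater than one in $S^{2l-1}$ is represented by its Legendre lift, the unit normal bundle. A hypersurface with unit normal field $\nu$ is represented by $\{(x,\nu(x))\}$, and the definitions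 apply to it through this lift. A Lie sphere transformation is a projective transformation preserving the Lie quadric. Two Legendre submanifolds are Lie equivalent if such a transformation maps one, as a family of lines on the quadric, onto the other. An isoparametric hypersurface is an oriented immersed hypersurface of $S^{2l-1}$ with constant principal curvatures. Then: 1. $V$ is a compact submanifold of $S^{2l-1}$ of codimension $m+1$. 2. $V$ is proper Dupin with exactly four principal curvatures, one of which is $\infty$, at each point of its unit normal bundle $B(V)$. 3. At each $(u,v)\in V$ the vector $\xi(u,v)=\left(-\frac\beta\alpha u,\frac\alpha\beta v\right)$ is a unit normal. At $\xi(u,v)$ the principal curvatures are $-\frac\alpha\beta,\,0,\,\frac\beta\alpha,\,\infty$ and $\Psi=\alpha^2$. At $-\xi(u,v)$ they are $-\frac\beta\alpha,\,0,\,\frac\alpha\beta,\,\infty$ and $\Psi=\beta^2$. 4. $\Psi$ is not constant on $B(V)$. 5. $V$ is not Lie equivalent to an isoparametric hypersurface. 6. There is $t_0>0$ such that for all $0<t<t_0$ the tube $M_t=\{\cos t\,x+\sin t\,\xi : (x,\xi)\in B(V)\}$ is a compact embedded orientable hypersurface of $S^{2l-1}$ and, for every choice of a smooth unit normal field, it is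 proper Dupin with exactly four principal curvatures and is not Lie equivalent to an isoparametric hypersurface. -/

import Mathlib

open scoped ContDiff Manifold RealInnerProductSpace

universe u

noncomputable section

namespace LieSphere

/-! ### Smooth submanifolds of a normed space -/

section Submanifolds

variable {E : Type*} [NormedAddCommGroup E] [NormedSpace ℝ E]

/-- `S` is a smooth embedded submanifold of dimension `k`: near each of its points there is a
smooth diffeomorphism between open sets of `E` that straightens `S` to a `k`-dimensional linear
subspace. -/
def IsSubmanifold (k : ℕ) (S : Set E) : Prop :=
  ∀ p ∈ S, ∃ (Φ : OpenPartialHomeomorph E E) (W : Submodule ℝ E),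
    p ∈ Φ.source ∧ ContDiffOn ℝ ∞ Φ Φ.source ∧ ContDiffOn ℝ ∞ Φ.symm Φ.target ∧
    Module.finrank ℝ W = k ∧ ∀ x ∈ Φ.source, x ∈ S ↔ Φ x ∈ W

/-- `w` is the velocity at `p` of a smooth curve in `S`. -/
def IsTangentVector (S : Set E) (p w : E) : Prop :=
  ∃ γ : ℝ → E, ContDiffAt ℝ ∞ γ 0 ∧ γ 0 = p ∧ HasDerivAt γ w 0 ∧ ∀ᶠ t in nhds (0 : ℝ), γ t ∈ S

/-- The tangent space of `S` at `p` (a linear subspace if `S` is a submanifold and `p ∈ S`). -/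
def tangentVectors (S : Set E) (p : E) : Set E := {w | IsTangentVector S p w}

end Submanifolds

/-! ### The extended line `ℝ ∪ {∞}` and the cross-ratio

`WithTop ℝ` models `ℝ ∪ {∞}`; its order makes `∞ = ⊤` the largest element. -/

/-- Homogeneous coordinates: `κ ↦ (κ, 1)` for real `κ`, and `∞ ↦ (1, 0)`. -/
def homCoord : WithTop ℝ → ℝ × ℝ
  | none => (1, 0)
  | some κ => (κ, 1)

/-- The difference `a - b` in homogeneous coordinates. -/
def homDiff (a b : WithTop ℝ) : ℝ :=
  (homCoord a).1 * (homCoord b).2 - (homCoord b).1 * (homCoord a).2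

/-- The cross-ratio `[a, b; c, d] = (a - b)(d - c) / ((a - c)(d - b))` of four distinct elements
of `ℝ ∪ {∞}`, with the usual conventions for `∞`; `[a, b; c, ∞] = (a - b) / (a - c)`. -/
def crossRatio (a b c d : WithTop ℝ) : ℝ :=
  (homDiff a b * homDiff d c) / (homDiff a c * homDiff d b)

/-! ### Legendre submanifolds

`F` is a Euclidean space and the ambient sphere is its unit sphere, of dimension
`n = dim F - 1`.  A contact element is a pair `(x, ξ)` of orthogonal unit vectors, and it is
identified with the line `[(1, x, 0), (0, ξ, 1)]` on the Lie quadric.  The contact condition on a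
family of contact elements is `⟪dx, ξ⟫ = 0`.  The product `F × F` is only used as a smooth
manifold. -/

section Legendre

variable {F : Type*} [NormedAddCommGroup F] [InnerProductSpace ℝ F]

/-- `B` is an embedded Legendre submanifold of the manifold of contact elements of the unit sphere
of `F`, of dimension `n - 1 = dim F - 2`. -/
structure IsLegendreSubmanifold (B : Set (F × F)) : Prop where
  unit_fst : ∀ p ∈ B, ‖p.1‖ = 1
  unit_snd : ∀ p ∈ B, ‖p.2‖ = 1
  orthogonal : ∀ p ∈ B, ⟪p.1, p.2⟫ = 0
  isSubmanifold : IsSubmanifold (Module.finrank ℝ F - 2) B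
  contact : ∀ p ∈ B, ∀ w ∈ tangentVectors B p, ⟪w.1, p.2⟫ = 0

/-- The ambient space `ℝ × F × ℝ` of the Lie quadric. -/
abbrev LieSpace (F : Type*) : Type _ := ℝ × F × ℝ

/-- The Lie form, of signature `(n + 1, 2)`. -/
def lieForm (z w : LieSpace F) : ℝ := -(z.1 * w.1) + ⟪z.2.1, w.2.1⟫ - z.2.2 * w.2.2

/-- `k₁ = (1, x, 0)`: the point sphere of the contact element `(x, ξ)`. -/
def pointSphere (p : F × F) : LieSpace F := (1, p.1, 0)

/-- `k₂ = (0, ξ, 1)`: the great sphere of the contact element `(x, ξ)`. -/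
def greatSphere (p : F × F) : LieSpace F := (0, p.2, 1)

/-- The projective line `[k₁, k₂]` on the Lie quadric given by a contact element. -/
def lieLine (p : F × F) : Submodule ℝ (LieSpace F) :=
  Submodule.span ℝ {pointSphere p, greatSphere p}

/-- The principal space of `κ` at `p = (x, ξ)`: all tangent vectors `(dx, dξ)` with
`dξ = -κ dx`, and with `dx = 0` for `κ = ∞`. -/
def principalSpace (B : Set (F × F)) (p : F × F) (κ : WithTop ℝ) : Set (F × F) :=
  {w | w ∈ tangentVectors B p ∧ (homCoord κ).1 • w.1 + (homCoord κ).2 • w.2 = 0}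

/-- The principal curvatures of `B` at `p`, in `ℝ ∪ {∞}`. -/
def principalCurvatures (B : Set (F × F)) (p : F × F) : Set (WithTop ℝ) :=
  {κ | ∃ w ∈ principalSpace B p κ, w ≠ 0}

/-- The Lie sphere `[κ k₁ + k₂]` at `p` (and `[k₁]` for `κ = ∞`), as a point of projective space,
that is, as a line through `0`; it is the curvature sphere if `κ` is a principal curvature. -/
def curvatureSphere (p : F × F) (κ : WithTop ℝ) : Submodule ℝ (LieSpace F) :=
  Submodule.span ℝ {(homCoord κ).1 • pointSphere p + (homCoord κ).2 • greatSphere p}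

/-- `S` is a (connected) curvature surface of `B` with corresponding principal curvature `κ`. -/
structure IsCurvatureSurface (B S : Set (F × F)) (κ : F × F → WithTop ℝ) : Prop where
  subset : S ⊆ B
  connected : IsConnected S
  isSubmanifold : ∃ k, IsSubmanifold k S
  principal : ∀ p ∈ S, κ p ∈ principalCurvatures B p
  tangent : ∀ p ∈ S, tangentVectors S p = principalSpace B p (κ p)

/-- `B` is a proper Dupin (Legendre) submanifold with `g` distinct principal curvatures: the
curvature sphere is constant along each curvature surface, and there are exactly `g` of them at
every point. -/
structure IsProperDupin (g : ℕ) (B : Set (F × F)) : Prop where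
  legendre : IsLegendreSubmanifold B
  dupin : ∀ S κ, IsCurvatureSurface B S κ →
    ∀ p ∈ S, ∀ q ∈ S, curvatureSphere p (κ p) = curvatureSphere q (κ q)
  proper : ∀ p ∈ B, (principalCurvatures B p).Finite ∧ (principalCurvatures B p).ncard = g

/-- `B` has exactly four principal curvatures `κ₁ < κ₂ < κ₃ < κ₄ ≤ ∞` at `p`, and its Lie
curvature `[κ₁, κ₂; κ₃, κ₄]` there is `ψ`. -/
def HasLieCurvature (B : Set (F × F)) (p : F × F) (ψ : ℝ) : Prop :=
  ∃ κ₁ κ₂ κ₃ κ₄ : WithTop ℝ, κ₁ < κ₂ ∧ κ₂ < κ₃ ∧ κ₃ < κ₄ ∧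
    principalCurvatures B p = {κ₁, κ₂, κ₃, κ₄} ∧ crossRatio κ₁ κ₂ κ₃ κ₄ = ψ

/-! ### Legendre lifts -/

/-- The unit normal bundle in the unit sphere of a submanifold `V` of the unit sphere; as a set of
contact elements it is the Legendre lift of `V`. -/
def unitNormalBundle (V : Set F) : Set (F × F) :=
  {p | p.1 ∈ V ∧ ‖p.2‖ = 1 ∧ ⟪p.1, p.2⟫ = 0 ∧ ∀ w ∈ tangentVectors V p.1, ⟪w, p.2⟫ = 0}

/-- `ν` is (on `M`) a smooth field of unit normals, in the unit sphere, of a hypersurface `M` of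
the unit sphere. -/
structure IsUnitNormalField (M : Set F) (ν : F → F) : Prop where
  smooth : ContDiffOn ℝ ∞ ν M
  unit : ∀ x ∈ M, ‖ν x‖ = 1
  orthogonal : ∀ x ∈ M, ⟪x, ν x⟫ = 0
  normal : ∀ x ∈ M, ∀ w ∈ tangentVectors M x, ⟪w, ν x⟫ = 0

/-- The Legendre lift of a hypersurface `M` oriented by `ν`.  Its principal curvatures are the
eigenvalues of the shape operator `A`, given by `dν = -A`. -/
def hypersurfaceLift (M : Set F) (ν : F → F) : Set (F × F) := (fun x => (x, ν x)) '' M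

/-- The tube of spherical radius `t` over `V`. -/
def tube (V : Set F) (t : ℝ) : Set F :=
  {y | ∃ p ∈ unitNormalBundle V, y = Real.cos t • p.1 + Real.sin t • p.2}

/-! ### Lie equivalence to an isoparametric hypersurface -/

/-- A Lie sphere transformation, represented by a linear automorphism: a projective
transformation that maps the Lie quadric to itself. -/
def IsLieSphereTransformation (A : LieSpace F ≃ₗ[ℝ] LieSpace F) : Prop :=
  ∀ z, lieForm (A z) (A z) = 0 ↔ lieForm z z = 0

/-- Some Lie sphere transformation maps the Legendre submanifold `B₁`, as a set of lines on the
quadric, onto `B₂`.  (No parametrization enters.  So Lie equivalence of parametrized Legendre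
submanifolds up to a diffeomorphism of their domains implies this.) -/
def LieEquivalent (B₁ B₂ : Set (F × F)) : Prop :=
  ∃ A : LieSpace F ≃ₗ[ℝ] LieSpace F, IsLieSphereTransformation A ∧
    (fun p => (lieLine p).map (A : LieSpace F →ₗ[ℝ] LieSpace F)) '' B₁ = lieLine '' B₂

section Immersed

variable (d : ℕ) {N : Type*} [TopologicalSpace N] [ChartedSpace (EuclideanSpace ℝ (Fin d)) N]

/-- The differential at `x` of a map from a `d`-dimensional manifold to `F`. -/
def differential (h : N → F) (x : N) : TangentSpace (𝓡 d) x →ₗ[ℝ] F :=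
  (mfderiv (𝓡 d) 𝓘(ℝ, F) h x).toLinearMap

/-- An immersed hypersurface `f` of the unit sphere of `F`, oriented by the field `ν` of unit
normals, is isoparametric: its principal curvatures (the eigenvalues `κ` of the shape operator,
`dν = -κ df`), with their multiplicities, are the same at all points. -/
structure IsIsoparametric (f ν : N → F) : Prop where
  smooth_immersion : ContMDiff (𝓡 d) 𝓘(ℝ, F) ∞ f
  smooth_normal : ContMDiff (𝓡 d) 𝓘(ℝ, F) ∞ ν
  dim_eq : d + 2 = Module.finrank ℝ F
  unit_immersion : ∀ x, ‖f x‖ = 1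
  unit_normal : ∀ x, ‖ν x‖ = 1
  orthogonal : ∀ x, ⟪f x, ν x⟫ = 0
  injective : ∀ x, Function.Injective (differential d f x)
  normal : ∀ x X, ⟪differential d f x X, ν x⟫ = 0
  constant : ∀ (x y : N) (κ : ℝ),
    Module.finrank ℝ (LinearMap.ker (differential d ν x + κ • differential d f x)) =
      Module.finrank ℝ (LinearMap.ker (differential d ν y + κ • differential d f y))

end Immersed

/-- The Legendre submanifold `B` is Lie equivalent to (the Legendre lift of) an oriented
isoparametric hypersurface of the unit sphere. -/
def LieEquivalentToIsoparametric (B : Set (F × F)) : Prop :=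
  ∃ (d : ℕ) (N : Type u) (_ : TopologicalSpace N) (_ : T2Space N)
    (_ : SecondCountableTopology N) (_ : ChartedSpace (EuclideanSpace ℝ (Fin d)) N)
    (_ : IsManifold (𝓡 d) ∞ N) (f ν : N → F),
    IsIsoparametric d f ν ∧ LieEquivalent B (Set.range fun x => (f x, ν x))

end Legendre

/-! ### Clifford–Stiefel manifolds and their deformations -/

/-- `ℝ^l × ℝ^l` with its Euclidean structure. -/
abbrev DoubleSpace (l : ℕ) : Type :=
  WithLp 2 (EuclideanSpace ℝ (Fin l) × EuclideanSpace ℝ (Fin l))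

/-- The matrices `E₁, …, E_k` are skew-symmetric and determine a representation of the Clifford
algebra `C_k` on `ℝ^l`. -/
structure IsCliffordRepresentation {k l : ℕ} (E : Fin k → Matrix (Fin l) (Fin l) ℝ) : Prop where
  skew : ∀ i, (E i).transpose = -E i
  sq : ∀ i, E i * E i = -1
  anticomm : ∀ i j, i ≠ j → E i * E j = -(E j * E i)

/-- The Clifford–Stiefel manifold `V₂(C_k)` of Clifford orthogonal 2-frames of length `1/√2`. -/
def cliffordStiefel {k l : ℕ} (E : Fin k → Matrix (Fin l) (Fin l) ℝ) : Set (DoubleSpace l) :=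
  {p | ‖p‖ = 1 ∧ ‖p.fst‖ = 1 / √2 ∧ ‖p.snd‖ = 1 / √2 ∧ ⟪p.fst, p.snd⟫ = 0 ∧
    ∀ i, ⟪Matrix.toEuclideanLin (E i) p.fst, p.snd⟫ = 0}

/-- The linear map `T_{α,β}(u, v) = √2 (α u, β v)`. -/
def stretch {l : ℕ} (α β : ℝ) (p : DoubleSpace l) : DoubleSpace l :=
  √2 • WithLp.toLp 2 (α • p.fst, β • p.snd)

/-- The image `V₂^{α,β} = T_{α,β}(V₂(C_k))`. -/
def stretchedStiefel {k l : ℕ} (E : Fin k → Matrix (Fin l) (Fin l) ℝ) (α β : ℝ) :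
    Set (DoubleSpace l) :=
  stretch α β '' cliffordStiefel E

/-- The vector `ξ(u, v) = (-(β/α) u, (α/β) v)`. -/
def specialNormal {l : ℕ} (α β : ℝ) (p : DoubleSpace l) : DoubleSpace l :=
  WithLp.toLp 2 (-(β / α) • p.fst, (α / β) • p.snd)

end LieSphere

end

/-!
The Clifford–Stiefel manifold is the focal set `⟪P y x, x⟫ = 0`, `⟪x, x⟫ = 1` of a Clifford system
`P`, and `V` is its image under a linear map `T` with `T² = 1 + δ P e`. At a contact element of
`B(V)` the principal curvatures are `∞`, `0` and the two roots of `κ² - 2 s κ - 1`, where `s` is a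
function on `B(V)` given by the normal direction. Each of the four is the value of a smooth function
whose derivative vanishes along its own principal space, so `V` is proper Dupin.

A Lie sphere transformation acts on the homogeneous curvature coordinates over a fixed line by an
invertible linear map, so it preserves harmonic quadruples of principal curvatures. The quadruple
`∞, 0, κ, -1/κ` over `V` is harmonic exactly when `s = 0`, that is, when the normal direction is
orthogonal to `e`. This happens somewhere on `B(V)`, but not at `± ξ` when `α² ≠ β²`, whereas on an
isoparametric hypersurface the quadruple is the same at every point. Tubes inherit all this because
`(x, ξ) ↦ (cos t x + sin t ξ, -sin t x + cos t ξ)` rotates the homogeneous curvature coordinates.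
-/

noncomputable section

namespace LieSphere

open Filter Topology

section Submanifolds

variable {E : Type*} [NormedAddCommGroup E] [NormedSpace ℝ E]
  {E' : Type*} [NormedAddCommGroup E'] [NormedSpace ℝ E']

theorem exists_smooth_openPartialHomeomorph [CompleteSpace E] {f : E → E'} {U : Set E}
    (hU : IsOpen U) (hf : ContDiffOn ℝ ∞ f U) {p : E} (hp : p ∈ U) {e : E ≃L[ℝ] E'}
    (he : HasFDerivAt f (e : E →L[ℝ] E') p) :
    ∃ Φ : OpenPartialHomeomorph E E', p ∈ Φ.source ∧ Φ.source ⊆ U ∧ (∀ x, Φ x = f x) ∧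
      ContDiffOn ℝ ∞ Φ Φ.source ∧ ContDiffOn ℝ ∞ Φ.symm Φ.target := by
  have hstrict : HasStrictFDerivAt f (e : E →L[ℝ] E') p :=
    (hf.contDiffAt (hU.mem_nhds hp)).hasStrictFDerivAt' he (by simp)
  have hcont : ContinuousOn (fderiv ℝ f) U := hf.continuousOn_fderiv_of_isOpen hU (by simp)
  have hU' : IsOpen (U ∩ fderiv ℝ f ⁻¹' Set.range ((↑) : (E ≃L[ℝ] E') → E →L[ℝ] E')) :=
    hcont.isOpen_inter_preimage hU ContinuousLinearEquiv.isOpen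
  set Φ := (hstrict.toOpenPartialHomeomorph f).restrOpen _ hU'
  refine ⟨Φ, ⟨hstrict.mem_toOpenPartialHomeomorph_source, hp, e, he.fderiv.symm⟩,
    fun x hx => hx.2.1, fun x => rfl, hf.mono fun x hx => hx.2.1, fun y hy => ?_⟩
  obtain ⟨-, hxU, e', he'⟩ := Φ.map_target hy
  have hfx : ContDiffAt ℝ ∞ f (Φ.symm y) := hf.contDiffAt (hU.mem_nhds hxU)
  have hd : HasFDerivAt f (e' : E →L[ℝ] E') (Φ.symm y) := by
    rw [he']
    exact (hfx.differentiableAt (by simp)).hasFDerivAt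
  exact (Φ.contDiffAt_symm hy hd hfx).contDiffWithinAt

/-- `Φ` is a smooth diffeomorphism between open sets that straightens `S` to `W`; this is the
condition imposed on the charts in `IsSubmanifold`. -/
structure IsStraightening (S : Set E) (Φ : OpenPartialHomeomorph E E) (W : Submodule ℝ E) :
    Prop where
  contDiffOn : ContDiffOn ℝ ∞ Φ Φ.source
  contDiffOn_symm : ContDiffOn ℝ ∞ Φ.symm Φ.target
  mem_iff : ∀ x ∈ Φ.source, x ∈ S ↔ Φ x ∈ W

theorem isSubmanifold_iff {k : ℕ} {S : Set E} :
    IsSubmanifold k S ↔ ∀ p ∈ S, ∃ (Φ : OpenPartialHomeomorph E E) (W : Submodule ℝ E),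
      p ∈ Φ.source ∧ Module.finrank ℝ W = k ∧ IsStraightening S Φ W :=
  ⟨fun h p hp => let ⟨Φ, W, h1, h2, h3, h4, h5⟩ := h p hp; ⟨Φ, W, h1, h4, h2, h3, h5⟩,
    fun h p hp => let ⟨Φ, W, h1, h4, h⟩ := h p hp; ⟨Φ, W, h1, h.1, h.2, h4, h.3⟩⟩

namespace IsStraightening

variable {S : Set E} {Φ : OpenPartialHomeomorph E E} {W : Submodule ℝ E}

theorem contDiffAt (h : IsStraightening S Φ W) {x : E} (hx : x ∈ Φ.source) :
    ContDiffAt ℝ ∞ Φ x :=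
  h.contDiffOn.contDiffAt (Φ.open_source.mem_nhds hx)

theorem contDiffAt_symm (h : IsStraightening S Φ W) {y : E} (hy : y ∈ Φ.target) :
    ContDiffAt ℝ ∞ Φ.symm y :=
  h.contDiffOn_symm.contDiffAt (Φ.open_target.mem_nhds hy)

theorem hasFDerivAt (h : IsStraightening S Φ W) {x : E} (hx : x ∈ Φ.source) :
    HasFDerivAt Φ (fderiv ℝ Φ x) x :=
  ((h.contDiffAt hx).differentiableAt (by simp)).hasFDerivAt

theorem hasFDerivAt_symm (h : IsStraightening S Φ W) {y : E} (hy : y ∈ Φ.target) :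
    HasFDerivAt Φ.symm (fderiv ℝ Φ.symm y) y :=
  ((h.contDiffAt_symm hy).differentiableAt (by simp)).hasFDerivAt

theorem fderiv_symm_apply (h : IsStraightening S Φ W) {x : E} (hx : x ∈ Φ.source) (w : E) :
    fderiv ℝ Φ.symm (Φ x) (fderiv ℝ Φ x w) = w := by
  have hcomp := (h.hasFDerivAt_symm (Φ.map_source hx)).comp x (h.hasFDerivAt hx)
  have hid : HasFDerivAt (Φ.symm ∘ Φ) (ContinuousLinearMap.id ℝ E) x :=
    (hasFDerivAt_id x).congr_of_eventuallyEq (Φ.eventually_left_inverse hx)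
  exact DFunLike.congr_fun (hcomp.unique hid) w

theorem fderiv_apply_symm (h : IsStraightening S Φ W) {x : E} (hx : x ∈ Φ.source) (w : E) :
    fderiv ℝ Φ x (fderiv ℝ Φ.symm (Φ x) w) = w := by
  have hx' : HasFDerivAt Φ (fderiv ℝ Φ x) (Φ.symm (Φ x)) := by
    rw [Φ.left_inv hx]; exact h.hasFDerivAt hx
  have hcomp := hx'.comp (Φ x) (h.hasFDerivAt_symm (Φ.map_source hx))
  have hid : HasFDerivAt (Φ ∘ Φ.symm) (ContinuousLinearMap.id ℝ E) (Φ x) :=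
    (hasFDerivAt_id _).congr_of_eventuallyEq (Φ.eventually_right_inverse (Φ.map_source hx))
  exact DFunLike.congr_fun (hcomp.unique hid) w

theorem symm_mem (h : IsStraightening S Φ W) {y : E} (hy : y ∈ Φ.target) (hW : y ∈ W) :
    Φ.symm y ∈ S :=
  (h.mem_iff _ (Φ.map_target hy)).2 (by rwa [Φ.right_inv hy])

theorem fderiv_mem (h : IsStraightening S Φ W) [FiniteDimensional ℝ E] {p w : E}
    (hp : p ∈ Φ.source) (hpS : p ∈ S) (hw : w ∈ tangentVectors S p) : fderiv ℝ Φ p w ∈ W := by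
  obtain ⟨γ, hγ, rfl, hd, hS⟩ := hw
  have hd' : HasDerivAt (Φ ∘ γ) (fderiv ℝ Φ (γ 0) w) 0 :=
    (h.hasFDerivAt hp).comp_hasDerivAt (0 : ℝ) hd
  refine W.closed_of_finiteDimensional.mem_of_tendsto (hasDerivAt_iff_tendsto_slope.1 hd')
    (nhdsWithin_le_nhds ?_)
  filter_upwards [hS, hγ.continuousAt (Φ.open_source.mem_nhds hp)] with t ht ht'
  rw [slope_def_module]
  exact W.smul_mem _ (W.sub_mem ((h.mem_iff _ ht').1 ht) ((h.mem_iff _ hp).1 hpS))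

theorem fderiv_symm_mem_tangentVectors (h : IsStraightening S Φ W) {p v : E}
    (hp : p ∈ Φ.source) (hpS : p ∈ S) (hv : v ∈ W) :
    fderiv ℝ Φ.symm (Φ p) v ∈ tangentVectors S p := by
  have hline : ContDiffAt ℝ ∞ (fun t : ℝ => Φ p + t • v) 0 := by fun_prop
  have hd : HasDerivAt (fun t : ℝ => Φ p + t • v) v 0 := by
    simpa using ((hasDerivAt_id (0 : ℝ)).smul_const v).const_add (Φ p)
  have h0 : Φ p + (0 : ℝ) • v = Φ p := by simp
  have hpt := Φ.map_source hp
  rw [← h0] at hpt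
  refine ⟨fun t => Φ.symm (Φ p + t • v), (h.contDiffAt_symm hpt).comp (0 : ℝ) hline,
    by simp [Φ.left_inv hp], ?_, ?_⟩
  · have := (h.hasFDerivAt_symm hpt).comp_hasDerivAt (0 : ℝ) hd
    rwa [h0] at this
  · filter_upwards [hline.continuousAt (Φ.open_target.mem_nhds hpt)] with t ht
    exact h.symm_mem ht (W.add_mem ((h.mem_iff _ hp).1 hpS) (W.smul_mem _ hv))

theorem mem_tangentVectors_iff [FiniteDimensional ℝ E] (h : IsStraightening S Φ W) {p w : E}
    (hp : p ∈ Φ.source) (hpS : p ∈ S) : w ∈ tangentVectors S p ↔ fderiv ℝ Φ p w ∈ W := by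
  refine ⟨h.fderiv_mem hp hpS, fun hw => ?_⟩
  rw [← h.fderiv_symm_apply hp w]
  exact h.fderiv_symm_mem_tangentVectors hp hpS hw

theorem restr (h : IsStraightening S Φ W) {U : Set E} (hU : IsOpen U) {S' : Set E}
    (hS : ∀ x ∈ U, x ∈ S ↔ x ∈ S') : IsStraightening S' (Φ.restrOpen U hU) W where
  contDiffOn := h.contDiffOn.mono fun _ hx => hx.1
  contDiffOn_symm := h.contDiffOn_symm.mono fun _ hy => hy.1
  mem_iff x hx := (hS x hx.2).symm.trans (h.mem_iff x hx.1)

theorem injective_fderiv_comp_symm (h : IsStraightening S Φ W) {f : E → E'} {p : E}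
    (hf : DifferentiableAt ℝ f p) (hp : p ∈ Φ.source) (hpS : p ∈ S)
    (himm : ∀ w ∈ tangentVectors S p, fderiv ℝ f p w = 0 → w = 0) :
    Function.Injective (fderiv ℝ (fun v : W => f (Φ.symm v)) ⟨Φ p, (h.mem_iff p hp).1 hpS⟩) := by
  set x : W := ⟨Φ p, (h.mem_iff p hp).1 hpS⟩
  have hderiv : HasFDerivAt (fun v : W => f (Φ.symm v))
      ((fderiv ℝ f p).comp ((fderiv ℝ Φ.symm (Φ p)).comp W.subtypeL)) x := by
    have hfp : HasFDerivAt f (fderiv ℝ f p) (Φ.symm x) := by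
      rw [Φ.left_inv hp]
      exact hf.hasFDerivAt
    exact hfp.comp x ((h.hasFDerivAt_symm (Φ.map_source hp)).comp x W.subtypeL.hasFDerivAt)
  rw [hderiv.fderiv]
  refine (injective_iff_map_eq_zero _).2 fun v hv => Subtype.ext ?_
  have hv0 := himm _ (h.fderiv_symm_mem_tangentVectors hp hpS v.2) hv
  simpa [hv0] using (h.fderiv_apply_symm hp (v : E)).symm

end IsStraightening

theorem isSubmanifold_of_locally {k : ℕ} {S : Set E}
    (h : ∀ p ∈ S, ∃ S', IsSubmanifold k S' ∧ ∀ᶠ x in 𝓝 p, x ∈ S ↔ x ∈ S') :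
    IsSubmanifold k S := by
  rw [isSubmanifold_iff]
  intro p hp
  obtain ⟨S', hS', hev⟩ := h p hp
  obtain ⟨U, hU, hUo, hpU⟩ := eventually_nhds_iff.1 hev
  obtain ⟨Φ, W, hpΦ, hW, hΦ⟩ := isSubmanifold_iff.1 hS' p ((hU p hpU).1 hp)
  exact ⟨Φ.restrOpen U hUo, W, ⟨hpΦ, hpU⟩, hW, hΦ.restr hUo fun x hx => (hU x hx).symm⟩

theorem mem_tangentVectors_image {S : Set E} {p w : E} {f : E → E'} {f' : E →L[ℝ] E'}
    {S' : Set E'} (hf : ContDiffAt ℝ ∞ f p) (hf' : HasFDerivAt f f' p)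
    (hS : ∀ᶠ x in 𝓝 p, x ∈ S → f x ∈ S') (hw : w ∈ tangentVectors S p) :
    f' w ∈ tangentVectors S' (f p) := by
  obtain ⟨γ, hγ, rfl, hd, hγS⟩ := hw
  refine ⟨f ∘ γ, hf.comp (0 : ℝ) hγ, rfl, hf'.comp_hasDerivAt (0 : ℝ) hd, ?_⟩
  filter_upwards [hγS, hγ.continuousAt.eventually hS] with t ht hSt using hSt ht

namespace IsSubmanifold

variable {k : ℕ} {S : Set E} {p : E}

theorem eventually_eq_of_fderiv_tangentVectors_eq_zero (hS : IsSubmanifold k S) (hp : p ∈ S)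
    {f : E → E'} (hf : ∀ᶠ q in 𝓝[S] p,
      ∃ f' : E →L[ℝ] E', HasFDerivAt f f' q ∧ ∀ w ∈ tangentVectors S q, f' w = 0) :
    ∀ᶠ q in 𝓝[S] p, f q = f p := by
  obtain ⟨Φ, W, hpΦ, -, hΦ⟩ := isSubmanifold_iff.1 hS p hp
  have hpW := (hΦ.mem_iff p hpΦ).1 hp
  obtain ⟨U, hU, hUf⟩ := eventually_iff_exists_mem.1 (eventually_nhdsWithin_iff.1 hf)
  have hnhds : Φ.target ∩ Φ.symm ⁻¹' U ∈ 𝓝 (Φ p) :=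
    inter_mem (Φ.open_target.mem_nhds (Φ.map_source hpΦ)) <|
      (hΦ.contDiffAt_symm (Φ.map_source hpΦ)).continuousAt (by rwa [Φ.left_inv hpΦ])
  obtain ⟨ε, hε, hball⟩ := Metric.mem_nhds_iff.1 hnhds
  have hderiv : ∀ v ∈ Metric.ball (⟨Φ p, hpW⟩ : W) ε,
      HasFDerivAt (fun v : W => f (Φ.symm v)) (0 : W →L[ℝ] E') v := by
    intro v hv
    have hvΦ := hball (show (v : E) ∈ Metric.ball (Φ p) ε from hv)
    have hvS := hΦ.symm_mem hvΦ.1 v.2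
    obtain ⟨f', hf', h0⟩ := hUf _ hvΦ.2 hvS
    refine (hf'.comp v ((hΦ.hasFDerivAt_symm hvΦ.1).comp v W.subtypeL.hasFDerivAt)).congr_fderiv ?_
    ext u
    have hu := hΦ.fderiv_symm_mem_tangentVectors (Φ.map_target hvΦ.1) hvS u.2
    rw [Φ.right_inv hvΦ.1] at hu
    exact h0 _ hu
  have hconst : ∀ v ∈ Metric.ball (⟨Φ p, hpW⟩ : W) ε, f (Φ.symm v) = f (Φ.symm (Φ p)) :=
    fun v hv => (convex_ball _ ε).is_const_of_fderivWithin_eq_zero (𝕜 := ℝ)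
      (f := fun v : W => f (Φ.symm v))
      (fun v hv => (hderiv v hv).differentiableAt.differentiableWithinAt)
      (fun v hv => (hderiv v hv).hasFDerivWithinAt.fderivWithin
        (Metric.isOpen_ball.uniqueDiffWithinAt hv)) hv (Metric.mem_ball_self hε)
  refine eventually_nhdsWithin_iff.2 ?_
  filter_upwards [Φ.open_source.mem_nhds hpΦ,
    (hΦ.contDiffAt hpΦ).continuousAt (Metric.ball_mem_nhds _ hε)] with q hqΦ hqε hqS
  simpa only [Φ.left_inv hqΦ, Φ.left_inv hpΦ] using hconst ⟨Φ q, (hΦ.mem_iff q hqΦ).1 hqS⟩ hqε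

variable [FiniteDimensional ℝ E]

theorem exists_tangentSpace (hS : IsSubmanifold k S) (hp : p ∈ S) :
    ∃ T : Submodule ℝ E, Module.finrank ℝ T = k ∧ (T : Set E) = tangentVectors S p := by
  obtain ⟨Φ, W, hpΦ, hW, hΦ⟩ := isSubmanifold_iff.1 hS p hp
  let e : E ≃ₗ[ℝ] E := LinearEquiv.ofBijective (fderiv ℝ Φ p).toLinearMap
    ⟨Function.LeftInverse.injective (hΦ.fderiv_symm_apply hpΦ),
      Function.RightInverse.surjective (hΦ.fderiv_apply_symm hpΦ)⟩
  refine ⟨W.comap e.toLinearMap, ?_, ?_⟩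
  · rw [← hW, Submodule.comap_equiv_eq_map_symm]
    exact LinearEquiv.finrank_map_eq e.symm W
  · ext w
    exact (hΦ.mem_tangentVectors_iff hpΦ hp).symm

theorem exists_continuousAt_tangentField (hS : IsSubmanifold k S) (hp : p ∈ S) {w : E}
    (hw : w ∈ tangentVectors S p) :
    ∃ η : E → E, ContinuousAt η p ∧ η p = w ∧ ∀ᶠ q in 𝓝[S] p, η q ∈ tangentVectors S q := by
  obtain ⟨Φ, W, hpΦ, -, hΦ⟩ := isSubmanifold_iff.1 hS p hp
  refine ⟨fun q => fderiv ℝ Φ.symm (Φ q) (fderiv ℝ Φ p w), ?_, hΦ.fderiv_symm_apply hpΦ w, ?_⟩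
  · have hfderiv : ContinuousAt (fderiv ℝ Φ.symm) (Φ p) :=
      (hΦ.contDiffOn_symm.continuousOn_fderiv_of_isOpen Φ.open_target (by simp)).continuousAt
        (Φ.open_target.mem_nhds (Φ.map_source hpΦ))
    exact (ContinuousAt.comp (f := Φ) hfderiv (hΦ.contDiffAt hpΦ).continuousAt).clm_apply
      continuousAt_const
  · refine eventually_nhdsWithin_iff.2 ?_
    filter_upwards [Φ.open_source.mem_nhds hpΦ] with q hq hqS
    exact hΦ.fderiv_symm_mem_tangentVectors hq hqS (hΦ.fderiv_mem hpΦ hp hw)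

end IsSubmanifold

section FiniteDimensional

variable [FiniteDimensional ℝ E]

theorem exists_straightening_levelSet [FiniteDimensional ℝ E'] {G : E → E'}
    (hG : ContDiff ℝ ∞ G) {p : E} (hp : Function.Surjective (fderiv ℝ G p)) :
    ∃ Φ : OpenPartialHomeomorph E E, p ∈ Φ.source ∧
      IsStraightening {x | G x = 0} Φ (LinearMap.ker (fderiv ℝ G p).toLinearMap) ∧
      HasFDerivAt Φ (ContinuousLinearMap.id ℝ E) p := by
  set A := fderiv ℝ G p
  obtain ⟨s, hs⟩ := A.toLinearMap.exists_rightInverse_of_surjective (LinearMap.range_eq_top.2 hp)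
  set s' : E' →L[ℝ] E := s.toContinuousLinearMap
  have hAs : ∀ y, A (s' y) = y := DFunLike.congr_fun hs
  have hfd : HasFDerivAt (fun x => x - s' (A x) + s' (G x))
      ((ContinuousLinearEquiv.refl ℝ E : E ≃L[ℝ] E) : E →L[ℝ] E) p := by
    have hGp : HasFDerivAt G A p := (hG.differentiable (by simp) p).hasFDerivAt
    refine (((hasFDerivAt_id p).sub (s'.comp A).hasFDerivAt).add
      (s'.hasFDerivAt.comp p hGp)).congr_fderiv ?_
    ext x
    simp
  obtain ⟨Φ, hpΦ, -, hΦf, hΦ, hΦsymm⟩ := exists_smooth_openPartialHomeomorph isOpen_univ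
    (by fun_prop : ContDiff ℝ ∞ fun x => x - s' (A x) + s' (G x)).contDiffOn (Set.mem_univ p) hfd
  refine ⟨Φ, hpΦ, ⟨hΦ, hΦsymm, fun x _ => ?_⟩,
    hfd.congr_of_eventuallyEq (Eventually.of_forall hΦf)⟩
  simp [hΦf, hAs]

theorem isSubmanifold_levelSet [FiniteDimensional ℝ E'] {G : E → E'} (hG : ContDiff ℝ ∞ G)
    (hs : ∀ p, G p = 0 → Function.Surjective (fderiv ℝ G p)) {k : ℕ}
    (hk : k + Module.finrank ℝ E' = Module.finrank ℝ E) : IsSubmanifold k {x | G x = 0} := by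
  rw [isSubmanifold_iff]
  intro p hp
  obtain ⟨Φ, hpΦ, hΦ, -⟩ := exists_straightening_levelSet hG (hs p hp)
  refine ⟨Φ, _, hpΦ, ?_, hΦ⟩
  have := (fderiv ℝ G p).toLinearMap.finrank_range_add_finrank_ker
  rw [LinearMap.range_eq_top.2 (hs p hp), finrank_top] at this
  omega

theorem tangentVectors_levelSet [FiniteDimensional ℝ E'] {G : E → E'} (hG : ContDiff ℝ ∞ G)
    {p : E} (h0 : G p = 0) (hp : Function.Surjective (fderiv ℝ G p)) :
    tangentVectors {x | G x = 0} p = {w | fderiv ℝ G p w = 0} := by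
  obtain ⟨Φ, hpΦ, hΦ, hid⟩ := exists_straightening_levelSet hG hp
  ext w
  rw [hΦ.mem_tangentVectors_iff hpΦ h0, hid.fderiv]
  simp

end FiniteDimensional

theorem exists_immersion_normalForm [FiniteDimensional ℝ E'] {h : E → E'} {O : Set E}
    (hO : IsOpen O) (hh : ContDiffOn ℝ ∞ h O) {x : E} (hx : x ∈ O)
    (himm : Function.Injective (fderiv ℝ h x)) :
    ∃ (A : E →L[ℝ] E') (π : E' →L[ℝ] E) (Ψ : OpenPartialHomeomorph E' E'),
      Function.LeftInverse π A ∧ A x ∈ Ψ.source ∧ Set.MapsTo π Ψ.source O ∧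
      (∀ z, Ψ (A z) = h z) ∧ ContDiffOn ℝ ∞ Ψ Ψ.source ∧ ContDiffOn ℝ ∞ Ψ.symm Ψ.target := by
  set A := fderiv ℝ h x
  obtain ⟨π₀, hπ₀⟩ :=
    A.toLinearMap.exists_leftInverse_of_injective (LinearMap.ker_eq_bot.2 himm)
  set π : E' →L[ℝ] E := π₀.toContinuousLinearMap
  have hπA : Function.LeftInverse π A := DFunLike.congr_fun hπ₀
  have hsmooth : ContDiffOn ℝ ∞ (fun y => h (π y) + (y - A (π y))) (π ⁻¹' O) :=
    (hh.comp π.contDiff.contDiffOn fun _ hy => hy).add (by fun_prop)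
  have hderiv : HasFDerivAt (fun y => h (π y) + (y - A (π y)))
      ((ContinuousLinearEquiv.refl ℝ E' : E' ≃L[ℝ] E') : E' →L[ℝ] E') (A x) := by
    have hhx : HasFDerivAt h A (π (A x)) := by
      rw [hπA x]
      exact ((hh.contDiffAt (hO.mem_nhds hx)).differentiableAt (by simp)).hasFDerivAt
    refine ((hhx.comp (A x) π.hasFDerivAt).add
      ((hasFDerivAt_id (A x)).sub (A.comp π).hasFDerivAt)).congr_fderiv ?_
    ext y
    simp
  obtain ⟨Ψ, hxΨ, hΨO, hΨ, hΨs, hΨs'⟩ := exists_smooth_openPartialHomeomorph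
    (hO.preimage π.continuous) hsmooth (by rwa [Set.mem_preimage, hπA x]) hderiv
  exact ⟨A, π, Ψ, hπA, hxΨ, hΨO, fun z => by simp [hΨ, hπA z], hΨs, hΨs'⟩

/-- A continuous inverse of a parametrization is automatically smooth, which is why only
continuity is required of `c`. -/
theorem exists_straightening_of_parametrization [FiniteDimensional ℝ E'] {S : Set E'} {h : E → E'}
    {O : Set E} (hO : IsOpen O) (hh : ContDiffOn ℝ ∞ h O) (hhS : Set.MapsTo h O S) {x : E}
    (hx : x ∈ O) (himm : Function.Injective (fderiv ℝ h x)) {c : E' → E}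
    (hc : Tendsto c (𝓝[S] (h x)) (𝓝 x)) (hhc : ∀ᶠ y in 𝓝[S] (h x), h (c y) = y) :
    ∃ (Ψ : OpenPartialHomeomorph E' E') (W : Submodule ℝ E'), h x ∈ Ψ.source ∧
      Module.finrank ℝ W = Module.finrank ℝ E ∧ IsStraightening S Ψ W ∧
      ∃ g : E' → E, ContDiffAt ℝ ∞ g (h x) ∧ g (h x) = x ∧ ∀ᶠ y in 𝓝[S] (h x), g y = c y := by
  obtain ⟨A, π, Ψ, hπA, hxΨ, hΨO, hΨ, hΨs, hΨs'⟩ := exists_immersion_normalForm hO hh hx himm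
  have hcΨ : ∀ᶠ y in 𝓝[S] (h x), A (c y) ∈ Ψ.source :=
    hc.eventually (A.continuous.continuousAt (Ψ.open_source.mem_nhds hxΨ))
  obtain ⟨U, hU, hUo, hxU⟩ :=
    eventually_nhds_iff.1 (eventually_nhdsWithin_iff.1 (hhc.and hcΨ))
  have hxt : h x ∈ Ψ.target := by rw [← hΨ]; exact Ψ.map_source hxΨ
  have hsymm : ∀ y ∈ U, y ∈ S → Ψ.symm y = A (c y) := by
    intro y hy hyS
    obtain ⟨hcy, hcyΨ⟩ := hU y hy hyS
    rw [← Ψ.left_inv hcyΨ, hΨ, hcy]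
  have hΨx : Ψ.symm (h x) = A x := by rw [← hΨ, Ψ.left_inv hxΨ]
  refine ⟨Ψ.symm.restrOpen U hUo, LinearMap.range A.toLinearMap, ⟨hxt, hxU⟩,
    LinearMap.finrank_range_of_inj hπA.injective,
    ⟨hΨs'.mono fun y hy => hy.1, hΨs.mono fun y hy => hy.1, ?_⟩,
    fun y => π (Ψ.symm y), ?_, ?_, ?_⟩
  · rintro y ⟨hyΨ, hyU⟩
    refine ⟨fun hyS => ⟨c y, (hsymm y hyU hyS).symm⟩, ?_⟩
    rintro ⟨z, hz : A z = Ψ.symm y⟩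
    have hzO := hΨO (Ψ.map_target hyΨ)
    change π (Ψ.symm y) ∈ O at hzO
    rw [← hz, hπA z] at hzO
    rw [← Ψ.right_inv hyΨ, ← show A z = Ψ.symm y from hz, hΨ]
    exact hhS hzO
  · exact π.contDiff.contDiffAt.comp (h x) (hΨs'.contDiffAt (Ψ.open_target.mem_nhds hxt))
  · simp only [hΨx, hπA x]
  · refine eventually_nhdsWithin_iff.2 ?_
    filter_upwards [hUo.mem_nhds hxU] with y hy hyS
    rw [hsymm y hy hyS, hπA (c y)]

theorem map_nhdsWithin_of_isEmbedding {X X' : Type*} [TopologicalSpace X] [TopologicalSpace X']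
    {S : Set X} {f : X → X'} (hf : IsEmbedding fun q : S => f q) {p : X} (hp : p ∈ S) :
    map f (𝓝[S] p) = 𝓝[f '' S] (f p) := by
  rw [nhdsWithin_eq_map_subtype_coe hp, map_map, Set.image_eq_range]
  exact hf.map_nhds_eq ⟨p, hp⟩

namespace IsSubmanifold

variable [FiniteDimensional ℝ E] [FiniteDimensional ℝ E'] {k : ℕ} {S : Set E} {f : E → E'}

theorem exists_straightening_image (hS : IsSubmanifold k S) (hf : ContDiff ℝ ∞ f)
    (hemb : IsEmbedding fun q : S => f q) {p : E} (hp : p ∈ S)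
    (himm : ∀ w ∈ tangentVectors S p, fderiv ℝ f p w = 0 → w = 0) :
    ∃ (Ψ : OpenPartialHomeomorph E' E') (W : Submodule ℝ E'), f p ∈ Ψ.source ∧
      Module.finrank ℝ W = k ∧ IsStraightening (f '' S) Ψ W ∧
      ∃ g : E' → E, ContDiffAt ℝ ∞ g (f p) ∧ g (f p) = p ∧ ∀ᶠ q in 𝓝[S] p, g (f q) = q := by
  obtain ⟨Φ, W, hpΦ, hW, hΦ⟩ := isSubmanifold_iff.1 hS p hp
  obtain ⟨P, hP⟩ := W.subtype.exists_leftInverse_of_injective W.ker_subtype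
  have hPW : ∀ v (hv : v ∈ W), P v = ⟨v, hv⟩ := fun v hv => DFunLike.congr_fun hP ⟨v, hv⟩
  have hpW := (hΦ.mem_iff p hpΦ).1 hp
  have hpt := Φ.map_source hpΦ
  have hx : f (Φ.symm (Φ p)) = f p := by rw [Φ.left_inv hpΦ]
  have hsource : ∀ᶠ q in 𝓝[S] p, q ∈ S ∧ q ∈ Φ.source :=
    eventually_mem_nhdsWithin.and (nhdsWithin_le_nhds (Φ.open_source.mem_nhds hpΦ))
  have hinv : ∀ᶠ q in 𝓝[S] p, Function.invFunOn f S (f q) = q :=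
    eventually_mem_nhdsWithin.mono fun q hq =>
      (Set.injOn_iff_injective.2 hemb.injective).leftInvOn_invFunOn hq
  have hcont : ContinuousAt (fun q => P (Φ q)) p :=
    P.continuous_of_finiteDimensional.continuousAt.comp (hΦ.contDiffAt hpΦ).continuousAt
  obtain ⟨Ψ, W', hΨ, hW', hstr, g, hg, hgx, hgc⟩ := exists_straightening_of_parametrization
    (S := f '' S) (h := fun v : W => f (Φ.symm v)) (O := W.subtypeL ⁻¹' Φ.target)
    (c := fun y => P (Φ (Function.invFunOn f S y)))
    (Φ.open_target.preimage W.subtypeL.continuous)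
    (hf.comp_contDiffOn (hΦ.contDiffOn_symm.comp W.subtypeL.contDiff.contDiffOn fun _ hv => hv))
    (fun v hv => ⟨_, hΦ.symm_mem hv v.2, rfl⟩) hpt
    (hΦ.injective_fderiv_comp_symm (hf.differentiable (by simp) p) hpΦ hp himm)
    (by
      rw [hx, ← map_nhdsWithin_of_isEmbedding hemb hp, tendsto_map'_iff, ← hPW _ hpW]
      refine (hcont.tendsto.mono_left nhdsWithin_le_nhds).congr' (hinv.mono fun q hq => ?_)
      simp only [Function.comp_apply, hq])
    (by
      rw [hx, ← map_nhdsWithin_of_isEmbedding hemb hp, eventually_map]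
      filter_upwards [hinv, hsource] with q hq ⟨hqS, hqΦ⟩
      rw [hq, hPW _ ((hΦ.mem_iff q hqΦ).1 hqS), Φ.left_inv hqΦ])
  rw [hx] at hΨ hg hgx hgc
  rw [← map_nhdsWithin_of_isEmbedding hemb hp, eventually_map] at hgc
  have hgp : Φ.symm (g (f p)) = p := by rw [hgx, Φ.left_inv hpΦ]
  refine ⟨Ψ, W', hΨ, hW'.trans hW, hstr, fun y => Φ.symm (g y), ?_, hgp, ?_⟩
  · have hsymm : ContDiffAt ℝ ∞ Φ.symm (g (f p)) := by
      rw [hgx]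
      exact hΦ.contDiffAt_symm hpt
    exact hsymm.comp (f p) (W.subtypeL.contDiff.contDiffAt.comp (f p) hg)
  · filter_upwards [hgc, hinv, hsource] with q hq hqinv ⟨hqS, hqΦ⟩
    rw [hq, hqinv, hPW _ ((hΦ.mem_iff q hqΦ).1 hqS), Φ.left_inv hqΦ]

theorem image (hS : IsSubmanifold k S) (hf : ContDiff ℝ ∞ f)
    (hemb : IsEmbedding fun q : S => f q)
    (himm : ∀ p ∈ S, ∀ w ∈ tangentVectors S p, fderiv ℝ f p w = 0 → w = 0) :
    IsSubmanifold k (f '' S) := by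
  rw [isSubmanifold_iff, Set.forall_mem_image]
  intro p hp
  obtain ⟨Ψ, W, hΨ, hW, hstr, -⟩ := hS.exists_straightening_image hf hemb hp (himm p hp)
  exact ⟨Ψ, W, hΨ, hW, hstr⟩

theorem exists_local_leftInverse (hS : IsSubmanifold k S) (hf : ContDiff ℝ ∞ f)
    (hemb : IsEmbedding fun q : S => f q) {p : E} (hp : p ∈ S)
    (himm : ∀ w ∈ tangentVectors S p, fderiv ℝ f p w = 0 → w = 0) :
    ∃ g : E' → E, ContDiffAt ℝ ∞ g (f p) ∧ g (f p) = p ∧ ∀ᶠ q in 𝓝[S] p, g (f q) = q := by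
  obtain ⟨-, -, -, -, -, hg⟩ := hS.exists_straightening_image hf hemb hp himm
  exact hg

end IsSubmanifold

end Submanifolds

section HomogeneousCoordinates

/-- The element of `ℝ ∪ {∞}` with homogeneous coordinates `c`; junk at `c = 0`. -/
def affineCoord (c : ℝ × ℝ) : WithTop ℝ :=
  if c.2 = 0 then ⊤ else ((c.1 / c.2 : ℝ) : WithTop ℝ)

/-- The determinant of two pairs of homogeneous coordinates, which vanishes when they describe the
same element of `ℝ ∪ {∞}`. -/
def coordDet (c d : ℝ × ℝ) : ℝ := c.1 * d.2 - d.1 * c.2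

@[simp] theorem homCoord_top : homCoord ⊤ = (1, 0) := rfl

@[simp] theorem homCoord_coe (a : ℝ) : homCoord (a : WithTop ℝ) = (a, 1) := rfl

theorem homCoord_ne_zero (κ : WithTop ℝ) : homCoord κ ≠ 0 := by
  induction κ using WithTop.recTopCoe <;> simp [Prod.ext_iff]

theorem affineCoord_homCoord (κ : WithTop ℝ) : affineCoord (homCoord κ) = κ := by
  induction κ using WithTop.recTopCoe <;> simp [affineCoord]

theorem exists_eq_smul_homCoord_affineCoord {c : ℝ × ℝ} (hc : c ≠ 0) :
    ∃ a : ℝ, a ≠ 0 ∧ c = a • homCoord (affineCoord c) := by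
  by_cases h : c.2 = 0
  · exact ⟨c.1, fun h1 => hc (Prod.ext h1 h), by simp [affineCoord, h, Prod.ext_iff]⟩
  · exact ⟨c.2, h, by simp [affineCoord, h, mul_div_cancel₀]⟩

theorem affineCoord_eq_iff_coordDet_eq_zero {c d : ℝ × ℝ} (hc : c ≠ 0) (hd : d ≠ 0) :
    affineCoord c = affineCoord d ↔ coordDet c d = 0 := by
  obtain ⟨a, ha, hac⟩ := exists_eq_smul_homCoord_affineCoord hc
  obtain ⟨b, hb, hbd⟩ := exists_eq_smul_homCoord_affineCoord hd
  have hdet : coordDet c d = a * b * homDiff (affineCoord c) (affineCoord d) := by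
    conv_lhs => rw [hac, hbd]
    simp only [coordDet, homDiff, Prod.smul_fst, Prod.smul_snd, smul_eq_mul]
    ring
  rw [hdet, mul_eq_zero_iff_left (mul_ne_zero ha hb)]
  generalize affineCoord c = x, affineCoord d = y
  induction x using WithTop.recTopCoe <;> induction y using WithTop.recTopCoe <;>
    simp [homDiff, sub_eq_zero]

end HomogeneousCoordinates

section CurvatureDirections

variable {F : Type*} [NormedAddCommGroup F] [InnerProductSpace ℝ F]

/-- The map `(dx, dξ) ↦ c₁ dx + c₂ dξ`.  The principal space of a curvature with homogeneous
coordinates `c` is its kernel on the tangent space. -/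
def relation (c : ℝ × ℝ) : F × F →L[ℝ] F :=
  c.1 • ContinuousLinearMap.fst ℝ F F + c.2 • ContinuousLinearMap.snd ℝ F F

theorem relation_apply (c : ℝ × ℝ) (w : F × F) : relation c w = c.1 • w.1 + c.2 • w.2 := rfl

theorem relation_smul_left (a : ℝ) (c : ℝ × ℝ) (w : F × F) :
    relation (a • c) w = a • relation c w := by
  simp only [relation_apply, Prod.smul_fst, Prod.smul_snd]
  module

theorem eq_zero_of_relation_eq_zero {c d : ℝ × ℝ} (h : coordDet c d ≠ 0) {w : F × F}
    (hc : relation c w = 0) (hd : relation d w = 0) : w = 0 := by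
  have h1 : coordDet c d • w.1 = d.2 • relation c w - c.2 • relation d w := by
    simp only [coordDet, relation_apply]
    module
  have h2 : coordDet c d • w.2 = c.1 • relation d w - d.1 • relation c w := by
    simp only [coordDet, relation_apply]
    module
  rw [hc, hd, smul_zero, smul_zero, sub_zero, smul_eq_zero_iff_right h] at h1 h2
  exact Prod.ext h1 h2

theorem relation_homCoord_affineCoord_eq_zero_iff {c : ℝ × ℝ} (hc : c ≠ 0) (w : F × F) :
    relation (homCoord (affineCoord c)) w = 0 ↔ relation c w = 0 := by
  obtain ⟨a, ha, hac⟩ := exists_eq_smul_homCoord_affineCoord hc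
  conv_rhs => rw [hac, relation_smul_left, smul_eq_zero_iff_right ha]

/-- `c` is a pair of homogeneous coordinates of a principal curvature of `B` at `p`. -/
def IsCurvatureDirection (B : Set (F × F)) (p : F × F) (c : ℝ × ℝ) : Prop :=
  ∃ w ∈ tangentVectors B p, w ≠ 0 ∧ relation c w = 0

theorem mem_principalCurvatures_iff {B : Set (F × F)} {p : F × F} {κ : WithTop ℝ} :
    κ ∈ principalCurvatures B p ↔ IsCurvatureDirection B p (homCoord κ) :=
  ⟨fun ⟨w, hw, h0⟩ => ⟨w, hw.1, h0, hw.2⟩, fun ⟨w, hw, h0, h⟩ => ⟨w, ⟨hw, h⟩, h0⟩⟩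

theorem affineCoord_mem_principalCurvatures_iff {B : Set (F × F)} {p : F × F} {c : ℝ × ℝ}
    (hc : c ≠ 0) : affineCoord c ∈ principalCurvatures B p ↔ IsCurvatureDirection B p c := by
  simp only [mem_principalCurvatures_iff, IsCurvatureDirection,
    relation_homCoord_affineCoord_eq_zero_iff hc]

theorem curvatureSphere_affineCoord {c : ℝ × ℝ} (hc : c ≠ 0) (p : F × F) :
    curvatureSphere p (affineCoord c) = Submodule.span ℝ {(c.1, relation c p, c.2)} := by
  obtain ⟨a, ha, hac⟩ := exists_eq_smul_homCoord_affineCoord hc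
  unfold curvatureSphere
  rw [← Submodule.span_singleton_smul_eq (IsUnit.mk0 a ha)]
  congr 2
  conv_rhs => rw [hac]
  simp [relation_apply, pointSphere, greatSphere, smul_smul]

/-- At the contact elements of `B` in `U`, the functions `ρ j` are homogeneous coordinates of the
distinct principal curvatures of `B`, and `ρ j` has derivative zero along the principal space of
its curvature.  This is the form in which the Dupin condition is verified. -/
structure CurvatureSystemOn (g : ℕ) (B U : Set (F × F)) (ρ : Fin g → F × F → ℝ × ℝ) : Prop where
  ne_zero : ∀ p ∈ B ∩ U, ∀ j, ρ j p ≠ 0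
  independent : ∀ p ∈ B ∩ U, ∀ i j, i ≠ j → coordDet (ρ i p) (ρ j p) ≠ 0
  isCurvatureDirection : ∀ p ∈ B ∩ U, ∀ j, IsCurvatureDirection B p (ρ j p)
  complete : ∀ p ∈ B ∩ U, ∀ c, c ≠ 0 → IsCurvatureDirection B p c → ∃ j, coordDet c (ρ j p) = 0
  hasFDerivAt : ∀ p ∈ B ∩ U, ∀ j, ∃ D : F × F →L[ℝ] ℝ × ℝ, HasFDerivAt (ρ j) D p ∧
    ∀ w ∈ tangentVectors B p, relation (ρ j p) w = 0 → D w = 0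

namespace CurvatureSystemOn

variable {g : ℕ} {B U : Set (F × F)} {ρ : Fin g → F × F → ℝ × ℝ} {p : F × F}

theorem principalCurvatures_eq (h : CurvatureSystemOn g B U ρ) (hp : p ∈ B ∩ U) :
    principalCurvatures B p = Set.range fun j => affineCoord (ρ j p) := by
  ext κ
  constructor
  · intro hκ
    obtain ⟨j, hj⟩ := h.complete p hp _ (homCoord_ne_zero κ) (mem_principalCurvatures_iff.1 hκ)
    refine ⟨j, Eq.symm ?_⟩
    rw [← affineCoord_homCoord κ]
    exact (affineCoord_eq_iff_coordDet_eq_zero (homCoord_ne_zero κ) (h.ne_zero p hp j)).2 hj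
  · rintro ⟨j, rfl⟩
    exact (affineCoord_mem_principalCurvatures_iff (h.ne_zero p hp j)).2
      (h.isCurvatureDirection p hp j)

theorem affineCoord_injective (h : CurvatureSystemOn g B U ρ) (hp : p ∈ B ∩ U) :
    Function.Injective fun j => affineCoord (ρ j p) := by
  intro i j hij
  by_contra hne
  exact h.independent p hp i j hne
    ((affineCoord_eq_iff_coordDet_eq_zero (h.ne_zero p hp i) (h.ne_zero p hp j)).1 hij)

variable {S : Set (F × F)} {κ : F × F → WithTop ℝ}

theorem mem_tangentVectors_and_relation_eq_zero (h : CurvatureSystemOn g B U ρ)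
    (hS : IsCurvatureSurface B S κ) {q : F × F} (hq : q ∈ S) (hqU : q ∈ U) {j : Fin g}
    (hj : affineCoord (ρ j q) = κ q) {w : F × F} (hw : w ∈ tangentVectors S q) :
    w ∈ tangentVectors B q ∧ relation (ρ j q) w = 0 := by
  rw [hS.tangent q hq, ← hj] at hw
  exact ⟨hw.1, (relation_homCoord_affineCoord_eq_zero_iff
    (h.ne_zero q ⟨hS.subset hq, hqU⟩ j) w).1 hw.2⟩

theorem exists_affineCoord_eq (h : CurvatureSystemOn g B U ρ) (hS : IsCurvatureSurface B S κ)
    {q : F × F} (hq : q ∈ S) (hqU : q ∈ U) : ∃ j, affineCoord (ρ j q) = κ q := by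
  have hκ := hS.principal q hq
  rwa [h.principalCurvatures_eq ⟨hS.subset hq, hqU⟩] at hκ

variable [FiniteDimensional ℝ F]

theorem eventually_affineCoord_eq (h : CurvatureSystemOn g B U ρ) (hU : IsOpen U)
    (hS : IsCurvatureSurface B S κ) (hp : p ∈ S) (hpU : p ∈ U) {j : Fin g}
    (hj : affineCoord (ρ j p) = κ p) : ∀ᶠ q in 𝓝[S] p, affineCoord (ρ j q) = κ q := by
  obtain ⟨k, hk⟩ := hS.isSubmanifold
  obtain ⟨w, hw, hw0⟩ := hS.principal p hp
  rw [← hS.tangent p hp] at hw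
  obtain ⟨η, hη, rfl, hηS⟩ := hk.exists_continuousAt_tangentField hp hw
  have hother : ∀ i, i ≠ j → ∀ᶠ q in 𝓝[S] p, relation (ρ i q) (η q) ≠ 0 := by
    intro i hij
    obtain ⟨D, hD, -⟩ := h.hasFDerivAt p ⟨hS.subset hp, hpU⟩ i
    have hcont : ContinuousAt (fun q => relation (ρ i q) (η q)) p :=
      (hD.continuousAt.fst.smul hη.fst).add (hD.continuousAt.snd.smul hη.snd)
    refine nhdsWithin_le_nhds (hcont.eventually_ne fun h0 => hw0 ?_)
    exact eq_zero_of_relation_eq_zero (h.independent p ⟨hS.subset hp, hpU⟩ i j hij) h0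
      (h.mem_tangentVectors_and_relation_eq_zero hS hp hpU hj hw).2
  have hall : ∀ᶠ q in 𝓝[S] p, ∀ i, i ≠ j → relation (ρ i q) (η q) ≠ 0 :=
    eventually_all.2 fun i => eventually_imp_distrib_left.2 (hother i)
  filter_upwards [hall, hηS, eventually_mem_nhdsWithin,
    nhdsWithin_le_nhds (hU.mem_nhds hpU)] with q hq hηq hqS hqU
  obtain ⟨i, hi⟩ := h.exists_affineCoord_eq hS hqS hqU
  by_cases hij : i = j
  · rwa [← hij]
  · exact absurd (h.mem_tangentVectors_and_relation_eq_zero hS hqS hqU hi hηq).2 (hq i hij)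

theorem eventually_curvatureSphere_eq (h : CurvatureSystemOn g B U ρ) (hU : IsOpen U)
    (hS : IsCurvatureSurface B S κ) (hp : p ∈ S) (hpU : p ∈ U) :
    ∀ᶠ q in 𝓝[S] p, curvatureSphere q (κ q) = curvatureSphere p (κ p) := by
  obtain ⟨k, hk⟩ := hS.isSubmanifold
  obtain ⟨j, hj⟩ := h.exists_affineCoord_eq hS hp hpU
  have hnear : ∀ᶠ q in 𝓝[S] p, q ∈ S ∧ q ∈ U ∧ affineCoord (ρ j q) = κ q :=
    eventually_mem_nhdsWithin.and
      (.and (nhdsWithin_le_nhds (hU.mem_nhds hpU)) (h.eventually_affineCoord_eq hU hS hp hpU hj))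
  have hconst := hk.eventually_eq_of_fderiv_tangentVectors_eq_zero hp
    (f := fun q => ((ρ j q).1, relation (ρ j q) q, (ρ j q).2)) <| by
      filter_upwards [hnear] with q ⟨hqS, hqU, hqκ⟩
      obtain ⟨D, hD, hD0⟩ := h.hasFDerivAt q ⟨hS.subset hqS, hqU⟩ j
      refine ⟨_, hD.fst.prodMk (((hD.fst.smul (hasFDerivAt_id q).fst).add
        (hD.snd.smul (hasFDerivAt_id q).snd)).prodMk hD.snd), fun w hw => ?_⟩
      obtain ⟨hwB, hrel⟩ := h.mem_tangentVectors_and_relation_eq_zero hS hqS hqU hqκ hw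
      simpa [hD0 w hwB hrel, relation_apply] using hrel
  filter_upwards [hconst, hnear] with q hq ⟨hqS, hqU, hqκ⟩
  rw [← hqκ, ← hj, curvatureSphere_affineCoord (h.ne_zero q ⟨hS.subset hqS, hqU⟩ j),
    curvatureSphere_affineCoord (h.ne_zero p ⟨hS.subset hp, hpU⟩ j)]
  exact congrArg (fun z => Submodule.span ℝ {z}) hq

end CurvatureSystemOn

theorem IsLegendreSubmanifold.isProperDupin [FiniteDimensional ℝ F] {g : ℕ} {B : Set (F × F)}
    (hB : IsLegendreSubmanifold B)
    (h : ∀ p ∈ B, ∃ U, IsOpen U ∧ p ∈ U ∧ ∃ ρ, CurvatureSystemOn g B U ρ) :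
    IsProperDupin g B where
  legendre := hB
  dupin := by
    intro S κ hS p hp q hq
    let _ : TopologicalSpace (Submodule ℝ (LieSpace F)) := ⊥
    have : DiscreteTopology (Submodule ℝ (LieSpace F)) := ⟨rfl⟩
    refine hS.connected.isPreconnected.constant (f := fun p => curvatureSphere p (κ p))
      (fun x hx => ?_) hp hq
    obtain ⟨U, hU, hxU, ρ, hρ⟩ := h x (hS.subset hx)
    exact tendsto_nhds_of_eventually_eq (hρ.eventually_curvatureSphere_eq hU hS hx hxU)
  proper := by
    intro p hp
    obtain ⟨U, _, hpU, ρ, hρ⟩ := h p hp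
    rw [hρ.principalCurvatures_eq ⟨hp, hpU⟩]
    refine ⟨Set.finite_range _, ?_⟩
    rw [← Set.image_univ, Set.ncard_image_of_injective _ (hρ.affineCoord_injective ⟨hp, hpU⟩)]
    simp

end CurvatureDirections

section ParallelMap

variable {X : Type*} [NormedAddCommGroup X] [NormedSpace ℝ X] {a b ε : ℝ}

/-- The linear map `(x, ξ) ↦ (a x + b ξ, ε (-b x + a ξ))`.  For `a = cos t`, `b = sin t` and
`ε = ±1` it moves every contact element the distance `t` along its normal geodesic and orients it
by `ε`. -/
def parallelMap (a b ε : ℝ) : X × X →L[ℝ] X × X :=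
  (a • ContinuousLinearMap.fst ℝ X X + b • ContinuousLinearMap.snd ℝ X X).prod
    (ε • (-b • ContinuousLinearMap.fst ℝ X X + a • ContinuousLinearMap.snd ℝ X X))

@[simp] theorem parallelMap_apply (a b ε : ℝ) (p : X × X) :
    parallelMap a b ε p = (a • p.1 + b • p.2, ε • (-b • p.1 + a • p.2)) := rfl

theorem parallelMap_leftInverse (h : a ^ 2 + b ^ 2 = 1) (hε : ε ^ 2 = 1) :
    Function.LeftInverse (parallelMap (X := X) a (-(ε * b)) ε) (parallelMap a b ε) := by
  intro p
  have hε' : ε * ε = 1 := by rw [← sq, hε]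
  have h' : a * a + b * b = 1 := by linarith
  simp only [parallelMap_apply]
  refine Prod.ext ?_ ?_
  · calc _ = (a * a + (ε * ε) * (b * b)) • p.1 + (a * b - (ε * ε) * (a * b)) • p.2 := by module
      _ = p.1 := by rw [hε', one_mul, one_mul, h', sub_self, one_smul, zero_smul, add_zero]
  · calc _ = ((ε * ε) * (a * a + b * b)) • p.2 := by module
      _ = p.2 := by rw [hε', h', one_mul, one_smul]

theorem parallelMap_rightInverse (h : a ^ 2 + b ^ 2 = 1) (hε : ε ^ 2 = 1) :
    Function.RightInverse (parallelMap (X := X) a (-(ε * b)) ε) (parallelMap a b ε) := by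
  have h' : a ^ 2 + (-(ε * b)) ^ 2 = 1 := by rw [neg_sq, mul_pow, hε, one_mul, h]
  have hb : -(ε * -(ε * b)) = b := by linear_combination b * hε
  simpa only [hb, Function.RightInverse] using parallelMap_leftInverse (X := X) h' hε

theorem coordDet_parallelMap (h : a ^ 2 + b ^ 2 = 1) (c d : ℝ × ℝ) :
    coordDet (parallelMap a b ε c) (parallelMap a b ε d) = ε * coordDet c d := by
  simp only [coordDet, parallelMap_apply, smul_eq_mul]
  linear_combination ε * (c.1 * d.2 - d.1 * c.2) * h

end ParallelMap

section ContainsHarmonic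

theorem coordDet_map (L : ℝ × ℝ →ₗ[ℝ] ℝ × ℝ) (c d : ℝ × ℝ) :
    coordDet (L c) (L d) = coordDet (L (1, 0)) (L (0, 1)) * coordDet c d := by
  have hsplit : ∀ c : ℝ × ℝ, L c = c.1 • L (1, 0) + c.2 • L (0, 1) := fun c => by
    simp [← map_smul, ← map_add]
  rw [hsplit c, hsplit d]
  simp only [coordDet, Prod.fst_add, Prod.snd_add, Prod.smul_fst, Prod.smul_snd, smul_eq_mul]
  ring

theorem coordDet_map_basis_ne_zero (L : (ℝ × ℝ) ≃ₗ[ℝ] ℝ × ℝ) :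
    coordDet (L (1, 0)) (L (0, 1)) ≠ 0 := by
  refine left_ne_zero_of_mul_eq_one (b := coordDet (L.symm (1, 0)) (L.symm (0, 1))) ?_
  rw [← LinearEquiv.coe_coe, ← coordDet_map, LinearEquiv.coe_coe, L.apply_symm_apply,
    L.apply_symm_apply]
  simp [coordDet]

/-- `C` contains homogeneous coordinates of four distinct points of the projective line, two pairs
of which are harmonic. -/
def ContainsHarmonic (C : Set (ℝ × ℝ)) : Prop :=
  ∃ v : Fin 4 → ℝ × ℝ, (∀ i, v i ∈ C) ∧ (∀ i j, i ≠ j → coordDet (v i) (v j) ≠ 0) ∧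
    coordDet (v 0) (v 1) * coordDet (v 2) (v 3) = coordDet (v 1) (v 2) * coordDet (v 0) (v 3)

theorem ContainsHarmonic.of_mapsTo {C C' : Set (ℝ × ℝ)} (h : ContainsHarmonic C)
    {g : ℝ × ℝ → ℝ × ℝ} {k : ℝ} (hk : k ≠ 0)
    (hg : ∀ c d, coordDet (g c) (g d) = k * coordDet c d) (hC : Set.MapsTo g C C') :
    ContainsHarmonic C' := by
  obtain ⟨v, hv, hne, h⟩ := h
  refine ⟨g ∘ v, fun i => hC (hv i), fun i j hij => ?_, ?_⟩
  · rw [Function.comp_apply, Function.comp_apply, hg]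
    exact mul_ne_zero hk (hne i j hij)
  · simp only [Function.comp_apply, hg]
    linear_combination k ^ 2 * h

theorem ContainsHarmonic.map {C C' : Set (ℝ × ℝ)} (h : ContainsHarmonic C)
    (L : (ℝ × ℝ) ≃ₗ[ℝ] ℝ × ℝ) (hL : Set.MapsTo L C C') : ContainsHarmonic C' :=
  h.of_mapsTo (coordDet_map_basis_ne_zero L) (coordDet_map (L : ℝ × ℝ →ₗ[ℝ] ℝ × ℝ)) hL

end ContainsHarmonic

section ParallelTransfer

variable {F : Type*} [NormedAddCommGroup F] [InnerProductSpace ℝ F]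

theorem relation_parallelMap (a b : ℝ) {ε : ℝ} (hε : ε ^ 2 = 1) (c : ℝ × ℝ) (w : F × F) :
    relation (parallelMap a b ε c) w = relation c (parallelMap a (-(ε * b)) ε w) := by
  have hb : b * c.2 = ε * ε * b * c.2 := by rw [← sq, hε, one_mul]
  simp only [relation_apply, parallelMap_apply, smul_eq_mul]
  rw [hb]
  module

theorem norm_smul_add_smul_eq_one {a b : ℝ} (h : a ^ 2 + b ^ 2 = 1) {x ξ : F} (hx : ‖x‖ = 1)
    (hξ : ‖ξ‖ = 1) (hxξ : ⟪x, ξ⟫ = 0) : ‖a • x + b • ξ‖ = 1 := by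
  have hsq : ‖a • x + b • ξ‖ ^ 2 = 1 := by
    rw [norm_add_sq_real, norm_smul, norm_smul, hx, hξ, inner_smul_left, inner_smul_right, hxξ]
    simpa using h
  exact (pow_eq_one_iff_of_nonneg (norm_nonneg _) two_ne_zero).1 hsq

theorem hasDerivAt_inner_zero_of_const {u v : ℝ → F} {u' v' : F} {k : ℝ}
    (hu : HasDerivAt u u' 0) (hv : HasDerivAt v v' 0) (h : ∀ᶠ t in 𝓝 (0 : ℝ), ⟪u t, v t⟫ = k) :
    ⟪u 0, v'⟫ + ⟪u', v 0⟫ = 0 :=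
  (hu.inner ℝ hv).unique ((hasDerivAt_const _ k).congr_of_eventuallyEq h)

theorem IsLegendreSubmanifold.inner_tangent {B : Set (F × F)} (hB : IsLegendreSubmanifold B)
    {p w : F × F} (hw : w ∈ tangentVectors B p) :
    ⟪p.1, w.1⟫ = 0 ∧ ⟪p.2, w.2⟫ = 0 ∧ ⟪p.1, w.2⟫ + ⟪w.1, p.2⟫ = 0 := by
  obtain ⟨γ, -, rfl, hd, hS⟩ := hw
  have h1 : HasDerivAt (fun t => (γ t).1) w.1 0 := hd.fst
  have h2 : HasDerivAt (fun t => (γ t).2) w.2 0 := hd.snd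
  refine ⟨?_, ?_, ?_⟩
  · have := hasDerivAt_inner_zero_of_const (k := 1) h1 h1 <| hS.mono fun t ht => by
      rw [real_inner_self_eq_norm_sq, hB.unit_fst _ ht, one_pow]
    linarith [real_inner_comm (γ 0).1 w.1]
  · have := hasDerivAt_inner_zero_of_const (k := 1) h2 h2 <| hS.mono fun t ht => by
      rw [real_inner_self_eq_norm_sq, hB.unit_snd _ ht, one_pow]
    linarith [real_inner_comm (γ 0).2 w.2]
  · exact hasDerivAt_inner_zero_of_const h1 h2 (hS.mono fun t => hB.orthogonal (γ t))

/-- Near `p`, the set `B'` is the image of `B` under `parallelMap a b ε`. -/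
structure IsParallelNear (a b ε : ℝ) (B B' : Set (F × F)) (p : F × F) : Prop where
  sq_add_sq : a ^ 2 + b ^ 2 = 1
  sq_eq : ε ^ 2 = 1
  mem_iff : ∀ᶠ q in 𝓝 p, q ∈ B' ↔ parallelMap a (-(ε * b)) ε q ∈ B

namespace IsParallelNear

variable {a b ε : ℝ} {B B' : Set (F × F)} {p : F × F}

theorem map_symm (h : IsParallelNear a b ε B B' p) {X : Type*} [NormedAddCommGroup X]
    [NormedSpace ℝ X] (q : X × X) : parallelMap a b ε (parallelMap a (-(ε * b)) ε q) = q :=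
  parallelMap_rightInverse h.sq_add_sq h.sq_eq q

theorem symm_map (h : IsParallelNear a b ε B B' p) {X : Type*} [NormedAddCommGroup X]
    [NormedSpace ℝ X] (q : X × X) : parallelMap a (-(ε * b)) ε (parallelMap a b ε q) = q :=
  parallelMap_leftInverse h.sq_add_sq h.sq_eq q

theorem mem (h : IsParallelNear a b ε B B' p) (hp : p ∈ B') : parallelMap a (-(ε * b)) ε p ∈ B :=
  h.mem_iff.self_of_nhds.1 hp

theorem eventually (h : IsParallelNear a b ε B B' p) : ∀ᶠ q in 𝓝 p, IsParallelNear a b ε B B' q :=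
  h.mem_iff.eventually_nhds.mono fun _ hq => ⟨h.sq_add_sq, h.sq_eq, hq⟩

theorem mem_tangentVectors_iff (h : IsParallelNear a b ε B B' p) (w : F × F) :
    w ∈ tangentVectors B' p ↔
      parallelMap a (-(ε * b)) ε w ∈ tangentVectors B (parallelMap a (-(ε * b)) ε p) := by
  refine ⟨fun hw => mem_tangentVectors_image (ContinuousLinearMap.contDiff _).contDiffAt
    (ContinuousLinearMap.hasFDerivAt _) (h.mem_iff.mono fun q hq => hq.1) hw, fun hw => ?_⟩
  have hmaps : ∀ᶠ q in 𝓝 (parallelMap a (-(ε * b)) ε p), q ∈ B → parallelMap a b ε q ∈ B' := by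
    have hc := (parallelMap (X := F) a b ε).continuous.tendsto (parallelMap a (-(ε * b)) ε p)
    rw [h.map_symm] at hc
    filter_upwards [hc.eventually h.mem_iff] with q hq hqB
    rwa [hq, h.symm_map]
  have := mem_tangentVectors_image (ContinuousLinearMap.contDiff _).contDiffAt
    (ContinuousLinearMap.hasFDerivAt _) hmaps hw
  rwa [h.map_symm, h.map_symm] at this

theorem isCurvatureDirection_iff (h : IsParallelNear a b ε B B' p) (c : ℝ × ℝ) :
    IsCurvatureDirection B' p (parallelMap a b ε c) ↔
      IsCurvatureDirection B (parallelMap a (-(ε * b)) ε p) c := by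
  constructor
  · rintro ⟨w, hw, h0, hr⟩
    rw [relation_parallelMap a b h.sq_eq] at hr
    refine ⟨_, (h.mem_tangentVectors_iff w).1 hw, fun h1 => h0 ?_, hr⟩
    rw [← h.map_symm w, h1, map_zero]
  · rintro ⟨w, hw, h0, hr⟩
    refine ⟨parallelMap a b ε w, (h.mem_tangentVectors_iff _).2 ?_, fun h1 => h0 ?_, ?_⟩
    · rwa [h.symm_map]
    · rw [← h.symm_map w, h1, map_zero]
    · rwa [relation_parallelMap a b h.sq_eq, h.symm_map]

theorem ne_zero (h : IsParallelNear a b ε B B' p) : ε ≠ 0 := by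
  rintro rfl
  simpa using h.sq_eq

theorem containsHarmonic_iff (h : IsParallelNear a b ε B B' p) :
    ContainsHarmonic {c | IsCurvatureDirection B' p c} ↔
      ContainsHarmonic {c | IsCurvatureDirection B (parallelMap a (-(ε * b)) ε p) c} := by
  constructor <;> intro hC
  · have h' : a ^ 2 + (-(ε * b)) ^ 2 = 1 := by
      rw [neg_sq, mul_pow, h.sq_eq, one_mul, h.sq_add_sq]
    refine hC.of_mapsTo h.ne_zero (coordDet_parallelMap h') fun c hc => ?_
    rwa [Set.mem_ofPred_eq, ← h.isCurvatureDirection_iff, h.map_symm]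
  · exact hC.of_mapsTo h.ne_zero (coordDet_parallelMap h.sq_add_sq) fun c hc =>
      (h.isCurvatureDirection_iff c).2 hc

theorem exists_curvatureSystemOn (h : IsParallelNear a b ε B B' p) {g : ℕ} {U : Set (F × F)}
    (hU : IsOpen U) (hp : parallelMap a (-(ε * b)) ε p ∈ U) {ρ : Fin g → F × F → ℝ × ℝ}
    (hρ : CurvatureSystemOn g B U ρ) :
    ∃ U', IsOpen U' ∧ p ∈ U' ∧ ∃ ρ', CurvatureSystemOn g B' U' ρ' := by
  obtain ⟨O, hO, hOo, hpO⟩ := eventually_nhds_iff.1 h.eventually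
  set K : F × F →L[ℝ] F × F := parallelMap a (-(ε * b)) ε
  have hmem : ∀ q ∈ B' ∩ (O ∩ K ⁻¹' U), K q ∈ B ∩ U := fun q hq =>
    ⟨(hO q hq.2.1).mem hq.1, hq.2.2⟩
  refine ⟨O ∩ K ⁻¹' U, hOo.inter (hU.preimage K.continuous), ⟨hpO, hp⟩,
    fun j q => parallelMap a b ε (ρ j (K q)), ?_, ?_, ?_, ?_, ?_⟩
  · intro q hq j h0
    apply hρ.ne_zero _ (hmem q hq) j
    rw [← h.symm_map (ρ j (K q)), h0, map_zero]
  · intro q hq i j hij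
    rw [coordDet_parallelMap h.sq_add_sq]
    exact mul_ne_zero h.ne_zero (hρ.independent _ (hmem q hq) i j hij)
  · intro q hq j
    exact ((hO q hq.2.1).isCurvatureDirection_iff _).2
      (hρ.isCurvatureDirection _ (hmem q hq) j)
  · intro q hq c hc hdir
    rw [← h.map_symm c] at hdir hc ⊢
    obtain ⟨j, hj⟩ := hρ.complete _ (hmem q hq) (parallelMap a (-(ε * b)) ε c)
      (fun h0 => hc (by rw [h0, map_zero])) (((hO q hq.2.1).isCurvatureDirection_iff _).1 hdir)
    exact ⟨j, by rw [coordDet_parallelMap h.sq_add_sq, hj, mul_zero]⟩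
  · intro q hq j
    obtain ⟨D, hD, hD0⟩ := hρ.hasFDerivAt _ (hmem q hq) j
    refine ⟨(parallelMap a b ε).comp (D.comp K), (parallelMap (X := ℝ) a b ε).hasFDerivAt.comp q
      (HasFDerivAt.comp q hD K.hasFDerivAt), fun w hw hr => ?_⟩
    rw [relation_parallelMap a b h.sq_eq] at hr
    rw [ContinuousLinearMap.comp_apply, ContinuousLinearMap.comp_apply,
      hD0 _ (((hO q hq.2.1).mem_tangentVectors_iff w).1 hw) hr, map_zero]

theorem eventually_mem_iff_mem_image (h : IsParallelNear a b ε B B' p) :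
    ∀ᶠ q in 𝓝 p, q ∈ B' ↔ q ∈ parallelMap a b ε '' B := by
  filter_upwards [h.mem_iff] with q hq
  rw [hq]
  exact ⟨fun h1 => ⟨_, h1, h.map_symm q⟩, fun ⟨r, hr, hrq⟩ => by rwa [← hrq, h.symm_map]⟩

theorem norm_fst (h : IsParallelNear a b ε B B' p) (hB : IsLegendreSubmanifold B)
    (hp : p ∈ B') : ‖p.1‖ = 1 := by
  rw [← h.map_symm p]
  exact norm_smul_add_smul_eq_one h.sq_add_sq (hB.unit_fst _ (h.mem hp))
    (hB.unit_snd _ (h.mem hp)) (hB.orthogonal _ (h.mem hp))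

theorem norm_snd (h : IsParallelNear a b ε B B' p) (hB : IsLegendreSubmanifold B)
    (hp : p ∈ B') : ‖p.2‖ = 1 := by
  have hε : ‖ε‖ = 1 := (pow_eq_one_iff_of_nonneg (norm_nonneg _) two_ne_zero).1
    (by rw [Real.norm_eq_abs, sq_abs, h.sq_eq])
  rw [← h.map_symm p, parallelMap_apply, norm_smul, hε, one_mul]
  exact norm_smul_add_smul_eq_one (by linarith [h.sq_add_sq, neg_sq b])
    (hB.unit_fst _ (h.mem hp)) (hB.unit_snd _ (h.mem hp)) (hB.orthogonal _ (h.mem hp))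

theorem inner_eq_zero (h : IsParallelNear a b ε B B' p) (hB : IsLegendreSubmanifold B)
    (hp : p ∈ B') : ⟪p.1, p.2⟫ = 0 := by
  rw [← h.map_symm p]
  have hq := h.mem hp
  generalize parallelMap a (-(ε * b)) ε p = q at hq ⊢
  have h21 : ⟪q.2, q.1⟫ = 0 := by rw [real_inner_comm, hB.orthogonal q hq]
  simp only [parallelMap_apply, inner_add_left, inner_add_right, real_inner_smul_left,
    real_inner_smul_right, hB.orthogonal q hq, h21, real_inner_self_eq_norm_sq,
    hB.unit_fst q hq, hB.unit_snd q hq]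
  ring

theorem inner_tangent_fst (h : IsParallelNear a b ε B B' p) (hB : IsLegendreSubmanifold B)
    (hp : p ∈ B') {w : F × F} (hw : w ∈ tangentVectors B' p) : ⟪w.1, p.2⟫ = 0 := by
  rw [← h.map_symm p, ← h.map_symm w]
  have hq := h.mem hp
  have hv := (h.mem_tangentVectors_iff w).1 hw
  generalize parallelMap a (-(ε * b)) ε p = q at hq hv ⊢
  generalize parallelMap a (-(ε * b)) ε w = v at hv ⊢
  obtain ⟨h11, h22, h12⟩ := hB.inner_tangent hv
  have hcontact := hB.contact q hq v hv
  rw [hcontact, add_zero] at h12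
  rw [real_inner_comm] at h11 h22 h12
  simp only [parallelMap_apply, inner_add_left, inner_add_right, real_inner_smul_left,
    real_inner_smul_right, h11, h22, h12, hcontact]
  ring

end IsParallelNear

variable [FiniteDimensional ℝ F] {B B' : Set (F × F)}

theorem IsSubmanifold.of_isParallelNear {k : ℕ} (hB : IsSubmanifold k B)
    (h : ∀ p ∈ B', ∃ a b ε, IsParallelNear a b ε B B' p) : IsSubmanifold k B' := by
  refine isSubmanifold_of_locally fun p hp => ?_
  obtain ⟨a, b, ε, hm⟩ := h p hp
  refine ⟨parallelMap a b ε '' B, hB.image (ContinuousLinearMap.contDiff _) ?_ ?_,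
    hm.eventually_mem_iff_mem_image⟩
  · exact (Topology.IsEmbedding.of_leftInverse (parallelMap_leftInverse hm.sq_add_sq hm.sq_eq)
      (ContinuousLinearMap.continuous _) (ContinuousLinearMap.continuous _)).comp .subtypeVal
  · intro q _ w _ h0
    rw [ContinuousLinearMap.fderiv] at h0
    rw [← hm.symm_map w, h0, map_zero]

theorem IsLegendreSubmanifold.of_isParallelNear (hB : IsLegendreSubmanifold B)
    (h : ∀ p ∈ B', ∃ a b ε, IsParallelNear a b ε B B' p) : IsLegendreSubmanifold B' where
  unit_fst p hp := let ⟨_, _, _, hm⟩ := h p hp; hm.norm_fst hB hp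
  unit_snd p hp := let ⟨_, _, _, hm⟩ := h p hp; hm.norm_snd hB hp
  orthogonal p hp := let ⟨_, _, _, hm⟩ := h p hp; hm.inner_eq_zero hB hp
  isSubmanifold := hB.isSubmanifold.of_isParallelNear h
  contact p hp _ hw := let ⟨_, _, _, hm⟩ := h p hp; hm.inner_tangent_fst hB hp hw

theorem IsLegendreSubmanifold.isProperDupin_of_isParallelNear {g : ℕ}
    (hB : IsLegendreSubmanifold B)
    (hρ : ∀ p ∈ B, ∃ U, IsOpen U ∧ p ∈ U ∧ ∃ ρ, CurvatureSystemOn g B U ρ)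
    (h : ∀ p ∈ B', ∃ a b ε, IsParallelNear a b ε B B' p) : IsProperDupin g B' := by
  refine (hB.of_isParallelNear h).isProperDupin fun p hp => ?_
  obtain ⟨a, b, ε, hm⟩ := h p hp
  obtain ⟨U, hU, hpU, ρ, hρ⟩ := hρ _ (hm.mem hp)
  exact hm.exists_curvatureSystemOn hU hpU hρ

end ParallelTransfer

section LieLines

variable {F : Type*} [NormedAddCommGroup F] [InnerProductSpace ℝ F]

/-- The point of the line of the contact element `p` with homogeneous coordinates `c`, namely
`c₁ k₁ + c₂ k₂`. -/
def lieVector (p : F × F) (c : ℝ × ℝ) : LieSpace F := (c.1, relation c p, c.2)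

theorem mem_lieLine_iff {p : F × F} {z : LieSpace F} :
    z ∈ lieLine p ↔ z.2.1 = relation (z.1, z.2.2) p := by
  unfold lieLine
  rw [Submodule.mem_span_pair]
  constructor
  · rintro ⟨a, b, rfl⟩
    simp [pointSphere, greatSphere, relation_apply]
  · intro h
    refine ⟨z.1, z.2.2, Prod.ext ?_ (Prod.ext ?_ ?_)⟩ <;>
      simp [h, pointSphere, greatSphere, relation_apply]

/-- The homogeneous coordinates of the points on the line of a contact element. -/
def lieLineEquiv (p : F × F) : (ℝ × ℝ) ≃ₗ[ℝ] lieLine p where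
  toFun c := ⟨lieVector p c, mem_lieLine_iff.2 rfl⟩
  invFun z := (z.1.1, z.1.2.2)
  map_add' c d := Subtype.ext <| Prod.ext rfl <| Prod.ext (by
    simp only [lieVector, relation_apply, Submodule.coe_add, Prod.fst_add, Prod.snd_add]
    module) rfl
  map_smul' a c := Subtype.ext <| Prod.ext rfl <| Prod.ext (relation_smul_left a c p) rfl
  left_inv _ := rfl
  right_inv z := Subtype.ext <| Prod.ext rfl <| Prod.ext (mem_lieLine_iff.1 z.2).symm rfl

/-- The change of homogeneous coordinates under a linear automorphism that maps the line of the
contact element `q` onto the line of `p`. -/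
def lieLineChange {p q : F × F} {C : LieSpace F ≃ₗ[ℝ] LieSpace F}
    (h : (lieLine q).map (C : LieSpace F →ₗ[ℝ] LieSpace F) = lieLine p) :
    (ℝ × ℝ) ≃ₗ[ℝ] ℝ × ℝ :=
  lieLineEquiv q ≪≫ₗ C.submoduleMap (lieLine q) ≪≫ₗ LinearEquiv.ofEq _ _ h ≪≫ₗ
    (lieLineEquiv p).symm

theorem lieVector_lieLineChange {p q : F × F} {C : LieSpace F ≃ₗ[ℝ] LieSpace F}
    (h : (lieLine q).map (C : LieSpace F →ₗ[ℝ] LieSpace F) = lieLine p) (c : ℝ × ℝ) :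
    lieVector p (lieLineChange h c) = C (lieVector q c) :=
  congrArg Subtype.val ((lieLineEquiv p).apply_symm_apply
    (LinearEquiv.ofEq _ _ h (C.submoduleMap (lieLine q) (lieLineEquiv q c))))

/-- The contact element whose line passes through `z` and `w`, by Cramer's rule; junk unless the
determinant `z₁ w₃ - w₁ z₃` is nonzero. -/
def contactElement (z w : LieSpace F) : F × F :=
  ((coordDet (z.1, z.2.2) (w.1, w.2.2))⁻¹ • (w.2.2 • z.2.1 - z.2.2 • w.2.1),
    (coordDet (z.1, z.2.2) (w.1, w.2.2))⁻¹ • (z.1 • w.2.1 - w.1 • z.2.1))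

theorem contactElement_lieVector (p : F × F) {c d : ℝ × ℝ} (h : coordDet c d ≠ 0) :
    contactElement (lieVector p c) (lieVector p d) = p := by
  refine Prod.ext ((inv_smul_eq_iff₀ h).2 ?_) ((inv_smul_eq_iff₀ h).2 ?_) <;>
    · simp only [lieVector, relation_apply, coordDet]
      module

theorem contactElement_map {p q : F × F} {C : LieSpace F ≃ₗ[ℝ] LieSpace F}
    (h : (lieLine q).map (C : LieSpace F →ₗ[ℝ] LieSpace F) = lieLine p) :
    contactElement (C (lieVector q (1, 0))) (C (lieVector q (0, 1))) = p := by
  rw [← lieVector_lieLineChange h, ← lieVector_lieLineChange h]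
  exact contactElement_lieVector p (coordDet_map_basis_ne_zero _)

variable {X : Type*} [NormedAddCommGroup X] [NormedSpace ℝ X] {x₀ : X}

theorem contDiffAt_contactElement {z w : X → LieSpace F} (hz : ContDiffAt ℝ ∞ z x₀)
    (hw : ContDiffAt ℝ ∞ w x₀)
    (h : coordDet ((z x₀).1, (z x₀).2.2) ((w x₀).1, (w x₀).2.2) ≠ 0) :
    ContDiffAt ℝ ∞ (fun x => contactElement (z x) (w x)) x₀ := by
  have hinv : ContDiffAt ℝ ∞
      (fun x => (coordDet ((z x).1, (z x).2.2) ((w x).1, (w x).2.2))⁻¹) x₀ :=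
    ((hz.fst.mul hw.snd.snd).sub (hw.fst.mul hz.snd.snd)).inv h
  exact (hinv.smul ((hw.snd.snd.smul hz.snd.fst).sub (hz.snd.snd.smul hw.snd.fst))).prodMk
    (hinv.smul ((hz.fst.smul hw.snd.fst).sub (hw.fst.smul hz.snd.fst)))

theorem hasFDerivAt_relation {c : X → ℝ × ℝ} {c' : X →L[ℝ] ℝ × ℝ} {φ : X → F × F}
    {φ' : X →L[ℝ] F × F} (hc : HasFDerivAt c c' x₀) (hφ : HasFDerivAt φ φ' x₀) :
    ∃ D : X →L[ℝ] F, HasFDerivAt (fun x => relation (c x) (φ x)) D x₀ ∧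
      ∀ v, D v = relation (c' v) (φ x₀) + relation (c x₀) (φ' v) := by
  refine ⟨_, (hc.fst.smul hφ.fst).add (hc.snd.smul hφ.snd), fun v => ?_⟩
  simp only [relation_apply, add_apply, smul_apply,
    ContinuousLinearMap.smulRight_apply, ContinuousLinearMap.comp_apply,
    ContinuousLinearMap.coe_fst', ContinuousLinearMap.coe_snd']
  abel

variable [FiniteDimensional ℝ F] {C : LieSpace F ≃ₗ[ℝ] LieSpace F}

theorem contDiffAt_map_lieVector {q : X → F × F} (hq : ContDiffAt ℝ ∞ q x₀) (c : ℝ × ℝ) :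
    ContDiffAt ℝ ∞ (fun x => C (lieVector (q x) c)) x₀ :=
  C.toContinuousLinearEquiv.contDiff.contDiffAt.comp x₀
    (contDiffAt_const.prodMk (((relation (F := F) c).contDiff.contDiffAt.comp x₀ hq).prodMk
      contDiffAt_const))

theorem contDiffAt_of_map_lieLine_eq {q φ : X → F × F} (hq : ContDiffAt ℝ ∞ q x₀)
    (h : ∀ x, (lieLine (q x)).map (C : LieSpace F →ₗ[ℝ] LieSpace F) = lieLine (φ x)) :
    ContDiffAt ℝ ∞ φ x₀ := by
  have hφ : φ = fun x =>
      contactElement (C (lieVector (q x) (1, 0))) (C (lieVector (q x) (0, 1))) :=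
    funext fun x => (contactElement_map (h x)).symm
  rw [hφ]
  refine contDiffAt_contactElement (contDiffAt_map_lieVector hq _)
    (contDiffAt_map_lieVector hq _) ?_
  rw [← lieVector_lieLineChange (h x₀), ← lieVector_lieLineChange (h x₀)]
  exact coordDet_map_basis_ne_zero _

theorem relation_fderiv_eq_zero_iff {q φ : X → F × F} {q' φ' : X →L[ℝ] F × F}
    (hq : HasFDerivAt q q' x₀) (hφ : HasFDerivAt φ φ' x₀)
    (h : ∀ x, (lieLine (q x)).map (C : LieSpace F →ₗ[ℝ] LieSpace F) = lieLine (φ x))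
    (c : ℝ × ℝ) (v : X) :
    relation c (q' v) = 0 ↔ relation (lieLineChange (h x₀) c) (φ' v) = 0 := by
  set y : X → LieSpace F := fun x => C (lieVector (q x) c)
  have hy : HasFDerivAt y ((C.toContinuousLinearEquiv : LieSpace F →L[ℝ] LieSpace F).comp
      ((0 : X →L[ℝ] ℝ).prod (((relation c).comp q').prod 0))) x₀ :=
    C.toContinuousLinearEquiv.hasFDerivAt.comp x₀ ((hasFDerivAt_const _ _).prodMk
      (((relation (F := F) c).hasFDerivAt.comp x₀ hq).prodMk (hasFDerivAt_const _ _)))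
  have hyφ : ∀ x, y x = lieVector (φ x) (lieLineChange (h x) c) := fun x =>
    (lieVector_lieLineChange (h x) c).symm
  -- Differentiating this membership shows that `y'` lies on the line iff the relation holds.
  have hmem : ∀ x, (y x).2.1 = relation ((y x).1, (y x).2.2) (φ x) := fun x => by
    rw [hyφ]
    rfl
  obtain ⟨D, hD, hDv⟩ := hasFDerivAt_relation (hy.fst.prodMk hy.snd.snd) hφ
  have hderiv := (hy.snd.fst.congr_of_eventuallyEq
    (.of_forall fun x => (hmem x).symm)).unique hD
  set u := relation c (q' v)
  have hu : (C (0, u, 0)).2.1 = relation ((C (0, u, 0)).1, (C (0, u, 0)).2.2) (φ x₀) +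
      relation (lieLineChange (h x₀) c) (φ' v) := by
    have := (DFunLike.congr_fun hderiv v).trans (hDv v)
    rwa [hyφ x₀] at this
  have hline : C (0, u, 0) ∈ lieLine (φ x₀) ↔ (0, u, 0) ∈ lieLine (q x₀) := by
    rw [← h x₀]
    simp
  calc u = 0 ↔ (0, u, 0) ∈ lieLine (q x₀) := by simp [mem_lieLine_iff, relation_apply]
    _ ↔ relation (lieLineChange (h x₀) c) (φ' v) = 0 := by
      rw [← hline, mem_lieLine_iff, hu, add_eq_left]

theorem IsSubmanifold.range_fderiv_eq {E : Type*} [NormedAddCommGroup E] [NormedSpace ℝ E]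
    [FiniteDimensional ℝ E] {B : Set E} {k : ℕ} (hB : IsSubmanifold k B)
    (hk : Module.finrank ℝ X = k) {φ : X → E} (hφ : ContDiffAt ℝ ∞ φ x₀) (hφB : ∀ x, φ x ∈ B)
    (hinj : Function.Injective (fderiv ℝ φ x₀)) :
    Set.range (fderiv ℝ φ x₀) = tangentVectors B (φ x₀) := by
  obtain ⟨T, hT, hTB⟩ := hB.exists_tangentSpace (hφB x₀)
  have hle : LinearMap.range (fderiv ℝ φ x₀).toLinearMap ≤ T := by
    rintro _ ⟨v, rfl⟩
    rw [← SetLike.mem_coe, hTB]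
    refine mem_tangentVectors_image (S := Set.univ) hφ
      (hφ.differentiableAt (by simp)).hasFDerivAt (.of_forall fun x _ => hφB x)
      ⟨fun t => x₀ + t • v, by fun_prop, by simp, ?_, by simp⟩
    simpa using ((hasDerivAt_id (0 : ℝ)).smul_const v).const_add x₀
  rw [← hTB, ← Submodule.eq_of_le_of_finrank_eq hle
    ((LinearMap.finrank_range_of_inj hinj).trans (hk.trans hT.symm))]
  rfl

theorem exists_isCurvatureDirection_iff {k : ℕ} {B : Set (F × F)} (hB : IsSubmanifold k B)
    (hk : Module.finrank ℝ X = k) {q : X → F × F} (hq : ContDiffAt ℝ ∞ q x₀)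
    (hinj : Function.Injective (fderiv ℝ q x₀))
    (hline : ∀ x, ∃ p ∈ B, (lieLine (q x)).map (C : LieSpace F →ₗ[ℝ] LieSpace F) = lieLine p)
    {p : F × F} (hp : (lieLine (q x₀)).map (C : LieSpace F →ₗ[ℝ] LieSpace F) = lieLine p) :
    ∃ L : (ℝ × ℝ) ≃ₗ[ℝ] ℝ × ℝ, ∀ c, IsCurvatureDirection B p (L c) ↔
      ∃ v ≠ 0, relation c (fderiv ℝ q x₀ v) = 0 := by
  choose φ hφB hφ using hline
  obtain rfl : φ x₀ = p := (contactElement_map (hφ x₀)).symm.trans (contactElement_map hp)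
  have hφs := contDiffAt_of_map_lieLine_eq hq hφ
  have hiff := relation_fderiv_eq_zero_iff (hq.differentiableAt (by simp)).hasFDerivAt
    (hφs.differentiableAt (by simp)).hasFDerivAt hφ
  have hφinj : Function.Injective (fderiv ℝ φ x₀) := by
    rw [injective_iff_map_eq_zero]
    intro v hv
    have h0 : ∀ c, relation c (fderiv ℝ q x₀ v) = 0 := fun c =>
      (hiff c v).2 (by rw [hv, map_zero])
    exact (map_eq_zero_iff _ hinj).1
      (eq_zero_of_relation_eq_zero (c := (1, 0)) (d := (0, 1)) (by simp [coordDet]) (h0 _) (h0 _))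
  have hrange := hB.range_fderiv_eq hk hφs hφB hφinj
  refine ⟨lieLineChange (hφ x₀), fun c => ?_⟩
  simp only [hiff, IsCurvatureDirection, ← hrange, Set.exists_range_iff,
    map_ne_zero_iff _ hφinj]

end LieLines

section Isoparametric

variable {F : Type*} [NormedAddCommGroup F] [InnerProductSpace ℝ F] {d : ℕ} {N : Type*}
  [TopologicalSpace N] [ChartedSpace (EuclideanSpace ℝ (Fin d)) N] {f ν : N → F}

theorem contDiffAt_comp_extChartAt_symm {h : N → F} {x : N}
    (hh : ContMDiffAt (𝓡 d) 𝓘(ℝ, F) ∞ h x) :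
    ContDiffAt ℝ ∞ (h ∘ (extChartAt (𝓡 d) x).symm) (extChartAt (𝓡 d) x x) := by
  have := (contMDiffAt_iff.1 hh).2
  rwa [ModelWithCorners.range_eq_univ, contDiffWithinAt_univ, extChartAt_model_space_eq_id] at this

theorem differential_eq_fderiv {h : N → F} {x : N} (hh : ContMDiffAt (𝓡 d) 𝓘(ℝ, F) ∞ h x)
    (v : EuclideanSpace ℝ (Fin d)) : differential d h x v =
      fderiv ℝ (h ∘ (extChartAt (𝓡 d) x).symm) (extChartAt (𝓡 d) x x) v := by
  have : mfderiv (𝓡 d) 𝓘(ℝ, F) h x =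
      fderiv ℝ (h ∘ (extChartAt (𝓡 d) x).symm) (extChartAt (𝓡 d) x x) := by
    rw [(hh.mdifferentiableAt (by simp)).mfderiv, ModelWithCorners.range_eq_univ,
      fderivWithin_univ, writtenInExtChartAt, extChartAt_model_space_eq_id]
    rfl
  exact congrArg (fun T : EuclideanSpace ℝ (Fin d) →L[ℝ] F => T v) this

theorem exists_relation_eq_zero_iff {X : Type*} [AddCommGroup X] [Module ℝ X]
    [FiniteDimensional ℝ X] {S T : X →ₗ[ℝ] F} (hS : Function.Injective S) {c : ℝ × ℝ}
    (hc : c ≠ 0) : (∃ v ≠ 0, relation c (S v, T v) = 0) ↔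
      c.2 ≠ 0 ∧ 0 < Module.finrank ℝ (LinearMap.ker (T + (c.1 / c.2) • S)) := by
  rcases eq_or_ne c.2 0 with h2 | h2
  · have h1 : c.1 ≠ 0 := fun h1 => hc (Prod.ext h1 h2)
    simp +contextual [relation_apply, h2, h1, map_eq_zero_iff S hS]
  · have hker : ∀ v, v ∈ LinearMap.ker (T + (c.1 / c.2) • S) ↔ relation c (S v, T v) = 0 := by
      intro v
      have hscale : relation c (S v, T v) = c.2 • (T + (c.1 / c.2) • S) v := by
        rw [LinearMap.add_apply, LinearMap.smul_apply, smul_add, smul_smul, mul_div_cancel₀ _ h2,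
          add_comm, relation_apply]
      rw [hscale, smul_eq_zero_iff_right h2, LinearMap.mem_ker]
    rw [Module.finrank_pos_iff_exists_ne_zero]
    simp only [← hker, ne_eq, h2, not_false_eq_true, true_and, Subtype.exists,
      Submodule.mk_eq_zero, exists_prop, and_comm]

theorem IsIsoparametric.exists_relation_eq_zero (h : IsIsoparametric d f ν) (x y : N) {c : ℝ × ℝ}
    (hx : ∃ v ≠ 0, relation c (differential d f x v, differential d ν x v) = 0) :
    ∃ v ≠ 0, relation c (differential d f y v, differential d ν y v) = 0 := by
  rcases eq_or_ne c 0 with rfl | hc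
  · obtain ⟨v, hv, -⟩ := hx
    exact ⟨v, hv, by simp [relation_apply]⟩
  · have : ∀ x : N, FiniteDimensional ℝ (TangentSpace (𝓡 d) x) := fun _ =>
      inferInstanceAs (FiniteDimensional ℝ (EuclideanSpace ℝ (Fin d)))
    rw [exists_relation_eq_zero_iff (h.injective _) hc] at hx ⊢
    rwa [h.constant y x]

theorem LieEquivalent.symm {B₁ B₂ : Set (F × F)} (h : LieEquivalent B₁ B₂) :
    LieEquivalent B₂ B₁ := by
  obtain ⟨A, hA, hAB⟩ := h
  refine ⟨A.symm, fun z => by simpa using (hA (A.symm z)).symm, ?_⟩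
  have hmap := congrArg (Submodule.map (A.symm : LieSpace F →ₗ[ℝ] LieSpace F) '' ·) hAB
  simpa [Set.image_image, ← Submodule.map_comp] using hmap.symm

variable [FiniteDimensional ℝ F] {B : Set (F × F)}

theorem IsIsoparametric.exists_isCurvatureDirection_iff (h : IsIsoparametric d f ν)
    (hB : IsSubmanifold d B) {C : LieSpace F ≃ₗ[ℝ] LieSpace F}
    (hline : ∀ x, ∃ p ∈ B,
      (lieLine (f x, ν x)).map (C : LieSpace F →ₗ[ℝ] LieSpace F) = lieLine p)
    {p : F × F} {x : N}
    (hp : (lieLine (f x, ν x)).map (C : LieSpace F →ₗ[ℝ] LieSpace F) = lieLine p) :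
    ∃ L : (ℝ × ℝ) ≃ₗ[ℝ] ℝ × ℝ, ∀ c, IsCurvatureDirection B p (L c) ↔
      ∃ v ≠ 0, relation c (differential d f x v, differential d ν x v) = 0 := by
  have hf := contDiffAt_comp_extChartAt_symm (h.smooth_immersion x)
  have hν := contDiffAt_comp_extChartAt_symm (h.smooth_normal x)
  have hfderiv : ∀ v : EuclideanSpace ℝ (Fin d), fderiv ℝ (fun y =>
      ((f ∘ (extChartAt (𝓡 d) x).symm) y, (ν ∘ (extChartAt (𝓡 d) x).symm) y))
      (extChartAt (𝓡 d) x x) v = (differential d f x v, differential d ν x v) := fun v => by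
    rw [(hf.differentiableAt (by simp)).fderiv_prodMk (hν.differentiableAt (by simp)),
      differential_eq_fderiv (h.smooth_immersion x), differential_eq_fderiv (h.smooth_normal x)]
    rfl
  obtain ⟨L, hL⟩ := LieSphere.exists_isCurvatureDirection_iff hB
    (finrank_euclideanSpace_fin (𝕜 := ℝ)) (hf.prodMk hν)
    (fun v w hvw => h.injective x (congrArg Prod.fst
      ((hfderiv v).symm.trans (hvw.trans (hfderiv w)))))
    (fun y => hline _) (p := p) (C := C) (by simpa using hp)
  refine ⟨L, fun c => (hL c).trans ?_⟩
  simp only [hfderiv]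
  rfl

theorem not_lieEquivalentToIsoparametric (hB : IsLegendreSubmanifold B) {p q : F × F}
    (hp : p ∈ B) (hq : q ∈ B) (hharm : ContainsHarmonic {c | IsCurvatureDirection B p c})
    (hnot : ¬ ContainsHarmonic {c | IsCurvatureDirection B q c}) :
    ¬ LieEquivalentToIsoparametric.{u} B := by
  rintro ⟨d, N, _, _, _, _, _, f, ν, hiso, hequiv⟩
  obtain ⟨C, -, hC⟩ := hequiv.symm
  have hpoint : ∀ p ∈ B, ∃ x : N,
      (lieLine (f x, ν x)).map (C : LieSpace F →ₗ[ℝ] LieSpace F) = lieLine p := fun p hp => by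
    obtain ⟨_, ⟨x, rfl⟩, hx⟩ := hC ▸ Set.mem_image_of_mem lieLine hp
    exact ⟨x, hx⟩
  have hline : ∀ x : N, ∃ p ∈ B,
      (lieLine (f x, ν x)).map (C : LieSpace F →ₗ[ℝ] LieSpace F) = lieLine p := fun x => by
    obtain ⟨p, hp, hx⟩ := hC ▸ Set.mem_image_of_mem
      (fun p => (lieLine p).map (C : LieSpace F →ₗ[ℝ] LieSpace F)) (Set.mem_range_self x)
    exact ⟨p, hp, hx.symm⟩
  have hBd : IsSubmanifold d B := by
    have := hB.isSubmanifold
    rwa [← hiso.dim_eq, Nat.add_sub_cancel] at this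
  obtain ⟨x, hx⟩ := hpoint p hp
  obtain ⟨y, hy⟩ := hpoint q hq
  obtain ⟨L, hL⟩ := hiso.exists_isCurvatureDirection_iff hBd hline hx
  obtain ⟨M, hM⟩ := hiso.exists_isCurvatureDirection_iff hBd hline hy
  refine hnot (hharm.map (L.symm ≪≫ₗ M) fun c hc => (hM _).2 ?_)
  refine hiso.exists_relation_eq_zero x y ((hL _).1 ?_)
  simpa using hc

end Isoparametric

section Products

variable {E : Type*} [NormedAddCommGroup E] [NormedSpace ℝ E]
  {E' : Type*} [NormedAddCommGroup E'] [NormedSpace ℝ E'] {S : Set E} {S' : Set E'}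

theorem IsSubmanifold.prod [FiniteDimensional ℝ E] [FiniteDimensional ℝ E'] {k k' : ℕ}
    (hS : IsSubmanifold k S) (hS' : IsSubmanifold k' S') : IsSubmanifold (k + k') (S ×ˢ S') := by
  rintro ⟨p, p'⟩ ⟨hp, hp'⟩
  obtain ⟨Φ, W, hpΦ, hΦ, hΦsymm, hW, hΦS⟩ := hS p hp
  obtain ⟨Φ', W', hpΦ', hΦ', hΦsymm', hW', hΦS'⟩ := hS' p' hp'
  refine ⟨Φ.prod Φ', W.prod W', ⟨hpΦ, hpΦ'⟩, hΦ.prodMap hΦ', hΦsymm.prodMap hΦsymm', ?_,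
    fun x hx => and_congr (hΦS x.1 hx.1) (hΦS' x.2 hx.2)⟩
  have hrange : W.prod W' = LinearMap.range (W.subtype.prodMap W'.subtype) := by
    rw [LinearMap.range_prodMap, W.range_subtype, W'.range_subtype]
  rw [hrange, LinearMap.finrank_range_of_inj
    (W.subtype_injective.prodMap W'.subtype_injective), Module.finrank_prod, hW, hW']

theorem mem_tangentVectors_prod {p w : E × E'} :
    w ∈ tangentVectors (S ×ˢ S') p ↔ w.1 ∈ tangentVectors S p.1 ∧ w.2 ∈ tangentVectors S' p.2 := by
  constructor
  · rintro ⟨γ, hγ, rfl, hw, hmem⟩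
    exact ⟨⟨fun t => (γ t).1, hγ.fst, rfl, hw.fst, hmem.mono fun t ht => ht.1⟩,
      ⟨fun t => (γ t).2, hγ.snd, rfl, hw.snd, hmem.mono fun t ht => ht.2⟩⟩
  · rintro ⟨⟨γ, hγ, hp, hw, hmem⟩, ⟨γ', hγ', hp', hw', hmem'⟩⟩
    exact ⟨fun t => (γ t, γ' t), hγ.prodMk hγ', Prod.ext hp hp', hw.prodMk hw', hmem.and hmem'⟩

end Products

section QuadraticMaps

variable {X X' : Type*} [NormedAddCommGroup X] [NormedSpace ℝ X]
  [NormedAddCommGroup X'] [NormedSpace ℝ X']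

theorem fderiv_apply_of_quadratic {f : X → X'} {p w : X} (hf : DifferentiableAt ℝ f p) {v v' : X'}
    (h : ∀ t : ℝ, f (p + t • w) = f p + t • v + t ^ 2 • v') : fderiv ℝ f p w = v := by
  have hline : HasDerivAt (fun t : ℝ => f (p + t • w)) (fderiv ℝ f p w) 0 :=
    hf.hasFDerivAt.hasLineDerivAt w
  have hquadratic : HasDerivAt (fun t : ℝ => f p + t • v + t ^ 2 • v') v 0 := by
    simpa [Pi.add_def] using (((hasDerivAt_id (0 : ℝ)).smul_const v).const_add (f p)).add
      ((hasDerivAt_pow 2 (0 : ℝ)).smul_const v')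
  rw [funext h] at hline
  exact hline.unique hquadratic

variable {Y : Type*} [NormedAddCommGroup Y] [InnerProductSpace ℝ Y]

theorem inner_self_add_smul (x w : Y) (t : ℝ) :
    ⟪x + t • w, x + t • w⟫ = ⟪x, x⟫ + t • (2 * ⟪x, w⟫) + t ^ 2 • ⟪w, w⟫ := by
  simp only [inner_add_left, inner_add_right, real_inner_smul_left, real_inner_smul_right,
    real_inner_comm x w, smul_eq_mul]
  ring

theorem fderiv_inner_self_sub_const (r : ℝ) (y w : Y) :
    fderiv ℝ (fun y : Y => ⟪y, y⟫ - r) y w = 2 * ⟪y, w⟫ :=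
  fderiv_apply_of_quadratic (f := fun y => ⟪y, y⟫ - r) (v' := ⟪w, w⟫)
    ((differentiableAt_id.inner ℝ differentiableAt_id).sub_const r) fun t => by
    simp only [inner_self_add_smul, smul_eq_mul]
    ring

theorem fderiv_inner_self_sub_const_surjective {r : ℝ} (hr : 0 < r) {y : Y} (hy : ⟪y, y⟫ - r = 0) :
    Function.Surjective (fderiv ℝ (fun y : Y => ⟪y, y⟫ - r) y) := fun a => by
  refine ⟨(a / (2 * r)) • y, ?_⟩
  rw [fderiv_inner_self_sub_const, real_inner_smul_right, sub_eq_zero.1 hy]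
  field_simp

variable [FiniteDimensional ℝ Y] {r : ℝ}

theorem isCompact_setOf_inner_self_eq (r : ℝ) : IsCompact {y : Y | ⟪y, y⟫ = r} := by
  refine (isCompact_closedBall (0 : Y) √r).of_isClosed_subset
    (isClosed_eq (by fun_prop) (by fun_prop)) fun y hy => ?_
  rw [Set.mem_ofPred_eq, real_inner_self_eq_norm_sq] at hy
  rw [mem_closedBall_zero_iff, ← hy, Real.sqrt_sq (norm_nonneg y)]

theorem isSubmanifold_setOf_inner_self_eq (hr : 0 < r) {k : ℕ} (hk : k + 1 = Module.finrank ℝ Y) :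
    IsSubmanifold k {y : Y | ⟪y, y⟫ = r} := by
  simp only [← sub_eq_zero (b := r)]
  exact isSubmanifold_levelSet ((contDiff_id.inner ℝ contDiff_id).sub contDiff_const)
    (fun y hy => fderiv_inner_self_sub_const_surjective hr hy) (by rwa [Module.finrank_self])

theorem mem_tangentVectors_setOf_inner_self_eq (hr : 0 < r) {y : Y} (hy : ⟪y, y⟫ = r) {w : Y} :
    w ∈ tangentVectors {y : Y | ⟪y, y⟫ = r} y ↔ ⟪y, w⟫ = 0 := by
  simp only [← sub_eq_zero (b := r)]
  rw [tangentVectors_levelSet (G := fun y : Y => ⟪y, y⟫ - r)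
    ((contDiff_id.inner ℝ contDiff_id).sub contDiff_const) (sub_eq_zero.2 hy)
    (fderiv_inner_self_sub_const_surjective hr (sub_eq_zero.2 hy)), Set.mem_ofPred_eq,
    fderiv_inner_self_sub_const, mul_eq_zero, or_iff_right two_ne_zero]

end QuadraticMaps

section CliffordSystem

variable {F Y : Type*} [NormedAddCommGroup F] [InnerProductSpace ℝ F]
  [NormedAddCommGroup Y] [InnerProductSpace ℝ Y] {P : Y →L[ℝ] F →L[ℝ] F} {x : F}

/-- A Clifford system, encoded without a basis: a linear family of symmetric operators `P y` with
`(P y)² = ‖y‖²`. -/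
structure IsCliffordSystem (P : Y →L[ℝ] F →L[ℝ] F) : Prop where
  symm : ∀ y u v, ⟪P y u, v⟫ = ⟪u, P y v⟫
  sq : ∀ y u, P y (P y u) = ‖y‖ ^ 2 • u

/-- The focal submanifold of a Clifford system. -/
def focalSet (P : Y →L[ℝ] F →L[ℝ] F) : Set F := {x | ⟪x, x⟫ = 1 ∧ ∀ y, ⟪P y x, x⟫ = 0}

/-- The tangent space of the focal submanifold at `x`, defined by linear equations; see
`tangentVectors_focalSet`. -/
def focalTangent (P : Y →L[ℝ] F →L[ℝ] F) (x : F) : Set F :=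
  {w | ⟪x, w⟫ = 0 ∧ ∀ y, ⟪P y x, w⟫ = 0}

namespace IsCliffordSystem

theorem anticomm (hP : IsCliffordSystem P) (y z : Y) (u : F) :
    P y (P z u) + P z (P y u) = (2 * ⟪y, z⟫) • u := by
  have hsq := hP.sq (y + z) u
  simp only [map_add, add_apply, norm_add_sq_real, hP.sq, add_smul] at hsq
  refine add_left_cancel (a := ‖y‖ ^ 2 • u + ‖z‖ ^ 2 • u) ?_
  rw [← sub_eq_zero] at hsq ⊢
  rw [← hsq]
  abel

theorem anticomm_of_orthogonal (hP : IsCliffordSystem P) {y z : Y} (h : ⟪y, z⟫ = 0) (u : F) :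
    P y (P z u) = -P z (P y u) :=
  eq_neg_of_add_eq_zero_left (by rw [hP.anticomm, h, mul_zero, zero_smul])

theorem inner_apply_apply_of_mem (hP : IsCliffordSystem P) (hx : x ∈ focalSet P) (y z : Y) :
    ⟪P y x, P z x⟫ = ⟪y, z⟫ := by
  have hinner := congrArg (fun v => ⟪v, x⟫) (hP.anticomm y z x)
  simp only [inner_add_left, real_inner_smul_left, hP.symm _ (P _ x), hx.1,
    real_inner_comm (P y x) (P z x)] at hinner
  linarith

theorem eq_zero_of_apply_eq_zero (hP : IsCliffordSystem P) (hx : x ∈ focalSet P) {z : Y}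
    (h : P z x = 0) : z = 0 := by
  rw [← inner_self_eq_zero (𝕜 := ℝ), ← hP.inner_apply_apply_of_mem hx, h, inner_zero_left]

theorem inner_apply_apply_apply_eq_zero (hP : IsCliffordSystem P) (hx : x ∈ focalSet P) {y z : Y}
    (h : ⟪y, z⟫ = 0) (i : Y) : ⟪P y (P z x), P i x⟫ = 0 := by
  have hreverse : P z (P y (P i x)) =
      (2 * ⟪y, i⟫) • P z x - (2 * ⟪z, i⟫) • P y x - P i (P y (P z x)) := by
    rw [eq_sub_of_add_eq (hP.anticomm y i x), map_sub, map_smul,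
      eq_sub_of_add_eq (hP.anticomm z i (P y x)),
      hP.anticomm_of_orthogonal ((real_inner_comm y z).trans h), map_neg]
    abel
  have hinner := congrArg (fun v => ⟪v, x⟫) hreverse
  simp only [inner_sub_left, real_inner_smul_left, hx.2, mul_zero] at hinner
  rw [hP.symm z, hP.symm y, hP.symm i, real_inner_comm, hP.symm i] at hinner
  linarith

theorem inner_apply_apply_apply_self (hP : IsCliffordSystem P) (hx : x ∈ focalSet P) (e y : Y) :
    ⟪P e (P y x), P y x⟫ = 0 := by
  rw [eq_sub_of_add_eq (hP.anticomm e y x), inner_sub_left, real_inner_smul_left,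
    real_inner_comm (P y x) x, hx.2, mul_zero, hP.symm y, hP.sq, real_inner_smul_right, hx.2,
    mul_zero, sub_zero]

end IsCliffordSystem

variable [FiniteDimensional ℝ F]

theorem isCompact_focalSet : IsCompact (focalSet P) := by
  have : focalSet P = {x | ⟪x, x⟫ = 1} ∩ ⋂ y, {x | ⟪P y x, x⟫ = 0} := by
    ext x
    simp only [focalSet, Set.mem_inter_iff, Set.mem_iInter, Set.mem_ofPred_eq]
  rw [this]
  exact (isCompact_setOf_inner_self_eq 1).inter_right
    (isClosed_iInter fun y => isClosed_eq (by fun_prop) (by fun_prop))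

variable [FiniteDimensional ℝ Y]

/-- The `Y`-valued bilinear form of a Clifford system, characterized by
`⟪cliffordForm P u v, y⟫ = ⟪P y u, v⟫`; the focal submanifold is a level set of its diagonal. -/
def cliffordForm (P : Y →L[ℝ] F →L[ℝ] F) (u : F) : F →ₗ[ℝ] Y :=
  LinearMap.adjoint (P.flip u : Y →ₗ[ℝ] F)

theorem inner_cliffordForm (P : Y →L[ℝ] F →L[ℝ] F) (u v : F) (y : Y) :
    ⟪cliffordForm P u v, y⟫ = ⟪P y u, v⟫ := by
  rw [cliffordForm, LinearMap.adjoint_inner_left, real_inner_comm]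
  rfl

theorem cliffordForm_eq_iff {u v : F} {b : Y} :
    cliffordForm P u v = b ↔ ∀ y, ⟪P y u, v⟫ = ⟪b, y⟫ := by
  refine ⟨fun h y => by rw [← h, inner_cliffordForm], fun h => ext_inner_right ℝ fun y => ?_⟩
  rw [inner_cliffordForm, h]

theorem contDiff_cliffordForm {X : Type*} [NormedAddCommGroup X] [NormedSpace ℝ X] {f g : X → F}
    (hf : ContDiff ℝ ∞ f) (hg : ContDiff ℝ ∞ g) :
    ContDiff ℝ ∞ fun x => cliffordForm P (f x) (g x) := by
  have hexpand : ∀ u v, cliffordForm P u v =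
      ∑ i, ⟪P (stdOrthonormalBasis ℝ Y i) u, v⟫ • stdOrthonormalBasis ℝ Y i := fun u v => by
    rw [← (stdOrthonormalBasis ℝ Y).sum_repr' (cliffordForm P u v)]
    exact Finset.sum_congr rfl fun i _ => by rw [real_inner_comm, inner_cliffordForm]
  simp only [hexpand]
  exact ContDiff.sum fun i _ => (((P _).contDiff.comp hf).inner ℝ hg).smul contDiff_const

theorem cliffordForm_add_smul (hP : IsCliffordSystem P) (x w : F) (t : ℝ) :
    cliffordForm P (x + t • w) (x + t • w) =
      cliffordForm P x x + t • ((2 : ℝ) • cliffordForm P x w) + t ^ 2 • cliffordForm P w w := by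
  rw [cliffordForm_eq_iff]
  intro y
  simp only [inner_add_left, real_inner_smul_left, inner_cliffordForm, map_add, map_smul,
    inner_add_right, real_inner_smul_right]
  rw [hP.symm y w x, real_inner_comm (P y x) w]
  ring

/-- The equations of the focal submanifold. -/
def focalMap (P : Y →L[ℝ] F →L[ℝ] F) (x : F) : ℝ × Y := (⟪x, x⟫ - 1, cliffordForm P x x)

theorem setOf_focalMap_eq_zero (P : Y →L[ℝ] F →L[ℝ] F) : {x | focalMap P x = 0} = focalSet P := by
  ext x
  simp only [focalMap, focalSet, Set.mem_ofPred_eq, Prod.mk_eq_zero, sub_eq_zero,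
    cliffordForm_eq_iff, inner_zero_left]

theorem contDiff_focalMap : ContDiff ℝ ∞ (focalMap P) :=
  ((contDiff_id.inner ℝ contDiff_id).sub contDiff_const).prodMk
    (contDiff_cliffordForm contDiff_id contDiff_id)

theorem fderiv_focalMap (hP : IsCliffordSystem P) (x w : F) :
    fderiv ℝ (focalMap P) x w = (2 * ⟪x, w⟫, (2 : ℝ) • cliffordForm P x w) := by
  refine fderiv_apply_of_quadratic (v' := (⟪w, w⟫, cliffordForm P w w))
    (contDiff_focalMap.differentiable (by simp) x) fun t => ?_
  simp only [focalMap, inner_self_add_smul, cliffordForm_add_smul hP, Prod.mk_add_mk,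
    Prod.smul_mk, add_sub_right_comm]

theorem fderiv_focalMap_surjective (hP : IsCliffordSystem P) (hx : x ∈ focalSet P) :
    Function.Surjective (fderiv ℝ (focalMap P) x) := by
  rintro ⟨a, b⟩
  have hxP : ⟪x, P b x⟫ = 0 := (real_inner_comm _ _).trans (hx.2 b)
  have hform : cliffordForm P x (a • x + P b x) = b := by
    rw [cliffordForm_eq_iff]
    intro y
    rw [inner_add_right, real_inner_smul_right, hx.2, hP.inner_apply_apply_of_mem hx, mul_zero,
      zero_add, real_inner_comm]
  refine ⟨(2⁻¹ : ℝ) • (a • x + P b x), ?_⟩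
  rw [fderiv_focalMap hP, map_smul, hform, real_inner_smul_right, inner_add_right,
    real_inner_smul_right, hx.1, hxP, smul_inv_smul₀ two_ne_zero]
  ring_nf

theorem isSubmanifold_focalSet (hP : IsCliffordSystem P) {k : ℕ}
    (hk : k + (1 + Module.finrank ℝ Y) = Module.finrank ℝ F) : IsSubmanifold k (focalSet P) := by
  rw [← setOf_focalMap_eq_zero]
  refine isSubmanifold_levelSet contDiff_focalMap (fun x hx => fderiv_focalMap_surjective hP ?_) ?_
  · rwa [← setOf_focalMap_eq_zero]
  · rw [Module.finrank_prod, Module.finrank_self, hk]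

theorem tangentVectors_focalSet (hP : IsCliffordSystem P) (hx : x ∈ focalSet P) :
    tangentVectors (focalSet P) x = focalTangent P x := by
  have hsurj := fderiv_focalMap_surjective hP hx
  rw [← setOf_focalMap_eq_zero] at hx ⊢
  rw [tangentVectors_levelSet contDiff_focalMap hx hsurj]
  ext w
  simp only [focalTangent, Set.mem_ofPred_eq, fderiv_focalMap hP, Prod.mk_eq_zero, mul_eq_zero,
    smul_eq_zero, two_ne_zero, false_or, cliffordForm_eq_iff, inner_zero_left]

/-- The product of the focal submanifold with a sphere of squared radius `r`; it parametrizes the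
unit normal bundle of a stretched focal submanifold. -/
def focalProduct (P : Y →L[ℝ] F →L[ℝ] F) (r : ℝ) : Set (F × Y) := focalSet P ×ˢ {y | ⟪y, y⟫ = r}

theorem isCompact_focalProduct {r : ℝ} : IsCompact (focalProduct P r) :=
  isCompact_focalSet.prod (isCompact_setOf_inner_self_eq r)

theorem isSubmanifold_focalProduct (hP : IsCliffordSystem P) {r : ℝ} (hr : 0 < r)
    (hY : 0 < Module.finrank ℝ Y) (hF : Module.finrank ℝ Y < Module.finrank ℝ F) :
    IsSubmanifold (Module.finrank ℝ F - 2) (focalProduct P r) := by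
  have hfocal := isSubmanifold_focalSet hP
    (k := Module.finrank ℝ F - (1 + Module.finrank ℝ Y)) (by omega)
  have hsphere := isSubmanifold_setOf_inner_self_eq (Y := Y) hr
    (k := Module.finrank ℝ Y - 1) (by omega)
  rw [focalProduct]
  convert hfocal.prod hsphere using 1
  omega

theorem mem_tangentVectors_focalProduct (hP : IsCliffordSystem P) {r : ℝ} (hr : 0 < r)
    {p : F × Y} (hp : p ∈ focalProduct P r) {w : F × Y} :
    w ∈ tangentVectors (focalProduct P r) p ↔ w.1 ∈ focalTangent P p.1 ∧ ⟪p.2, w.2⟫ = 0 := by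
  rw [focalProduct, mem_tangentVectors_prod, tangentVectors_focalSet hP hp.1,
    mem_tangentVectors_setOf_inner_self_eq hr hp.2]

end CliffordSystem

section LeftInverses

variable {E : Type*} [NormedAddCommGroup E] [NormedSpace ℝ E]
  {E' : Type*} [NormedAddCommGroup E'] [NormedSpace ℝ E'] {S : Set E} {f : E → E'} {p : E}

theorem tangentVectors_image_of_leftInvOn {g : E' → E} (hf : ContDiff ℝ ∞ f) (hg : ContDiff ℝ ∞ g)
    (hgf : Set.LeftInvOn g f S) (hp : p ∈ S) :
    tangentVectors (f '' S) (f p) = fderiv ℝ f p '' tangentVectors S p := by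
  have hfp := (hf.differentiable (by simp) p).hasFDerivAt
  ext w
  constructor
  · rintro ⟨γ, hγ, hγp, hγw, hmem⟩
    have hgγp : g (γ 0) = p := by rw [hγp, hgf hp]
    have hgγ := (hg.differentiable (by simp) (γ 0)).hasFDerivAt.comp_hasDerivAt 0 hγw
    refine ⟨_, ⟨g ∘ γ, hg.contDiffAt.comp 0 hγ, hgγp, hgγ, ?_⟩, ?_⟩
    · filter_upwards [hmem] with t ⟨q, hq, hqt⟩
      rwa [Function.comp_apply, ← hqt, hgf hq]
    · rw [← hgγp] at hfp
      rw [← hgγp]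
      refine (hfp.comp_hasDerivAt (0 : ℝ) hgγ).unique (hγw.congr_of_eventuallyEq ?_)
      filter_upwards [hmem] with t ⟨q, hq, hqt⟩
      simp only [Function.comp_apply, ← hqt, hgf hq]
  · rintro ⟨w, hw, rfl⟩
    exact mem_tangentVectors_image hf.contDiffAt hfp
      (Eventually.of_forall fun q hq => Set.mem_image_of_mem f hq) hw

theorem isEmbedding_of_isCompact {X X' : Type*} [TopologicalSpace X] [TopologicalSpace X']
    [T2Space X'] {K : Set X} {h : X → X'} (hK : IsCompact K) (hh : ContinuousOn h K)
    (hinj : Set.InjOn h K) : IsEmbedding fun q : K => h q := by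
  have := isCompact_iff_compactSpace.1 hK
  exact (hh.domRestrict.isClosedEmbedding hinj.injective).isEmbedding

end LeftInverses

section Stretching

variable {F Y : Type*} [NormedAddCommGroup F] [InnerProductSpace ℝ F]
  [NormedAddCommGroup Y] [InnerProductSpace ℝ Y] {P : Y →L[ℝ] F →L[ℝ] F}
  {T : F ≃L[ℝ] F} {e : Y} {δ : ℝ} {x : F} {y : Y}

/-- `T` is a symmetric automorphism of the form `√(1 + δ P e)` for a unit vector `e`. For
`T (u, v) = √2 (α u, β v)` and `P e (u, v) = (u, -v)` this holds with `δ = α² - β²`. -/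
structure IsStretching (P : Y →L[ℝ] F →L[ℝ] F) (T : F ≃L[ℝ] F) (e : Y) (δ : ℝ) : Prop where
  symm : ∀ u v, ⟪T u, v⟫ = ⟪u, T v⟫
  sq : ∀ u, T (T u) = u + δ • P e u
  inner_self : ⟪e, e⟫ = 1
  sq_lt_one : δ ^ 2 < 1

namespace IsStretching

theorem inv_symm (hT : IsStretching P T e δ) (u v : F) : ⟪T.symm u, v⟫ = ⟪u, T.symm v⟫ := by
  conv_rhs => rw [← T.apply_symm_apply u, hT.symm, T.apply_symm_apply]

theorem pos (hT : IsStretching P T e δ) : 0 < 1 - δ ^ 2 := sub_pos.2 hT.sq_lt_one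

theorem inner_inv_inv (hT : IsStretching P T e δ) (hP : IsCliffordSystem P)
    (hx : x ∈ focalSet P) (y : Y) :
    (1 - δ ^ 2) * ⟪T.symm (P y x), T.symm (P y x)⟫ = ⟪y, y⟫ := by
  have happly : T (T (P y x - δ • P e (P y x))) = (1 - δ ^ 2) • P y x := by
    rw [hT.sq, map_sub, map_smul, hP.sq, ← real_inner_self_eq_norm_sq, hT.inner_self]
    module
  have hinv : (1 - δ ^ 2) • T.symm (T.symm (P y x)) = P y x - δ • P e (P y x) := by
    rw [← map_smul, ← map_smul, ← happly, T.symm_apply_apply, T.symm_apply_apply]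
  rw [← hT.inv_symm, ← real_inner_smul_left, hinv, inner_sub_left, real_inner_smul_left,
    hP.inner_apply_apply_apply_self hx, hP.inner_apply_apply_of_mem hx, mul_zero, sub_zero]

theorem norm_inv_apply_eq_one_iff (hT : IsStretching P T e δ) (hP : IsCliffordSystem P)
    (hx : x ∈ focalSet P) : ‖T.symm (P y x)‖ = 1 ↔ ⟪y, y⟫ = 1 - δ ^ 2 := by
  rw [← hT.inner_inv_inv hP hx, real_inner_self_eq_norm_sq, mul_eq_left₀ hT.pos.ne',
    pow_eq_one_iff_of_nonneg (norm_nonneg _) two_ne_zero]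

end IsStretching

/-- The map `(x, y) ↦ (T x, T⁻¹ (P y x))`. It parametrizes the unit normal bundle of the image of
the focal submanifold under `T`, because `P y x` runs through the normal vectors at `x`. -/
def normalMap (P : Y →L[ℝ] F →L[ℝ] F) (T : F ≃L[ℝ] F) (p : F × Y) : F × F :=
  (T p.1, T.symm (P p.2 p.1))

theorem contDiff_normalMap : ContDiff ℝ ∞ (normalMap P T) := by
  unfold normalMap
  fun_prop

theorem fderiv_normalMap (p w : F × Y) :
    fderiv ℝ (normalMap P T) p w = (T w.1, T.symm (P w.2 p.1 + P p.2 w.1)) := by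
  refine fderiv_apply_of_quadratic (v' := (0, T.symm (P w.2 w.1)))
    (contDiff_normalMap.differentiable (by simp) p) fun t => Prod.ext ?_ ?_
  · simp only [normalMap, Prod.fst_add, Prod.smul_fst, map_add, map_smul, smul_zero, add_zero]
  · simp only [normalMap, Prod.fst_add, Prod.snd_add, Prod.smul_fst, Prod.smul_snd, map_add,
      map_smul, add_apply, smul_apply]
    module

variable [FiniteDimensional ℝ F] [FiniteDimensional ℝ Y]

/-- A left inverse of `normalMap P T` over the focal submanifold. -/
def normalInv (P : Y →L[ℝ] F →L[ℝ] F) (T : F ≃L[ℝ] F) (q : F × F) : F × Y :=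
  (T.symm q.1, cliffordForm P (T.symm q.1) (T q.2))

theorem contDiff_normalInv : ContDiff ℝ ∞ (normalInv P T) :=
  ContDiff.prodMk (by fun_prop) (contDiff_cliffordForm (by fun_prop) (by fun_prop))

theorem leftInvOn_normalInv (hP : IsCliffordSystem P) (r : ℝ) :
    Set.LeftInvOn (normalInv P T) (normalMap P T) (focalProduct P r) := by
  rintro p ⟨hp, -⟩
  refine Prod.ext (T.symm_apply_apply _) ?_
  simp only [normalInv, normalMap, T.symm_apply_apply, T.apply_symm_apply, cliffordForm_eq_iff]
  intro y
  rw [hP.inner_apply_apply_of_mem hp, real_inner_comm]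

theorem mem_tangentVectors_stretched (hP : IsCliffordSystem P) (hx : x ∈ focalSet P)
    {v : F} : v ∈ tangentVectors (T '' focalSet P) (T x) ↔ T.symm v ∈ focalTangent P x := by
  rw [tangentVectors_image_of_leftInvOn T.contDiff T.symm.contDiff
    (fun x _ => T.symm_apply_apply x) hx, tangentVectors_focalSet hP hx, T.fderiv]
  exact T.toEquiv.image_eq_preimage_symm _ ▸ Iff.rfl

theorem normalMap_mem_unitNormalBundle (hP : IsCliffordSystem P) (hT : IsStretching P T e δ)
    {p : F × Y} (hp : p ∈ focalProduct P (1 - δ ^ 2)) :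
    normalMap P T p ∈ unitNormalBundle (T '' focalSet P) := by
  refine ⟨Set.mem_image_of_mem T hp.1, (hT.norm_inv_apply_eq_one_iff hP hp.1).2 hp.2, ?_,
    fun v hv => ?_⟩
  · rw [normalMap, ← hT.inv_symm, T.symm_apply_apply, real_inner_comm, hp.1.2]
  · rw [normalMap, ← hT.inv_symm, real_inner_comm]
    exact ((mem_tangentVectors_stretched hP hp.1).1 hv).2 _

theorem exists_normalMap_eq (hP : IsCliffordSystem P) (hT : IsStretching P T e δ)
    {q : F × F} (hq : q ∈ unitNormalBundle (T '' focalSet P)) :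
    ∃ p ∈ focalProduct P (1 - δ ^ 2), normalMap P T p = q := by
  obtain ⟨X, Ξ⟩ := q
  obtain ⟨⟨x, hx, rfl⟩, hunit, horth, hnormal⟩ := hq
  let y := cliffordForm P x (T Ξ)
  have htangent : T Ξ - P y x ∈ focalTangent P x := by
    refine ⟨?_, fun z => ?_⟩
    · rw [inner_sub_right, ← hT.symm, horth, real_inner_comm, hx.2, sub_zero]
    · rw [inner_sub_right, hP.inner_apply_apply_of_mem hx, ← inner_cliffordForm,
        real_inner_comm, sub_self]
  have horthogonal : ⟪T Ξ - P y x, T Ξ⟫ = 0 := by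
    rw [← hT.symm]
    exact hnormal _ ((mem_tangentVectors_stretched hP hx).2 (by rwa [T.symm_apply_apply]))
  have hzero : T Ξ - P y x = 0 := by
    rw [← inner_self_eq_zero (𝕜 := ℝ), inner_sub_right, horthogonal, real_inner_comm,
      htangent.2, sub_zero]
  have hΞ : T.symm (P y x) = Ξ := by rw [← sub_eq_zero.1 hzero, T.symm_apply_apply]
  exact ⟨(x, y), ⟨hx, (hT.norm_inv_apply_eq_one_iff hP hx).1 (hΞ.symm ▸ hunit)⟩,
    Prod.ext rfl hΞ⟩

theorem unitNormalBundle_stretched (hP : IsCliffordSystem P) (hT : IsStretching P T e δ) :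
    unitNormalBundle (T '' focalSet P) = normalMap P T '' focalProduct P (1 - δ ^ 2) :=
  Set.Subset.antisymm (fun _ hq => exists_normalMap_eq hP hT hq)
    (Set.image_subset_iff.2 fun _ hp => normalMap_mem_unitNormalBundle hP hT hp)

theorem mem_tangentVectors_normalBundle (hP : IsCliffordSystem P) {r : ℝ} (hr : 0 < r)
    {p : F × Y} (hp : p ∈ focalProduct P r) {v : F × F} :
    v ∈ tangentVectors (normalMap P T '' focalProduct P r) (normalMap P T p) ↔
      ∃ w ∈ focalTangent P p.1, ∃ z, ⟪p.2, z⟫ = 0 ∧ v = (T w, T.symm (P z p.1 + P p.2 w)) := by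
  rw [tangentVectors_image_of_leftInvOn contDiff_normalMap contDiff_normalInv
    (leftInvOn_normalInv hP r) hp]
  simp only [Set.mem_image, mem_tangentVectors_focalProduct hP hr hp, fderiv_normalMap,
    Prod.exists, and_assoc, exists_and_left, eq_comm (a := v)]

theorem isLegendreSubmanifold_unitNormalBundle (hP : IsCliffordSystem P)
    (hT : IsStretching P T e δ) (hF : Module.finrank ℝ Y < Module.finrank ℝ F)
    (hunit : ∀ x ∈ focalSet P, ‖T x‖ = 1) :
    IsLegendreSubmanifold (unitNormalBundle (T '' focalSet P)) where
  unit_fst := by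
    rintro p ⟨⟨x, hx, hxp⟩, -⟩
    rw [← hxp, hunit x hx]
  unit_snd p hp := hp.2.1
  orthogonal p hp := hp.2.2.1
  isSubmanifold := by
    have he : e ≠ 0 := fun h => by simpa [h] using hT.inner_self
    rw [unitNormalBundle_stretched hP hT]
    refine (isSubmanifold_focalProduct hP hT.pos (Module.finrank_pos_iff_exists_ne_zero.2 ⟨e, he⟩)
      hF).image contDiff_normalMap (isEmbedding_of_isCompact isCompact_focalProduct
        contDiff_normalMap.continuous.continuousOn (leftInvOn_normalInv hP _).injOn) ?_
    rintro ⟨x, y⟩ hp ⟨w, z⟩ - hzero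
    rw [fderiv_normalMap, Prod.mk_eq_zero, map_eq_zero_iff T T.injective,
      map_eq_zero_iff T.symm T.symm.injective] at hzero
    obtain ⟨rfl : w = 0, hz⟩ := hzero
    rw [map_zero, add_zero] at hz
    exact Prod.ext rfl (hP.eq_zero_of_apply_eq_zero hp.1 hz)
  contact p hp w hw :=
    hp.2.2.2 _ (mem_tangentVectors_image contDiff_fst.contDiffAt
      (ContinuousLinearMap.fst ℝ F F).hasFDerivAt (Eventually.of_forall fun q hq => hq.1) hw)

theorem isCompact_unitNormalBundle (hP : IsCliffordSystem P) (hT : IsStretching P T e δ) :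
    IsCompact (unitNormalBundle (T '' focalSet P)) := by
  rw [unitNormalBundle_stretched hP hT]
  exact isCompact_focalProduct.image contDiff_normalMap.continuous

end Stretching

section Eigenvectors

variable {F Y : Type*} [NormedAddCommGroup F] [InnerProductSpace ℝ F]
  [NormedAddCommGroup Y] [InnerProductSpace ℝ Y] {P : Y →L[ℝ] F →L[ℝ] F}
  {T : F ≃L[ℝ] F} {e : Y} {δ : ℝ} {x : F} {y : Y}

theorem smul_add_symm_eq_zero_iff (hT : IsStretching P T e δ) (κ : ℝ) (w : F) (z : Y) :
    κ • T w + T.symm (P z x + P y w) = 0 ↔ κ • w + P (y + (κ * δ) • e) w + P z x = 0 := by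
  rw [← map_eq_zero_iff T T.injective, map_add, map_smul, hT.sq, T.apply_symm_apply, map_add,
    map_smul, add_apply, smul_apply]
  refine Eq.congr_left ?_
  module

theorem eigenvalue_cases (hP : IsCliffordSystem P) (hx : x ∈ focalSet P) {κ : ℝ} {w : F} {z b : Y}
    (hw : w ∈ focalTangent P x) (h : κ • w + P b w + P z x = 0) (hne : w ≠ 0 ∨ z ≠ 0) :
    κ = 0 ∨ (z = 0 ∧ κ ^ 2 = ⟪b, b⟫) := by
  have hcomponent : (⟪b, b⟫ - κ ^ 2) • w = κ • P z x - P b (P z x) := by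
    have hPw : P b w = -(κ • w) - P z x := by
      rw [eq_sub_iff_add_eq, eq_neg_iff_add_eq_zero, ← h]
      abel
    have hsq := hP.sq b w
    rw [← real_inner_self_eq_norm_sq, hPw, map_sub, map_neg, map_smul, hPw] at hsq
    rw [sub_smul, ← hsq]
    module
  have hκ : κ * ⟪z, z⟫ = 0 := by
    have hinner := congrArg (fun v => ⟪P z x, v⟫) hcomponent
    simp only [real_inner_smul_right, inner_sub_right, hw.2,
      hP.inner_apply_apply_of_mem hx] at hinner
    rw [real_inner_comm (P b (P z x)), hP.inner_apply_apply_apply_self hx] at hinner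
    linarith
  refine (mul_eq_zero.1 hκ).imp_right fun hzz => ?_
  obtain rfl : z = 0 := inner_self_eq_zero.1 hzz
  rw [map_zero, zero_apply, smul_zero, map_zero, sub_zero, smul_eq_zero, sub_eq_zero] at hcomponent
  exact ⟨rfl, (hcomponent.resolve_right (hne.resolve_right (not_not.2 rfl))).symm⟩

theorem exists_ne_zero_inner_eq_zero [FiniteDimensional ℝ Y] (hY : 2 ≤ Module.finrank ℝ Y)
    (y : Y) : ∃ z, z ≠ 0 ∧ ⟪y, z⟫ = 0 := by
  have hker : LinearMap.ker (innerₛₗ ℝ y) ≠ ⊥ :=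
    LinearMap.ker_ne_bot_of_finrank_lt (by rw [Module.finrank_self]; omega)
  obtain ⟨z, hz, hz0⟩ := Submodule.exists_mem_ne_zero_of_ne_bot hker
  exact ⟨z, hz0, hz⟩

theorem exists_eigenvector_zero [FiniteDimensional ℝ Y] (hP : IsCliffordSystem P)
    (hx : x ∈ focalSet P) (hY : 2 ≤ Module.finrank ℝ Y) (hy : y ≠ 0) :
    ∃ w ∈ focalTangent P x, ∃ z, ⟪y, z⟫ = 0 ∧ z ≠ 0 ∧ P y w + P z x = 0 := by
  obtain ⟨z, hz, hyz⟩ := exists_ne_zero_inner_eq_zero hY y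
  have hy' : ‖y‖ ^ 2 ≠ 0 := pow_ne_zero 2 (norm_ne_zero_iff.2 hy)
  refine ⟨(-(‖y‖ ^ 2)⁻¹) • P y (P z x), ⟨?_, fun i => ?_⟩, z, hyz, hz, ?_⟩
  · rw [real_inner_smul_right, ← hP.symm, hP.inner_apply_apply_of_mem hx, hyz, mul_zero]
  · rw [real_inner_smul_right, real_inner_comm, hP.inner_apply_apply_apply_eq_zero hx hyz, mul_zero]
  · rw [map_smul, hP.sq, smul_smul, neg_mul, inv_mul_cancel₀ hy', neg_one_smul, neg_add_cancel]

theorem IsCliffordSystem.injective (hP : IsCliffordSystem P) (hy : y ≠ 0) :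
    Function.Injective (P y) := fun u v huv => by
  have hsq := hP.sq y u
  rw [huv, hP.sq] at hsq
  exact (smul_right_injective F (pow_ne_zero 2 (norm_ne_zero_iff.2 hy)) hsq).symm

variable [FiniteDimensional ℝ F] [FiniteDimensional ℝ Y]

theorem finrank_le_two_mul_finrank_ker (hP : IsCliffordSystem P)
    (hY : 2 ≤ Module.finrank ℝ Y) {κ : ℝ} {b : Y} (hb : κ ^ 2 = ⟪b, b⟫) :
    Module.finrank ℝ F ≤
      2 * Module.finrank ℝ (LinearMap.ker (κ • LinearMap.id + (P b : F →ₗ[ℝ] F))) := by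
  set A : F →ₗ[ℝ] F := κ • LinearMap.id - (P b : F →ₗ[ℝ] F)
  set E := LinearMap.ker (κ • LinearMap.id + (P b : F →ₗ[ℝ] F))
  have hrange : LinearMap.range A ≤ E := by
    rintro _ ⟨u, rfl⟩
    change κ • (κ • u - P b u) + P b (κ • u - P b u) = 0
    rw [map_sub, map_smul, hP.sq, ← real_inner_self_eq_norm_sq, ← hb]
    module
  obtain ⟨z, hz, hbz⟩ := exists_ne_zero_inner_eq_zero hY b
  have hmap : (LinearMap.ker A).map (P z : F →ₗ[ℝ] F) ≤ E := by
    rintro _ ⟨u, hu : κ • u - P b u = 0, rfl⟩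
    change κ • P z u + P b (P z u) = 0
    rw [hP.anticomm_of_orthogonal hbz, ← map_smul, ← sub_eq_add_neg, ← map_sub, hu, map_zero]
  have hker := Submodule.finrank_mono hmap
  rw [← ((LinearMap.ker A).equivMapOfInjective _ (hP.injective hz)).finrank_eq] at hker
  have := Submodule.finrank_mono hrange
  have := A.finrank_range_add_finrank_ker
  omega

theorem exists_eigenvector (hP : IsCliffordSystem P) (hY : 2 ≤ Module.finrank ℝ Y)
    (hF : 2 * Module.finrank ℝ Y < Module.finrank ℝ F) {κ : ℝ} (hκ : κ ≠ 0) {b : Y}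
    (hb : κ ^ 2 = ⟪b, b⟫) : ∃ w ∈ focalTangent P x, w ≠ 0 ∧ κ • w + P b w = 0 := by
  have hfinrank := finrank_le_two_mul_finrank_ker (F := F) hP hY hb
  set E := LinearMap.ker (κ • LinearMap.id + (P b : F →ₗ[ℝ] F))
  have hker : LinearMap.ker (cliffordForm P x ∘ₗ E.subtype) ≠ ⊥ :=
    LinearMap.ker_ne_bot_of_finrank_lt (by omega)
  obtain ⟨⟨w, hwE : κ • w + P b w = 0⟩, hw : cliffordForm P x w = 0, hw0⟩ :=
    Submodule.exists_mem_ne_zero_of_ne_bot hker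
  have hnormal : ∀ y, ⟪P y x, w⟫ = 0 := fun y => by
    rw [← inner_cliffordForm, hw, inner_zero_left]
  have hx : κ * ⟪x, w⟫ = 0 := by
    rw [← real_inner_smul_right, eq_neg_of_add_eq_zero_left hwE, inner_neg_right, ← hP.symm,
      hnormal, neg_zero]
  exact ⟨w, ⟨(mul_eq_zero.1 hx).resolve_left hκ, hnormal⟩, fun h => hw0 (Subtype.ext h), hwE⟩

end Eigenvectors

section Parallel

variable {F : Type*} [NormedAddCommGroup F] [InnerProductSpace ℝ F]

theorem eq_inner_smul_of_mem_orthogonal [FiniteDimensional ℝ F] {U : Submodule ℝ F}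
    (hU : Module.finrank ℝ U + 2 = Module.finrank ℝ F) {h k n : F} (hh : ‖h‖ = 1) (hk : ‖k‖ = 1)
    (hhk : ⟪h, k⟫ = 0) (hhU : h ∈ Uᗮ) (hkU : k ∈ Uᗮ) (hnU : n ∈ Uᗮ) (hhn : ⟪h, n⟫ = 0) :
    n = ⟪k, n⟫ • k := by
  have hon : Orthonormal ℝ ![h, k] := by
    simp [orthonormal_vecCons_iff, hh, hk, hhk]
  have hspan : Submodule.span ℝ (Set.range ![h, k]) = Uᗮ := by
    refine Submodule.eq_of_le_of_finrank_eq (Submodule.span_le.2 ?_) ?_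
    · rintro _ ⟨i, rfl⟩
      fin_cases i
      exacts [hhU, hkU]
    · have hUperp := U.finrank_add_finrank_orthogonal
      rw [finrank_span_eq_card hon.linearIndependent, Fintype.card_fin]
      omega
  rw [← hspan, Matrix.range_cons_cons_empty, Submodule.mem_span_pair] at hnU
  obtain ⟨r, s, rfl⟩ := hnU
  have hr : r = 0 := by
    simpa [inner_add_right, real_inner_smul_right, hh, hhk] using hhn
  simp [hr, real_inner_smul_right, hk]

/-- The point `a x + b ξ` of the normal great circle of a contact element `(x, ξ)`; the parallel
hypersurfaces and tubes are images of a Legendre submanifold under this map. -/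
def parallelPoint (a b : ℝ) : F × F →L[ℝ] F :=
  a • ContinuousLinearMap.fst ℝ F F + b • ContinuousLinearMap.snd ℝ F F

/-- The unit normal `-b x + a ξ` of the parallel hypersurface at the point `a x + b ξ`. -/
def parallelNormal (a b : ℝ) : F × F →L[ℝ] F :=
  -b • ContinuousLinearMap.fst ℝ F F + a • ContinuousLinearMap.snd ℝ F F

theorem parallelPoint_apply (a b : ℝ) (p : F × F) : parallelPoint a b p = a • p.1 + b • p.2 := rfl

theorem parallelNormal_apply (a b : ℝ) (p : F × F) :
    parallelNormal a b p = -b • p.1 + a • p.2 := rfl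

theorem parallelMap_eq (a b ε : ℝ) (p : F × F) :
    parallelMap a b ε p = (parallelPoint a b p, ε • parallelNormal a b p) := rfl

namespace IsLegendreSubmanifold

variable {B : Set (F × F)} {a b : ℝ} {p w : F × F}

theorem norm_parallelPoint (hB : IsLegendreSubmanifold B) (hab : a ^ 2 + b ^ 2 = 1) (hp : p ∈ B) :
    ‖parallelPoint a b p‖ = 1 :=
  norm_smul_add_smul_eq_one hab (hB.unit_fst p hp) (hB.unit_snd p hp) (hB.orthogonal p hp)

theorem norm_parallelNormal (hB : IsLegendreSubmanifold B) (hab : a ^ 2 + b ^ 2 = 1)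
    (hp : p ∈ B) : ‖parallelNormal a b p‖ = 1 :=
  norm_smul_add_smul_eq_one (by rw [neg_sq, add_comm, hab]) (hB.unit_fst p hp) (hB.unit_snd p hp)
    (hB.orthogonal p hp)

theorem inner_parallelPoint_parallelNormal (hB : IsLegendreSubmanifold B) (hp : p ∈ B) :
    ⟪parallelPoint a b p, parallelNormal a b p⟫ = 0 := by
  have hcomm : ⟪p.2, p.1⟫ = 0 := by rw [real_inner_comm, hB.orthogonal p hp]
  simp only [parallelPoint_apply, parallelNormal_apply, inner_add_left, inner_add_right,
    real_inner_smul_left, real_inner_smul_right, real_inner_self_eq_norm_sq, hB.unit_fst p hp,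
    hB.unit_snd p hp, hB.orthogonal p hp, hcomm]
  ring

theorem inner_parallelPoint_tangent (hB : IsLegendreSubmanifold B) (hp : p ∈ B)
    (hw : w ∈ tangentVectors B p) (c d : ℝ) : ⟪parallelPoint a b w, c • p.1 + d • p.2⟫ = 0 := by
  obtain ⟨h₁, h₂, h₁₂⟩ := hB.inner_tangent hw
  have hcontact := hB.contact p hp w hw
  rw [hcontact, add_zero] at h₁₂
  rw [real_inner_comm] at h₁ h₂ h₁₂
  simp [parallelPoint_apply, inner_add_left, inner_add_right, real_inner_smul_left,
    real_inner_smul_right, h₁, h₂, h₁₂, hcontact]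

variable [FiniteDimensional ℝ F]

theorem exists_finrank_eq_image_parallelPoint (hB : IsLegendreSubmanifold B) (hp : p ∈ B)
    (himm : ∀ w ∈ tangentVectors B p, parallelPoint a b w = 0 → w = 0) :
    ∃ U : Submodule ℝ F, Module.finrank ℝ U = Module.finrank ℝ F - 2 ∧
      (U : Set F) = parallelPoint a b '' tangentVectors B p := by
  obtain ⟨S, hS, hST⟩ := hB.isSubmanifold.exists_tangentSpace hp
  refine ⟨S.map (parallelPoint a b).toLinearMap, ?_, by rw [Submodule.map_coe, hST]; rfl⟩
  have hinj : Function.Injective ((parallelPoint a b).toLinearMap.comp S.subtype) := by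
    rw [← LinearMap.ker_eq_bot, LinearMap.ker_eq_bot']
    exact fun w hw => Subtype.ext (himm w (hST ▸ w.2) hw)
  rw [← hS, ← LinearMap.finrank_range_of_inj hinj, LinearMap.range_comp, Submodule.range_subtype]

theorem eq_inner_smul_parallelNormal (hB : IsLegendreSubmanifold B) (hab : a ^ 2 + b ^ 2 = 1)
    (hF : 2 ≤ Module.finrank ℝ F) (hp : p ∈ B)
    (himm : ∀ w ∈ tangentVectors B p, parallelPoint a b w = 0 → w = 0) {n : F}
    (hpn : ⟪parallelPoint a b p, n⟫ = 0)
    (hwn : ∀ w ∈ tangentVectors B p, ⟪parallelPoint a b w, n⟫ = 0) :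
    n = ⟪parallelNormal a b p, n⟫ • parallelNormal a b p := by
  obtain ⟨U, hU, hUT⟩ := hB.exists_finrank_eq_image_parallelPoint hp himm
  have hmem {v : F} (hv : ∀ w ∈ tangentVectors B p, ⟪parallelPoint a b w, v⟫ = 0) : v ∈ Uᗮ := by
    refine (Submodule.mem_orthogonal _ _).2 fun u hu => ?_
    obtain ⟨w, hw, rfl⟩ : u ∈ parallelPoint a b '' tangentVectors B p := hUT ▸ hu
    exact hv w hw
  exact eq_inner_smul_of_mem_orthogonal (by omega) (hB.norm_parallelPoint hab hp)
    (hB.norm_parallelNormal hab hp) (hB.inner_parallelPoint_parallelNormal hp)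
    (hmem fun w hw => hB.inner_parallelPoint_tangent hp hw a b)
    (hmem fun w hw => hB.inner_parallelPoint_tangent hp hw (-b) a) (hmem hwn) hpn

end IsLegendreSubmanifold

/-- The hypotheses under which the points `a x + b ξ`, for `(x, ξ)` in a compact Legendre
submanifold `B`, form an embedded hypersurface of the sphere that is parametrized by `B`. -/
structure HasParallelHypersurface (a b : ℝ) (B : Set (F × F)) : Prop where
  legendre : IsLegendreSubmanifold B
  isCompact : IsCompact B
  sq_add_sq : a ^ 2 + b ^ 2 = 1
  injOn : Set.InjOn (parallelPoint a b) B
  immersive : ∀ p ∈ B, ∀ w ∈ tangentVectors B p, parallelPoint a b w = 0 → w = 0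

namespace HasParallelHypersurface

variable {B : Set (F × F)} {a b : ℝ} {p : F × F}

theorem image_subset_sphere (h : HasParallelHypersurface a b B) :
    parallelPoint a b '' B ⊆ Metric.sphere 0 1 := by
  rintro _ ⟨p, hp, rfl⟩
  exact mem_sphere_zero_iff_norm.2 (h.legendre.norm_parallelPoint h.sq_add_sq hp)

theorem isEmbedding (h : HasParallelHypersurface a b B) :
    IsEmbedding fun q : B => parallelPoint a b (q : F × F) :=
  isEmbedding_of_isCompact h.isCompact (parallelPoint a b).continuous.continuousOn h.injOn

variable [FiniteDimensional ℝ F]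

theorem isSubmanifold (h : HasParallelHypersurface a b B) :
    IsSubmanifold (Module.finrank ℝ F - 2) (parallelPoint a b '' B) :=
  h.legendre.isSubmanifold.image (ContinuousLinearMap.contDiff _) h.isEmbedding
    fun p hp w hw hzero => h.immersive p hp w hw (by rwa [ContinuousLinearMap.fderiv] at hzero)

theorem exists_local_leftInverse (h : HasParallelHypersurface a b B) (hp : p ∈ B) :
    ∃ g : F → F × F, ContDiffAt ℝ ∞ g (parallelPoint a b p) ∧ g (parallelPoint a b p) = p ∧
      ∀ᶠ y in 𝓝[parallelPoint a b '' B] parallelPoint a b p,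
        ∃ q ∈ B, parallelPoint a b q = y ∧ g y = q := by
  obtain ⟨g, hg, hgp, hgB⟩ := h.legendre.isSubmanifold.exists_local_leftInverse
    (ContinuousLinearMap.contDiff _) h.isEmbedding hp
    fun w hw hzero => h.immersive p hp w hw (by rwa [ContinuousLinearMap.fderiv] at hzero)
  refine ⟨g, hg, hgp, ?_⟩
  rw [← map_nhdsWithin_of_isEmbedding h.isEmbedding hp, eventually_map]
  filter_upwards [hgB, self_mem_nhdsWithin] with q hgq hq using ⟨q, hq, rfl, hgq⟩

theorem mem_tangentVectors_iff (h : HasParallelHypersurface a b B) (hp : p ∈ B) {v : F} :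
    v ∈ tangentVectors (parallelPoint a b '' B) (parallelPoint a b p) ↔
      ∃ w ∈ tangentVectors B p, parallelPoint a b w = v := by
  constructor
  · intro hv
    obtain ⟨g, hg, hgp, hgB⟩ := h.exists_local_leftInverse hp
    have hgd := (hg.differentiableAt (by simp)).hasFDerivAt
    have hgB' := eventually_nhdsWithin_iff.1 hgB
    have htangent := mem_tangentVectors_image (S' := B) hg hgd
      (hgB'.mono fun y hy hyB => by
        obtain ⟨q, hq, -, hgy⟩ := hy hyB
        rwa [hgy]) hv
    rw [hgp] at htangent
    refine ⟨_, htangent, ?_⟩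
    obtain ⟨γ, hγ, h0, hd, hS⟩ := hv
    rw [← h0] at hgd
    have hcomp := (parallelPoint (F := F) a b).hasFDerivAt.comp_hasDerivAt (0 : ℝ)
      (hgd.comp_hasDerivAt (0 : ℝ) hd)
    rw [h0] at hcomp
    refine hcomp.unique (hd.congr_of_eventuallyEq ?_)
    filter_upwards [hS, hγ.continuousAt.eventually (h0.symm ▸ hgB')] with t ht hgt
    obtain ⟨q, -, hqt, hgq⟩ := hgt ht
    simp only [Function.comp, hgq, hqt]
  · rintro ⟨w, hw, rfl⟩
    exact mem_tangentVectors_image (ContinuousLinearMap.contDiff _).contDiffAt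
      (parallelPoint (F := F) a b).hasFDerivAt (Eventually.of_forall fun q hq => ⟨q, hq, rfl⟩) hw

theorem exists_isUnitNormalField (h : HasParallelHypersurface a b B) :
    ∃ ν, IsUnitNormalField (parallelPoint a b '' B) ν ∧
      ∀ p ∈ B, ν (parallelPoint a b p) = parallelNormal a b p := by
  have hinv := h.injOn.leftInvOn_invFunOn
  have hνB : ∀ p ∈ B, parallelNormal a b (Function.invFunOn (parallelPoint a b) B
      (parallelPoint a b p)) = parallelNormal a b p := fun p hp => by rw [hinv hp]
  refine ⟨fun y => parallelNormal a b (Function.invFunOn (parallelPoint a b) B y),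
    ⟨?_, ?_, ?_, ?_⟩, hνB⟩
  · rintro _ ⟨p, hp, rfl⟩
    obtain ⟨g, hg, hgp, hgB⟩ := h.exists_local_leftInverse hp
    refine (((parallelNormal a b).contDiff.contDiffAt.comp _ hg).contDiffWithinAt
      ).congr_of_eventuallyEq ?_ (by rw [hνB p hp, Function.comp, hgp])
    filter_upwards [hgB]
    rintro _ ⟨q, hq, rfl, hgq⟩
    rw [hνB q hq, Function.comp, hgq]
  · rintro _ ⟨p, hp, rfl⟩
    rw [hνB p hp, h.legendre.norm_parallelNormal h.sq_add_sq hp]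
  · rintro _ ⟨p, hp, rfl⟩
    rw [hνB p hp, h.legendre.inner_parallelPoint_parallelNormal hp]
  · rintro _ ⟨p, hp, rfl⟩ v hv
    obtain ⟨w, hw, rfl⟩ := (h.mem_tangentVectors_iff hp).1 hv
    rw [hνB p hp]
    exact h.legendre.inner_parallelPoint_tangent hp hw (-b) a

theorem eq_smul_parallelNormal (h : HasParallelHypersurface a b B)
    (hF : 2 ≤ Module.finrank ℝ F) {ν : F → F} (hν : IsUnitNormalField (parallelPoint a b '' B) ν)
    (hp : p ∈ B) : ∃ ε : ℝ, ε ^ 2 = 1 ∧ ν (parallelPoint a b p) = ε • parallelNormal a b p ∧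
      ⟪parallelNormal a b p, ν (parallelPoint a b p)⟫ = ε := by
  have hmem : parallelPoint a b p ∈ parallelPoint a b '' B := ⟨p, hp, rfl⟩
  have heq := h.legendre.eq_inner_smul_parallelNormal h.sq_add_sq hF hp (h.immersive p hp)
    (hν.orthogonal _ hmem)
    fun w hw => hν.normal _ hmem _ ((h.mem_tangentVectors_iff hp).2 ⟨w, hw, rfl⟩)
  refine ⟨_, ?_, heq, rfl⟩
  have hnorm := congrArg norm heq
  rw [norm_smul, hν.unit _ hmem, h.legendre.norm_parallelNormal h.sq_add_sq hp, mul_one] at hnorm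
  rw [← sq_abs, ← Real.norm_eq_abs, ← hnorm, one_pow]

theorem exists_eventually_eq_smul_parallelNormal (h : HasParallelHypersurface a b B)
    (hF : 2 ≤ Module.finrank ℝ F) {ν : F → F} (hν : IsUnitNormalField (parallelPoint a b '' B) ν)
    (hp : p ∈ B) : ∃ ε : ℝ, ε ^ 2 = 1 ∧ ∀ᶠ y in 𝓝 (parallelPoint a b p),
      ∀ q ∈ B, parallelPoint a b q = y → ν y = ε • parallelNormal a b q := by
  obtain ⟨ν₀, hν₀, hν₀B⟩ := h.exists_isUnitNormalField
  have hmem : parallelPoint a b p ∈ parallelPoint a b '' B := ⟨p, hp, rfl⟩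
  obtain ⟨ε, hε, -, hinner⟩ := h.eq_smul_parallelNormal hF hν hp
  have hcont : ContinuousWithinAt (fun y => ⟪ν₀ y, ν y⟫) (parallelPoint a b '' B)
      (parallelPoint a b p) :=
    (hν₀.smooth.continuousOn _ hmem).inner (hν.smooth.continuousOn _ hmem)
  refine ⟨ε, hε, ?_⟩
  -- The sign `⟪ν₀, ν⟫ = ±1` is continuous, hence locally constant.
  filter_upwards [eventually_nhdsWithin_iff.1 (hcont (Metric.ball_mem_nhds _ one_pos))]
    with y hy q hq hqy
  subst hqy
  obtain ⟨ε', hε', hνq, hinner'⟩ := h.eq_smul_parallelNormal hF hν hq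
  have hdist : |ε' - ε| < 1 := by
    have := hy ⟨q, hq, rfl⟩
    rwa [Metric.mem_ball, Real.dist_eq, hν₀B q hq, hν₀B p hp, hinner, hinner'] at this
  have hεε' : ε' = ε := by
    rcases sq_eq_one_iff.1 hε with rfl | rfl <;> rcases sq_eq_one_iff.1 hε' with rfl | rfl <;>
      first | rfl | norm_num at hdist
  rw [hνq, hεε']

theorem exists_isParallelNear_hypersurfaceLift (h : HasParallelHypersurface a b B)
    (hF : 2 ≤ Module.finrank ℝ F) {ν : F → F} (hν : IsUnitNormalField (parallelPoint a b '' B) ν)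
    (hp : p ∈ B) : ∃ ε, ν (parallelPoint a b p) = ε • parallelNormal a b p ∧
      IsParallelNear a b ε B (hypersurfaceLift (parallelPoint a b '' B) ν)
        (parallelPoint a b p, ν (parallelPoint a b p)) := by
  obtain ⟨ε, hε, hlocal⟩ := h.exists_eventually_eq_smul_parallelNormal hF hν hp
  refine ⟨ε, hlocal.self_of_nhds p hp rfl, h.sq_add_sq, hε, ?_⟩
  filter_upwards [(continuous_fst.tendsto (parallelPoint a b p, _)).eventually hlocal] with r hr
  constructor
  · rintro ⟨_, ⟨q, hq, rfl⟩, rfl⟩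
    have hmap : (parallelPoint a b q, ν (parallelPoint a b q)) = parallelMap a b ε q := by
      rw [parallelMap_eq, hr q hq rfl]
    change parallelMap a (-(ε * b)) ε (parallelPoint a b q, ν (parallelPoint a b q)) ∈ B
    rwa [hmap, parallelMap_leftInverse h.sq_add_sq hε]
  · intro hq
    have hmap := parallelMap_rightInverse h.sq_add_sq hε r
    rw [parallelMap_eq] at hmap
    refine ⟨r.1, ⟨_, hq, congrArg Prod.fst hmap⟩, Prod.ext rfl ?_⟩
    exact (hr _ hq (congrArg Prod.fst hmap)).trans (congrArg Prod.snd hmap)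

end HasParallelHypersurface

end Parallel

section Roots

/-- The negative root of `κ² - 2 s κ - 1`. -/
def rootNeg (s : ℝ) : ℝ := s - √(s ^ 2 + 1)

/-- The positive root of `κ² - 2 s κ - 1`. -/
def rootPos (s : ℝ) : ℝ := s + √(s ^ 2 + 1)

theorem abs_lt_sqrt_sq_add_one (s : ℝ) : |s| < √(s ^ 2 + 1) := by
  rw [← Real.sqrt_sq_eq_abs]
  exact Real.sqrt_lt_sqrt (sq_nonneg s) (lt_add_one _)

theorem rootNeg_lt_zero (s : ℝ) : rootNeg s < 0 :=
  sub_neg.2 ((le_abs_self s).trans_lt (abs_lt_sqrt_sq_add_one s))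

theorem zero_lt_rootPos (s : ℝ) : 0 < rootPos s :=
  neg_lt_iff_pos_add'.1 ((neg_le_abs s).trans_lt (abs_lt_sqrt_sq_add_one s))

theorem rootNeg_add_rootPos (s : ℝ) : rootNeg s + rootPos s = 2 * s := by
  unfold rootNeg rootPos
  ring

theorem eq_rootNeg_or_eq_rootPos_iff {s κ : ℝ} :
    κ = rootNeg s ∨ κ = rootPos s ↔ κ ^ 2 - 2 * s * κ - 1 = 0 := by
  have hfactor : κ ^ 2 - 2 * s * κ - 1 = (κ - rootNeg s) * (κ - rootPos s) := by
    unfold rootNeg rootPos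
    linear_combination Real.sq_sqrt (show 0 ≤ s ^ 2 + 1 by positivity)
  rw [hfactor, mul_eq_zero, sub_eq_zero, sub_eq_zero]

theorem differentiable_rootNeg : Differentiable ℝ rootNeg :=
  differentiable_id.sub (Differentiable.sqrt (by fun_prop) fun s => by positivity)

theorem differentiable_rootPos : Differentiable ℝ rootPos :=
  differentiable_id.add (Differentiable.sqrt (by fun_prop) fun s => by positivity)

theorem rootPos_eq_of_pos {s κ : ℝ} (hκ : 0 < κ) (h : κ ^ 2 - 2 * s * κ - 1 = 0) :
    rootPos s = κ :=
  ((eq_rootNeg_or_eq_rootPos_iff.2 h).resolve_left fun h' =>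
    (hκ.trans_eq h').not_gt (rootNeg_lt_zero s)).symm

theorem rootNeg_eq_of_neg {s κ : ℝ} (hκ : κ < 0) (h : κ ^ 2 - 2 * s * κ - 1 = 0) :
    rootNeg s = κ :=
  ((eq_rootNeg_or_eq_rootPos_iff.2 h).resolve_right fun h' =>
    (h'.symm.trans_lt hκ).not_gt (zero_lt_rootPos s)).symm

end Roots

section Harmonic

theorem coordDet_smul_smul (s t : ℝ) (c d : ℝ × ℝ) :
    coordDet (s • c) (t • d) = s * t * coordDet c d := by
  simp only [coordDet, Prod.smul_fst, Prod.smul_snd, smul_eq_mul]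
  ring

theorem exists_eq_smul_of_coordDet_eq_zero {c d : ℝ × ℝ} (hd : d ≠ 0) (h : coordDet c d = 0) :
    ∃ t : ℝ, c = t • d := by
  unfold coordDet at h
  rcases eq_or_ne d.2 0 with hd2 | hd2
  · have hd1 : d.1 ≠ 0 := fun hd1 => hd (Prod.ext hd1 hd2)
    have hc2 : c.2 = 0 := by simpa [hd1, hd2] using h
    exact ⟨c.1 / d.1, Prod.ext (div_mul_cancel₀ _ hd1).symm (by simp [hc2, hd2])⟩
  · refine ⟨c.2 / d.2, Prod.ext ?_ (div_mul_cancel₀ _ hd2).symm⟩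
    simp only [Prod.smul_fst, smul_eq_mul]
    field_simp
    linarith

/-- Homogeneous coordinates of the points `a, 0, b, ∞` of the extended line; for `a < 0 < b` they
are in increasing order. -/
def quadruple (a b : ℝ) : Fin 4 → ℝ × ℝ := ![(a, 1), (0, 1), (b, 1), (1, 0)]

variable {a b : ℝ}

theorem quadruple_ne_zero (a b : ℝ) (j : Fin 4) : quadruple a b j ≠ 0 := by
  fin_cases j <;> simp [quadruple]

theorem affineCoord_quadruple (a b : ℝ) : (fun j => affineCoord (quadruple a b j)) =
    ![((a : ℝ) : WithTop ℝ), ((0 : ℝ) : WithTop ℝ), ((b : ℝ) : WithTop ℝ), ⊤] := by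
  funext j
  fin_cases j <;> simp [quadruple, affineCoord]

theorem coordDet_quadruple_ne_zero (ha : a < 0) (hb : 0 < b) {i j : Fin 4} (hij : i ≠ j) :
    coordDet (quadruple a b i) (quadruple a b j) ≠ 0 := by
  have hab : a - b ≠ 0 := by linarith
  have hba : b - a ≠ 0 := by linarith
  fin_cases i <;> fin_cases j <;>
    simp [quadruple, coordDet, ha.ne, hb.ne', hab, hba] at hij ⊢

theorem add_eq_zero_of_harmonic_quadruple (ha : a < 0) (hb : 0 < b) {i j k l : Fin 4}
    (hij : i ≠ j) (hik : i ≠ k) (hil : i ≠ l) (hjk : j ≠ k) (hjl : j ≠ l) (hkl : k ≠ l)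
    (h : coordDet (quadruple a b i) (quadruple a b j) *
        coordDet (quadruple a b k) (quadruple a b l) =
      coordDet (quadruple a b j) (quadruple a b k) *
        coordDet (quadruple a b i) (quadruple a b l)) : a + b = 0 := by
  fin_cases i <;> fin_cases j <;> fin_cases k <;> fin_cases l <;>
    first
      | contradiction
      | simp only [quadruple, coordDet, Fin.reduceFinMk, Fin.zero_eta, Fin.mk_one,
          Matrix.cons_val] at h
        linarith

theorem containsHarmonic_iff_add_eq_zero {C : Set (ℝ × ℝ)} (ha : a < 0) (hb : 0 < b)
    (hC : ∀ j, quadruple a b j ∈ C)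
    (hC' : ∀ c ∈ C, c ≠ 0 → ∃ j, coordDet c (quadruple a b j) = 0) :
    ContainsHarmonic C ↔ a + b = 0 := by
  constructor
  · rintro ⟨v, hv, hne, h⟩
    have hv0 : ∀ i, v i ≠ 0 := by
      intro i hi
      obtain ⟨j, hij⟩ := exists_ne i
      exact hne i j hij.symm (by simp [coordDet, hi])
    choose σ hσ using fun i => hC' (v i) (hv i) (hv0 i)
    choose t ht using fun i => exists_eq_smul_of_coordDet_eq_zero (quadruple_ne_zero a b _) (hσ i)
    have ht0 : ∀ i, t i ≠ 0 := fun i hi => hv0 i (by rw [ht, hi, zero_smul])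
    have hσ_inj : ∀ i j, i ≠ j → σ i ≠ σ j := fun i j hij hσij => hne i j hij (by
      rw [ht i, ht j, coordDet_smul_smul, hσij, coordDet, sub_self, mul_zero])
    rw [ht 0, ht 1, ht 2, ht 3] at h
    simp only [coordDet_smul_smul] at h
    refine add_eq_zero_of_harmonic_quadruple ha hb (hσ_inj 0 1 (by decide))
      (hσ_inj 0 2 (by decide)) (hσ_inj 0 3 (by decide)) (hσ_inj 1 2 (by decide))
      (hσ_inj 1 3 (by decide)) (hσ_inj 2 3 (by decide)) ?_
    refine mul_left_cancel₀ (mul_ne_zero (mul_ne_zero (mul_ne_zero (ht0 0) (ht0 1)) (ht0 2))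
      (ht0 3)) ?_
    linear_combination h
  · intro hab
    refine ⟨quadruple a b, hC, fun i j => coordDet_quadruple_ne_zero ha hb, ?_⟩
    simp only [quadruple, coordDet, Matrix.cons_val]
    linarith

end Harmonic

section StretchedCurvatures

variable {F Y : Type*} [NormedAddCommGroup F] [InnerProductSpace ℝ F]
  [NormedAddCommGroup Y] [InnerProductSpace ℝ Y] {P : Y →L[ℝ] F →L[ℝ] F}
  {T : F ≃L[ℝ] F} {e : Y} {δ : ℝ}

/-- Half the sum of the two principal curvatures of the stretched focal set other than `0` and `∞`,
as a function of the contact element. -/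
def halfSum (P : Y →L[ℝ] F →L[ℝ] F) (T : F ≃L[ℝ] F) (e : Y) (δ : ℝ) (q : F × F) : ℝ :=
  δ / (1 - δ ^ 2) * ⟪P e (T.symm q.1), T q.2⟫

theorem halfSum_normalMap (hP : IsCliffordSystem P) {p : F × Y} (hp : p.1 ∈ focalSet P) :
    halfSum P T e δ (normalMap P T p) = δ / (1 - δ ^ 2) * ⟪e, p.2⟫ := by
  simp only [halfSum, normalMap, T.symm_apply_apply, T.apply_symm_apply,
    hP.inner_apply_apply_of_mem hp]

theorem contDiff_halfSum : ContDiff ℝ ∞ (halfSum P T e δ) := by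
  unfold halfSum
  exact contDiff_const.mul (ContDiff.inner ℝ (by fun_prop) (by fun_prop))

theorem fderiv_halfSum (q v : F × F) : fderiv ℝ (halfSum P T e δ) q v =
    δ / (1 - δ ^ 2) * (⟪P e (T.symm q.1), T v.2⟫ + ⟪P e (T.symm v.1), T q.2⟫) := by
  refine fderiv_apply_of_quadratic (v' := δ / (1 - δ ^ 2) * ⟪P e (T.symm v.1), T v.2⟫)
    (contDiff_halfSum.differentiable (by simp) q) fun t => ?_
  simp only [halfSum, Prod.fst_add, Prod.snd_add, Prod.smul_fst, Prod.smul_snd, map_add,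
    map_smul, inner_add_left, inner_add_right, real_inner_smul_left, real_inner_smul_right,
    smul_eq_mul]
  ring

/-- Homogeneous coordinates of the four principal curvatures of the stretched focal set at the
contact element `q`. -/
def stretchedCurvatures (P : Y →L[ℝ] F →L[ℝ] F) (T : F ≃L[ℝ] F) (e : Y) (δ : ℝ) (j : Fin 4)
    (q : F × F) : ℝ × ℝ :=
  quadruple (rootNeg (halfSum P T e δ q)) (rootPos (halfSum P T e δ q)) j

theorem IsStretching.sq_eq_inner_self_iff (hT : IsStretching P T e δ) {y : Y}
    (hy : ⟪y, y⟫ = 1 - δ ^ 2) {κ : ℝ} :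
    κ ^ 2 = ⟪y + (κ * δ) • e, y + (κ * δ) • e⟫ ↔
      κ ^ 2 - 2 * (δ / (1 - δ ^ 2) * ⟪e, y⟫) * κ - 1 = 0 := by
  have hinner : ⟪y + (κ * δ) • e, y + (κ * δ) • e⟫ =
      1 - δ ^ 2 + 2 * κ * δ * ⟪e, y⟫ + κ ^ 2 * δ ^ 2 := by
    simp only [inner_add_left, inner_add_right, real_inner_smul_left, real_inner_smul_right, hy,
      hT.inner_self, real_inner_comm e y]
    ring
  have hpos := hT.pos.ne'
  have hmul : (1 - δ ^ 2) * (κ ^ 2 - 2 * (δ / (1 - δ ^ 2) * ⟪e, y⟫) * κ - 1) =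
      κ ^ 2 - (1 - δ ^ 2 + 2 * κ * δ * ⟪e, y⟫ + κ ^ 2 * δ ^ 2) := by
    field_simp
    ring
  rw [hinner, ← sub_eq_zero, ← hmul, mul_eq_zero, or_iff_right hpos]

variable [FiniteDimensional ℝ F] [FiniteDimensional ℝ Y] {p : F × Y}

theorem fderiv_halfSum_eq_zero_of_relation_eq_zero (hP : IsCliffordSystem P)
    (hT : IsStretching P T e δ) (hp : p ∈ focalProduct P (1 - δ ^ 2)) {v : F × F}
    (hv : v ∈ tangentVectors (normalMap P T '' focalProduct P (1 - δ ^ 2)) (normalMap P T p))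
    {κ : ℝ} (hκ : κ ≠ 0) (hr : relation (κ, 1) v = 0) :
    fderiv ℝ (halfSum P T e δ) (normalMap P T p) v = 0 := by
  obtain ⟨w, hw, z, -, rfl⟩ := (mem_tangentVectors_normalBundle hP hT.pos hp).1 hv
  rw [relation_apply, one_smul, smul_add_symm_eq_zero_iff hT] at hr
  have hz : z = 0 := by
    by_contra hne
    rcases eigenvalue_cases hP hp.1 hw hr (Or.inr hne) with h | h
    · exact hκ h
    · exact hne h.1
  have hleft : ⟪P e p.1, P p.2 w⟫ = ⟪P p.2 (P e p.1), w⟫ := (hP.symm _ _ _).symm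
  have hright : ⟪P e w, P p.2 p.1⟫ = ⟪P e (P p.2 p.1), w⟫ := by rw [hP.symm, real_inner_comm]
  simp only [fderiv_halfSum, normalMap, hz, map_zero, zero_apply, zero_add, T.symm_apply_apply,
    T.apply_symm_apply]
  rw [hleft, hright, ← inner_add_left, hP.anticomm, real_inner_smul_left, hw.1, mul_zero, mul_zero]

theorem isCurvatureDirection_of_root (hP : IsCliffordSystem P) (hT : IsStretching P T e δ)
    (hY : 2 ≤ Module.finrank ℝ Y) (hF : 2 * Module.finrank ℝ Y < Module.finrank ℝ F)
    (hp : p ∈ focalProduct P (1 - δ ^ 2)) {κ : ℝ} (hκ : κ ≠ 0)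
    (h : κ ^ 2 - 2 * halfSum P T e δ (normalMap P T p) * κ - 1 = 0) :
    IsCurvatureDirection (normalMap P T '' focalProduct P (1 - δ ^ 2)) (normalMap P T p)
      (κ, 1) := by
  rw [halfSum_normalMap hP hp.1, ← hT.sq_eq_inner_self_iff hp.2] at h
  obtain ⟨w, hw, hw0, hwr⟩ := exists_eigenvector (x := p.1) hP hY hF hκ h
  refine ⟨_, (mem_tangentVectors_normalBundle hP hT.pos hp).2
    ⟨w, hw, 0, inner_zero_right _, rfl⟩, fun h0 => hw0 ?_, ?_⟩
  · exact T.map_eq_zero_iff.1 (Prod.mk_eq_zero.1 h0).1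
  · rw [relation_apply, one_smul, smul_add_symm_eq_zero_iff hT, map_zero, zero_apply, add_zero, hwr]

theorem isCurvatureDirection_zero (hP : IsCliffordSystem P) (hT : IsStretching P T e δ)
    (hY : 2 ≤ Module.finrank ℝ Y) (hp : p ∈ focalProduct P (1 - δ ^ 2)) :
    IsCurvatureDirection (normalMap P T '' focalProduct P (1 - δ ^ 2)) (normalMap P T p)
      (0, 1) := by
  have hy : p.2 ≠ 0 := real_inner_self_pos.1 (hT.pos.trans_eq hp.2.symm)
  obtain ⟨w, hw, z, hz, hz0, hr⟩ := exists_eigenvector_zero hP hp.1 hY hy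
  refine ⟨_, (mem_tangentVectors_normalBundle hP hT.pos hp).2 ⟨w, hw, z, hz, rfl⟩,
    fun h0 => hz0 ?_, ?_⟩
  · rw [T.map_eq_zero_iff.1 (Prod.mk_eq_zero.1 h0).1, map_zero, zero_add] at hr
    exact hP.eq_zero_of_apply_eq_zero hp.1 hr
  · rw [relation_apply, zero_smul, zero_add, one_smul, add_comm (P z p.1), hr, map_zero]

theorem isCurvatureDirection_top (hP : IsCliffordSystem P) (hT : IsStretching P T e δ)
    (hY : 2 ≤ Module.finrank ℝ Y) (hp : p ∈ focalProduct P (1 - δ ^ 2)) :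
    IsCurvatureDirection (normalMap P T '' focalProduct P (1 - δ ^ 2)) (normalMap P T p)
      (1, 0) := by
  obtain ⟨z, hz, hyz⟩ := exists_ne_zero_inner_eq_zero hY p.2
  refine ⟨_, (mem_tangentVectors_normalBundle hP hT.pos hp).2
    ⟨0, ⟨inner_zero_right _, fun _ => inner_zero_right _⟩, z, hyz, rfl⟩, fun h0 => hz ?_, ?_⟩
  · have hPz := T.symm.map_eq_zero_iff.1 (Prod.mk_eq_zero.1 h0).2
    rw [map_zero, add_zero] at hPz
    exact hP.eq_zero_of_apply_eq_zero hp.1 hPz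
  · simp only [relation_apply, map_zero, smul_zero, zero_smul, add_zero]

theorem exists_coordDet_stretchedCurvatures_eq_zero (hP : IsCliffordSystem P)
    (hT : IsStretching P T e δ) (hp : p ∈ focalProduct P (1 - δ ^ 2)) {c : ℝ × ℝ}
    (h : IsCurvatureDirection (normalMap P T '' focalProduct P (1 - δ ^ 2)) (normalMap P T p) c) :
    ∃ j, coordDet c (stretchedCurvatures P T e δ j (normalMap P T p)) = 0 := by
  obtain ⟨v, hv, hv0, hr⟩ := h
  obtain ⟨w, hw, z, -, rfl⟩ := (mem_tangentVectors_normalBundle hP hT.pos hp).1 hv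
  rcases eq_or_ne c.2 0 with h2 | h2
  · exact ⟨3, by simp [coordDet, stretchedCurvatures, quadruple, h2]⟩
  have hc : c = c.2 • (c.1 / c.2, 1) :=
    Prod.ext (mul_div_cancel₀ _ h2).symm (mul_one _).symm
  rw [hc, relation_smul_left, smul_eq_zero_iff_right h2, relation_apply, one_smul,
    smul_add_symm_eq_zero_iff hT] at hr
  have hne : w ≠ 0 ∨ z ≠ 0 := by
    by_contra! h0
    exact hv0 (by simp [h0.1, h0.2])
  rcases eigenvalue_cases hP hp.1 hw hr hne with h | h
  · have hc1 : c.1 = 0 := (div_eq_zero_iff.1 h).resolve_right h2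
    exact ⟨1, by simp [coordDet, stretchedCurvatures, quadruple, hc1]⟩
  · have hroot := (hT.sq_eq_inner_self_iff hp.2).1 h.2
    rw [← halfSum_normalMap (T := T) hP hp.1, ← eq_rootNeg_or_eq_rootPos_iff, div_eq_iff h2,
      div_eq_iff h2] at hroot
    rcases hroot with hc1 | hc1
    · exact ⟨0, by simp [coordDet, stretchedCurvatures, quadruple, hc1]⟩
    · exact ⟨2, by simp [coordDet, stretchedCurvatures, quadruple, hc1]⟩

theorem exists_hasFDerivAt_comp_halfSum (hP : IsCliffordSystem P) (hT : IsStretching P T e δ)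
    (hp : p ∈ focalProduct P (1 - δ ^ 2)) {R : ℝ → ℝ} (hR : Differentiable ℝ R)
    (hR0 : R (halfSum P T e δ (normalMap P T p)) ≠ 0) :
    ∃ D : F × F →L[ℝ] ℝ × ℝ,
      HasFDerivAt (fun q => (R (halfSum P T e δ q), (1 : ℝ))) D (normalMap P T p) ∧
      ∀ v ∈ tangentVectors (normalMap P T '' focalProduct P (1 - δ ^ 2)) (normalMap P T p),
        relation (R (halfSum P T e δ (normalMap P T p)), 1) v = 0 → D v = 0 := by
  have hs := (contDiff_halfSum (P := P) (T := T) (e := e) (δ := δ)).differentiable (by simp)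
    (normalMap P T p) |>.hasFDerivAt
  refine ⟨_, ((hR _).hasFDerivAt.comp _ hs).prodMk (hasFDerivAt_const _ _), fun v hv hr => ?_⟩
  simp [fderiv_halfSum_eq_zero_of_relation_eq_zero hP hT hp hv hR0 hr]

theorem curvatureSystemOn_stretched (hP : IsCliffordSystem P) (hT : IsStretching P T e δ)
    (hY : 2 ≤ Module.finrank ℝ Y) (hF : 2 * Module.finrank ℝ Y < Module.finrank ℝ F) :
    CurvatureSystemOn 4 (unitNormalBundle (T '' focalSet P)) Set.univ
      (stretchedCurvatures P T e δ) := by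
  rw [unitNormalBundle_stretched hP hT]
  constructor
  · exact fun q _ => quadruple_ne_zero _ _
  · exact fun q _ i j => coordDet_quadruple_ne_zero (rootNeg_lt_zero _) (zero_lt_rootPos _)
  · rintro _ ⟨⟨p, hp, rfl⟩, -⟩ j
    fin_cases j
    · exact isCurvatureDirection_of_root hP hT hY hF hp (rootNeg_lt_zero _).ne
        (eq_rootNeg_or_eq_rootPos_iff.1 (Or.inl rfl))
    · exact isCurvatureDirection_zero hP hT hY hp
    · exact isCurvatureDirection_of_root hP hT hY hF hp (zero_lt_rootPos _).ne'
        (eq_rootNeg_or_eq_rootPos_iff.1 (Or.inr rfl))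
    · exact isCurvatureDirection_top hP hT hY hp
  · rintro _ ⟨⟨p, hp, rfl⟩, -⟩ c -
    exact exists_coordDet_stretchedCurvatures_eq_zero hP hT hp
  · rintro _ ⟨⟨p, hp, rfl⟩, -⟩ j
    fin_cases j
    · exact exists_hasFDerivAt_comp_halfSum hP hT hp differentiable_rootNeg (rootNeg_lt_zero _).ne
    · exact ⟨0, hasFDerivAt_const _ _, fun _ _ _ => rfl⟩
    · exact exists_hasFDerivAt_comp_halfSum hP hT hp differentiable_rootPos (zero_lt_rootPos _).ne'
    · exact ⟨0, hasFDerivAt_const _ _, fun _ _ _ => rfl⟩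

theorem principalCurvatures_stretched (hP : IsCliffordSystem P) (hT : IsStretching P T e δ)
    (hY : 2 ≤ Module.finrank ℝ Y) (hF : 2 * Module.finrank ℝ Y < Module.finrank ℝ F) {q : F × F}
    (hq : q ∈ unitNormalBundle (T '' focalSet P)) :
    principalCurvatures (unitNormalBundle (T '' focalSet P)) q =
      {((rootNeg (halfSum P T e δ q) : ℝ) : WithTop ℝ), ((0 : ℝ) : WithTop ℝ),
        ((rootPos (halfSum P T e δ q) : ℝ) : WithTop ℝ), ⊤} := by
  rw [(curvatureSystemOn_stretched hP hT hY hF).principalCurvatures_eq ⟨hq, Set.mem_univ q⟩]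
  simp only [stretchedCurvatures, affineCoord_quadruple, Matrix.range_cons, Matrix.range_empty,
    Set.union_empty, Set.singleton_union]

theorem containsHarmonic_stretched_iff (hP : IsCliffordSystem P) (hT : IsStretching P T e δ)
    (hY : 2 ≤ Module.finrank ℝ Y) (hF : 2 * Module.finrank ℝ Y < Module.finrank ℝ F) {q : F × F}
    (hq : q ∈ unitNormalBundle (T '' focalSet P)) :
    ContainsHarmonic {c | IsCurvatureDirection (unitNormalBundle (T '' focalSet P)) q c} ↔
      halfSum P T e δ q = 0 := by
  have h := curvatureSystemOn_stretched hP hT hY hF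
  refine (containsHarmonic_iff_add_eq_zero (rootNeg_lt_zero _) (zero_lt_rootPos _)
    (h.isCurvatureDirection q ⟨hq, Set.mem_univ q⟩)
    fun c hc hc0 => h.complete q ⟨hq, Set.mem_univ q⟩ c hc0 hc).trans ?_
  rw [rootNeg_add_rootPos, mul_eq_zero_iff_left two_ne_zero]

end StretchedCurvatures

section Tubes

variable {F Y : Type*} [NormedAddCommGroup F] [InnerProductSpace ℝ F]
  [NormedAddCommGroup Y] [InnerProductSpace ℝ Y] {P : Y →L[ℝ] F →L[ℝ] F}
  {T : F ≃L[ℝ] F} {e : Y} {δ : ℝ} {a b : ℝ}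

theorem tube_eq_image_parallelPoint (V : Set F) (t : ℝ) :
    tube V t = parallelPoint (Real.cos t) (Real.sin t) '' unitNormalBundle V := by
  ext y
  simp only [tube, Set.mem_image, parallelPoint_apply]
  exact exists_congr fun p => and_congr_right fun _ => eq_comm

namespace IsCliffordSystem

variable {x x' : F} {y : Y}

theorem abs_inner_apply_self_le (hP : IsCliffordSystem P) (hy : ⟪y, y⟫ ≤ 1) (u : F) :
    |⟪P y u, u⟫| ≤ ⟪u, u⟫ := by
  have hsq : ‖P y u‖ ^ 2 = ⟪y, y⟫ * ‖u‖ ^ 2 := by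
    rw [← real_inner_self_eq_norm_sq, hP.symm, hP.sq, real_inner_smul_right,
      real_inner_self_eq_norm_sq, real_inner_self_eq_norm_sq]
  have hnorm : ‖P y u‖ ≤ ‖u‖ :=
    (sq_le_sq₀ (norm_nonneg _) (norm_nonneg _)).1
      (hsq.trans_le (mul_le_of_le_one_left (sq_nonneg _) hy))
  rw [real_inner_self_eq_norm_mul_norm]
  exact (abs_real_inner_le_norm _ _).trans (mul_le_mul_of_nonneg_right hnorm (norm_nonneg _))

theorem two_mul_abs_inner_apply_sub_le (hP : IsCliffordSystem P) (hy : ⟪y, y⟫ ≤ 1)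
    (hx : ⟪P y x, x⟫ = 0) (hx' : ⟪P y x', x'⟫ = 0) :
    2 * |⟪P y x, x' - x⟫| ≤ ⟪x' - x, x' - x⟫ := by
  have hquadratic : ⟪P y (x' - x), x' - x⟫ = -2 * ⟪P y x, x' - x⟫ := by
    simp only [map_sub, inner_sub_left, inner_sub_right, hx, hx']
    rw [hP.symm y x', real_inner_comm]
    ring
  have hle := hP.abs_inner_apply_self_le hy (x' - x)
  rwa [hquadratic, abs_mul, abs_neg, abs_two] at hle

end IsCliffordSystem

theorem inner_self_le_sq_norm_symm_mul (T : F ≃L[ℝ] F) (u : F) :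
    ⟪u, u⟫ ≤ ‖(T.symm : F →L[ℝ] F)‖ ^ 2 * ⟪T u, T u⟫ := by
  have hle := (T.symm : F →L[ℝ] F).le_opNorm (T u)
  simp only [ContinuousLinearEquiv.coe_coe, T.symm_apply_apply] at hle
  rw [real_inner_self_eq_norm_sq, real_inner_self_eq_norm_sq, ← mul_pow]
  exact pow_le_pow_left₀ (norm_nonneg _) hle 2

theorem apply_eq_zero_of_mul_inner_le (hb : 0 < b) (hab : ‖(T.symm : F →L[ℝ] F)‖ ^ 2 * b < a)
    {u : F} (h : a * ⟪T u, T u⟫ ≤ b * ⟪u, u⟫) : T u = 0 := by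
  by_contra hne
  have hpos : 0 < ⟪T u, T u⟫ := real_inner_self_pos.2 hne
  have hle := mul_le_mul_of_nonneg_left (inner_self_le_sq_norm_symm_mul T u) hb.le
  nlinarith

variable [FiniteDimensional ℝ F] [FiniteDimensional ℝ Y]

theorem injOn_parallelPoint_stretched (hP : IsCliffordSystem P) (hT : IsStretching P T e δ)
    (hb : 0 < b) (hab : ‖(T.symm : F →L[ℝ] F)‖ ^ 2 * b < a) :
    Set.InjOn (parallelPoint a b) (unitNormalBundle (T '' focalSet P)) := by
  rw [unitNormalBundle_stretched hP hT]
  rintro _ ⟨⟨x, y⟩, ⟨hx, hy⟩, rfl⟩ _ ⟨⟨x', y'⟩, ⟨hx', hy'⟩, rfl⟩ h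
  simp only [Set.mem_ofPred_eq, normalMap, parallelPoint_apply] at hy hy' h ⊢
  have hy_le : ⟪y, y⟫ ≤ 1 := by linarith [sq_nonneg δ]
  have hy'_le : ⟪y', y'⟫ ≤ 1 := by linarith [sq_nonneg δ]
  have hTzero : T (x' - x) = 0 := by
    refine apply_eq_zero_of_mul_inner_le hb hab ?_
    have hinner := congrArg (fun u => ⟪u, T (x' - x)⟫) h
    simp only [inner_add_left, real_inner_smul_left] at hinner
    rw [hT.inv_symm, hT.inv_symm, T.symm_apply_apply] at hinner
    have hle := hP.two_mul_abs_inner_apply_sub_le hy_le (hx.2 y) (hx'.2 y)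
    have hle' := hP.two_mul_abs_inner_apply_sub_le hy'_le (hx'.2 y') (hx.2 y')
    rw [← neg_sub x' x, inner_neg_right, inner_neg_neg, abs_neg] at hle'
    have hsub : ⟪T (x' - x), T (x' - x)⟫ = ⟪T x', T (x' - x)⟫ - ⟪T x, T (x' - x)⟫ := by
      rw [map_sub, inner_sub_left]
    have hdiff : ⟪P y x, x' - x⟫ - ⟪P y' x', x' - x⟫ ≤ ⟪x' - x, x' - x⟫ := by
      linarith [le_abs_self ⟪P y x, x' - x⟫, neg_abs_le ⟪P y' x', x' - x⟫]
    calc a * ⟪T (x' - x), T (x' - x)⟫ = b * (⟪P y x, x' - x⟫ - ⟪P y' x', x' - x⟫) := by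
          rw [hsub]
          linarith
      _ ≤ b * ⟪x' - x, x' - x⟫ := mul_le_mul_of_nonneg_left hdiff hb.le
  have hTx : T x' = T x := by rwa [map_sub, sub_eq_zero] at hTzero
  rw [hTx] at h ⊢
  rw [smul_right_injective F hb.ne' (add_left_cancel h)]

theorem eq_zero_of_parallelPoint_stretched (hP : IsCliffordSystem P) (hT : IsStretching P T e δ)
    (hb : 0 < b) (hab : ‖(T.symm : F →L[ℝ] F)‖ ^ 2 * b < a) {p v : F × F}
    (hp : p ∈ unitNormalBundle (T '' focalSet P))
    (hv : v ∈ tangentVectors (unitNormalBundle (T '' focalSet P)) p)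
    (h : parallelPoint a b v = 0) : v = 0 := by
  rw [unitNormalBundle_stretched hP hT] at hp hv
  obtain ⟨⟨x, y⟩, hxy, rfl⟩ := hp
  obtain ⟨w, hw, z, _, rfl⟩ := (mem_tangentVectors_normalBundle hP hT.pos hxy).1 hv
  obtain ⟨hx, hy⟩ := hxy
  simp only [Set.mem_ofPred_eq, parallelPoint_apply] at hy h ⊢
  have hTw : T w = 0 := by
    refine apply_eq_zero_of_mul_inner_le hb hab ?_
    have hinner := congrArg (fun u => ⟪u, T w⟫) h
    simp only [inner_add_left, real_inner_smul_left, inner_zero_left] at hinner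
    rw [hT.inv_symm, T.symm_apply_apply, inner_add_left, hw.2, zero_add] at hinner
    have hle : -⟪P y w, w⟫ ≤ ⟪w, w⟫ :=
      (neg_le_abs _).trans (hP.abs_inner_apply_self_le (by linarith [sq_nonneg δ]) w)
    calc a * ⟪T w, T w⟫ = b * -⟪P y w, w⟫ := by linarith
      _ ≤ b * ⟪w, w⟫ := mul_le_mul_of_nonneg_left hle hb.le
  rw [hTw, smul_zero, zero_add] at h
  rw [hTw, (smul_eq_zero.1 h).resolve_left hb.ne', Prod.mk_zero_zero]

theorem hasParallelHypersurface_stretched (hP : IsCliffordSystem P) (hT : IsStretching P T e δ)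
    (hF : Module.finrank ℝ Y < Module.finrank ℝ F) (hunit : ∀ x ∈ focalSet P, ‖T x‖ = 1)
    (h : a ^ 2 + b ^ 2 = 1) (hb : 0 < b) (hab : ‖(T.symm : F →L[ℝ] F)‖ ^ 2 * b < a) :
    HasParallelHypersurface a b (unitNormalBundle (T '' focalSet P)) where
  legendre := isLegendreSubmanifold_unitNormalBundle hP hT hF hunit
  isCompact := isCompact_unitNormalBundle hP hT
  sq_add_sq := h
  injOn := injOn_parallelPoint_stretched hP hT hb hab
  immersive _ hp _ hv := eq_zero_of_parallelPoint_stretched hP hT hb hab hp hv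

theorem eventually_mul_sin_lt_cos (K : ℝ) :
    ∀ᶠ t in 𝓝[>] (0 : ℝ), 0 < Real.sin t ∧ K * Real.sin t < Real.cos t := by
  have hcont : ContinuousAt (fun t => Real.cos t - K * Real.sin t) 0 := by fun_prop
  have hlt : ∀ᶠ t in 𝓝 (0 : ℝ), 0 < Real.cos t - K * Real.sin t :=
    hcont.eventually (lt_mem_nhds (by simp))
  filter_upwards [hlt.filter_mono nhdsWithin_le_nhds, Ioo_mem_nhdsGT Real.pi_pos] with t ht htπ
  exact ⟨Real.sin_pos_of_mem_Ioo htπ, sub_pos.1 ht⟩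

theorem eventually_hasParallelHypersurface_stretched (hP : IsCliffordSystem P)
    (hT : IsStretching P T e δ) (hF : Module.finrank ℝ Y < Module.finrank ℝ F)
    (hunit : ∀ x ∈ focalSet P, ‖T x‖ = 1) :
    ∀ᶠ t in 𝓝[>] (0 : ℝ), HasParallelHypersurface (Real.cos t) (Real.sin t)
      (unitNormalBundle (T '' focalSet P)) := by
  filter_upwards [eventually_mul_sin_lt_cos (‖(T.symm : F →L[ℝ] F)‖ ^ 2)] with t ⟨hsin, hcos⟩
  exact hasParallelHypersurface_stretched hP hT hF hunit (Real.cos_sq_add_sin_sq t) hsin hcos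

namespace HasParallelHypersurface

variable {B : Set (F × F)} {ν : F → F}

theorem isProperDupin_hypersurfaceLift (h : HasParallelHypersurface a b B)
    (hF : 2 ≤ Module.finrank ℝ F) {g : ℕ} {ρ : Fin g → F × F → ℝ × ℝ}
    (hρ : CurvatureSystemOn g B Set.univ ρ) (hν : IsUnitNormalField (parallelPoint a b '' B) ν) :
    IsProperDupin g (hypersurfaceLift (parallelPoint a b '' B) ν) := by
  refine h.legendre.isProperDupin_of_isParallelNear
    (fun p _ => ⟨Set.univ, isOpen_univ, Set.mem_univ p, ρ, hρ⟩) ?_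
  rintro _ ⟨_, ⟨p, hp, rfl⟩, rfl⟩
  obtain ⟨ε, -, hnear⟩ := h.exists_isParallelNear_hypersurfaceLift hF hν hp
  exact ⟨a, b, ε, hnear⟩

theorem containsHarmonic_hypersurfaceLift_iff (h : HasParallelHypersurface a b B)
    (hF : 2 ≤ Module.finrank ℝ F) (hν : IsUnitNormalField (parallelPoint a b '' B) ν)
    {p : F × F} (hp : p ∈ B) :
    ContainsHarmonic {c | IsCurvatureDirection (hypersurfaceLift (parallelPoint a b '' B) ν)
      (parallelPoint a b p, ν (parallelPoint a b p)) c} ↔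
      ContainsHarmonic {c | IsCurvatureDirection B p c} := by
  obtain ⟨ε, hε, hnear⟩ := h.exists_isParallelNear_hypersurfaceLift hF hν hp
  have hmap : parallelMap a (-(ε * b)) ε (parallelPoint a b p, ν (parallelPoint a b p)) = p := by
    rw [hε, ← parallelMap_eq, parallelMap_leftInverse h.sq_add_sq hnear.sq_eq]
  have hiff := hnear.containsHarmonic_iff
  rwa [hmap] at hiff

theorem not_lieEquivalentToIsoparametric_hypersurfaceLift (h : HasParallelHypersurface a b B)
    (hF : 2 ≤ Module.finrank ℝ F) (hν : IsUnitNormalField (parallelPoint a b '' B) ν)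
    (hlift : IsLegendreSubmanifold (hypersurfaceLift (parallelPoint a b '' B) ν))
    {p q : F × F} (hp : p ∈ B) (hq : q ∈ B)
    (hharm : ContainsHarmonic {c | IsCurvatureDirection B p c})
    (hnot : ¬ ContainsHarmonic {c | IsCurvatureDirection B q c}) :
    ¬ LieEquivalentToIsoparametric.{u} (hypersurfaceLift (parallelPoint a b '' B) ν) :=
  not_lieEquivalentToIsoparametric hlift ⟨_, ⟨p, hp, rfl⟩, rfl⟩ ⟨_, ⟨q, hq, rfl⟩, rfl⟩
    ((h.containsHarmonic_hypersurfaceLift_iff hF hν hp).2 hharm)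
    (mt (h.containsHarmonic_hypersurfaceLift_iff hF hν hq).1 hnot)

end HasParallelHypersurface

end Tubes

section OperatorFamilies

variable {F ι : Type*} [NormedAddCommGroup F] [InnerProductSpace ℝ F] [Fintype ι]

/-- The linear family `y ↦ ∑ i, y i • J i` spanned by finitely many operators. -/
def operatorFamily (J : ι → F →L[ℝ] F) : EuclideanSpace ℝ ι →L[ℝ] F →L[ℝ] F :=
  ∑ i, (EuclideanSpace.proj i : EuclideanSpace ℝ ι →L[ℝ] ℝ).smulRight (J i)

theorem operatorFamily_apply (J : ι → F →L[ℝ] F) (y : EuclideanSpace ℝ ι) (u : F) :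
    operatorFamily J y u = ∑ i, y i • J i u := by
  simp [operatorFamily, sum_apply]

theorem operatorFamily_single [DecidableEq ι] (J : ι → F →L[ℝ] F) (i : ι) (u : F) :
    operatorFamily J (EuclideanSpace.single i 1) u = J i u := by
  rw [operatorFamily_apply, Finset.sum_eq_single i] <;> simp +contextual

theorem mem_focalSet_operatorFamily {J : ι → F →L[ℝ] F} {x : F} :
    x ∈ focalSet (operatorFamily J) ↔ ⟪x, x⟫ = 1 ∧ ∀ i, ⟪J i x, x⟫ = 0 := by
  classical
  refine and_congr_right fun _ => ⟨fun h i => ?_, fun h y => ?_⟩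
  · rw [← operatorFamily_single J, h]
  · rw [operatorFamily_apply, sum_inner]
    exact Finset.sum_eq_zero fun i _ => by rw [real_inner_smul_left, h, mul_zero]

theorem isCliffordSystem_operatorFamily {J : ι → F →L[ℝ] F}
    (hsymm : ∀ i u v, ⟪J i u, v⟫ = ⟪u, J i v⟫) (hsq : ∀ i u, J i (J i u) = u)
    (hanti : ∀ i j, i ≠ j → ∀ u, J i (J j u) + J j (J i u) = 0) :
    IsCliffordSystem (operatorFamily J) := by
  refine ⟨fun y u v => ?_, fun y u => smul_right_injective F (two_ne_zero (α := ℝ)) ?_⟩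
  · simp only [operatorFamily_apply, sum_inner, inner_sum, real_inner_smul_left,
      real_inner_smul_right, hsymm]
  have hexpand : operatorFamily J y (operatorFamily J y u) =
      ∑ i, ∑ j, (y i * y j) • J i (J j u) := by
    rw [operatorFamily_apply, operatorFamily_apply]
    simp only [map_sum, map_smul, Finset.smul_sum, smul_smul]
  have hswap : ∑ i, ∑ j, (y i * y j) • J i (J j u) = ∑ i, ∑ j, (y i * y j) • J j (J i u) := by
    rw [Finset.sum_comm]
    exact Finset.sum_congr rfl fun i _ => Finset.sum_congr rfl fun j _ => by rw [mul_comm]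
  have hdiagonal (i : ι) :
      ∑ j, ((y i * y j) • J i (J j u) + (y i * y j) • J j (J i u)) = (2 : ℝ) • y i ^ 2 • u := by
    rw [Finset.sum_eq_single i]
    · rw [hsq, sq, two_smul]
    · intro j _ hj
      rw [← smul_add, hanti i j hj.symm, smul_zero]
    · simp
  calc (2 : ℝ) • operatorFamily J y (operatorFamily J y u)
      = ∑ i, ∑ j, ((y i * y j) • J i (J j u) + (y i * y j) • J j (J i u)) := by
        rw [two_smul]
        simp only [Finset.sum_add_distrib]
        rw [← hswap, hexpand]
    _ = (2 : ℝ) • ‖y‖ ^ 2 • u := by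
        rw [Finset.sum_congr rfl fun i _ => hdiagonal i, EuclideanSpace.real_norm_sq_eq,
          Finset.sum_smul, Finset.smul_sum]

end OperatorFamilies

section DoubleSpace

variable {l : ℕ}

theorem inner_doubleSpace (p q : DoubleSpace l) : ⟪p, q⟫ = ⟪p.fst, q.fst⟫ + ⟪p.snd, q.snd⟫ :=
  WithLp.prod_inner_apply p q

theorem doubleSpace_ext {p q : DoubleSpace l} (hfst : p.fst = q.fst) (hsnd : p.snd = q.snd) :
    p = q :=
  WithLp.ofLp_injective 2 (Prod.ext hfst hsnd)

theorem finrank_doubleSpace : Module.finrank ℝ (DoubleSpace l) = 2 * l := by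
  rw [LinearEquiv.finrank_eq (WithLp.linearEquiv 2 ℝ
    (EuclideanSpace ℝ (Fin l) × EuclideanSpace ℝ (Fin l))), Module.finrank_prod]
  simp [two_mul]

/-- The operator on `DoubleSpace l` given by an operator on the product with the supremum norm. -/
def doubleMap
    (f : EuclideanSpace ℝ (Fin l) × EuclideanSpace ℝ (Fin l) →L[ℝ]
      EuclideanSpace ℝ (Fin l) × EuclideanSpace ℝ (Fin l)) : DoubleSpace l →L[ℝ] DoubleSpace l :=
  ((WithLp.prodContinuousLinearEquiv 2 ℝ (EuclideanSpace ℝ (Fin l))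
      (EuclideanSpace ℝ (Fin l))).symm.toContinuousLinearMap ∘L f) ∘L
    (WithLp.prodContinuousLinearEquiv 2 ℝ (EuclideanSpace ℝ (Fin l))
      (EuclideanSpace ℝ (Fin l))).toContinuousLinearMap

end DoubleSpace

section Representations

variable {n l : ℕ}

/-- The operators `1, E₁, …, Eₙ`; a Clifford orthogonal 2-frame `(u, v)` is a pair such that `v` is
orthogonal to the images of `u` under all of them. -/
def stiefelOperator (E : Fin n → Matrix (Fin l) (Fin l) ℝ) :
    Option (Fin n) → EuclideanSpace ℝ (Fin l) →ₗ[ℝ] EuclideanSpace ℝ (Fin l)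
  | none => LinearMap.id
  | some i => Matrix.toEuclideanLin (E i)

/-- The adjoints `1, -E₁, …, -Eₙ` of the operators `stiefelOperator`. -/
def stiefelAdjoint (E : Fin n → Matrix (Fin l) (Fin l) ℝ) :
    Option (Fin n) → EuclideanSpace ℝ (Fin l) →ₗ[ℝ] EuclideanSpace ℝ (Fin l)
  | none => LinearMap.id
  | some i => -Matrix.toEuclideanLin (E i)

theorem toEuclideanLin_mul_apply (A B : Matrix (Fin l) (Fin l) ℝ) (u : EuclideanSpace ℝ (Fin l)) :
    Matrix.toEuclideanLin A (Matrix.toEuclideanLin B u) = Matrix.toEuclideanLin (A * B) u := by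
  simp [Matrix.toLpLin_apply, Matrix.mulVec_mulVec]

variable {E : Fin n → Matrix (Fin l) (Fin l) ℝ}

namespace IsCliffordRepresentation

theorem apply_apply_self (hE : IsCliffordRepresentation E) (i : Fin n)
    (u : EuclideanSpace ℝ (Fin l)) :
    Matrix.toEuclideanLin (E i) (Matrix.toEuclideanLin (E i) u) = -u := by
  rw [toEuclideanLin_mul_apply, hE.sq]
  simp

theorem apply_apply (hE : IsCliffordRepresentation E) {i j : Fin n} (hij : i ≠ j)
    (u : EuclideanSpace ℝ (Fin l)) :
    Matrix.toEuclideanLin (E i) (Matrix.toEuclideanLin (E j) u) =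
      -Matrix.toEuclideanLin (E j) (Matrix.toEuclideanLin (E i) u) := by
  rw [toEuclideanLin_mul_apply, toEuclideanLin_mul_apply, hE.anticomm i j hij, map_neg]
  rfl

theorem inner_stiefelAdjoint (hE : IsCliffordRepresentation E) (i : Option (Fin n))
    (u v : EuclideanSpace ℝ (Fin l)) :
    ⟪stiefelAdjoint E i u, v⟫ = ⟪u, stiefelOperator E i v⟫ := by
  cases i with
  | none => rfl
  | some i =>
    simp only [stiefelAdjoint, stiefelOperator]
    rw [← LinearMap.adjoint_inner_left, ← Matrix.toEuclideanLin_conjTranspose_eq_adjoint,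
      Matrix.conjTranspose_eq_transpose_of_trivial, hE.skew, map_neg]

theorem stiefelAdjoint_stiefelOperator (hE : IsCliffordRepresentation E) (i : Option (Fin n))
    (u : EuclideanSpace ℝ (Fin l)) : stiefelAdjoint E i (stiefelOperator E i u) = u := by
  cases i with
  | none => rfl
  | some i => simp [stiefelAdjoint, stiefelOperator, hE.apply_apply_self]

theorem stiefelOperator_stiefelAdjoint (hE : IsCliffordRepresentation E) (i : Option (Fin n))
    (u : EuclideanSpace ℝ (Fin l)) : stiefelOperator E i (stiefelAdjoint E i u) = u := by
  cases i with
  | none => rfl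
  | some i => simp [stiefelAdjoint, stiefelOperator, hE.apply_apply_self]

theorem stiefelAdjoint_stiefelOperator_add (hE : IsCliffordRepresentation E)
    {i j : Option (Fin n)} (hij : i ≠ j) (u : EuclideanSpace ℝ (Fin l)) :
    stiefelAdjoint E i (stiefelOperator E j u) + stiefelAdjoint E j (stiefelOperator E i u) =
      0 := by
  rcases i with _ | i <;> rcases j with _ | j
  · exact absurd rfl hij
  · simp [stiefelAdjoint, stiefelOperator]
  · simp [stiefelAdjoint, stiefelOperator]
  · simp [stiefelAdjoint, stiefelOperator, hE.apply_apply (fun h => hij (congrArg some h))]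

theorem stiefelOperator_stiefelAdjoint_add (hE : IsCliffordRepresentation E)
    {i j : Option (Fin n)} (hij : i ≠ j) (u : EuclideanSpace ℝ (Fin l)) :
    stiefelOperator E i (stiefelAdjoint E j u) + stiefelOperator E j (stiefelAdjoint E i u) =
      0 := by
  rcases i with _ | i <;> rcases j with _ | j
  · exact absurd rfl hij
  · simp [stiefelAdjoint, stiefelOperator]
  · simp [stiefelAdjoint, stiefelOperator]
  · simp [stiefelAdjoint, stiefelOperator, hE.apply_apply (fun h => hij (congrArg some h))]

end IsCliffordRepresentation

/-- The operators `(u, v) ↦ (u, -v)` and `(u, v) ↦ (Aᵀ v, A u)`, for `A = 1` and `A = E i`, which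
anticommute and whose squares are `1`. -/
def cliffordOperator (E : Fin n → Matrix (Fin l) (Fin l) ℝ) :
    Option (Option (Fin n)) → DoubleSpace l →L[ℝ] DoubleSpace l
  | none => doubleMap ((ContinuousLinearMap.fst ℝ _ _).prod (-ContinuousLinearMap.snd ℝ _ _))
  | some i => doubleMap
      (((stiefelAdjoint E i).toContinuousLinearMap ∘L ContinuousLinearMap.snd ℝ _ _).prod
        ((stiefelOperator E i).toContinuousLinearMap ∘L ContinuousLinearMap.fst ℝ _ _))

theorem cliffordOperator_none (p : DoubleSpace l) :
    cliffordOperator E none p = WithLp.toLp 2 (p.fst, -p.snd) := rfl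

theorem cliffordOperator_some (i : Option (Fin n)) (p : DoubleSpace l) :
    cliffordOperator E (some i) p =
      WithLp.toLp 2 (stiefelAdjoint E i p.snd, stiefelOperator E i p.fst) := rfl

/-- The Clifford system of a representation, whose focal set is the Clifford–Stiefel manifold. -/
def cliffordSystem (E : Fin n → Matrix (Fin l) (Fin l) ℝ) :
    EuclideanSpace ℝ (Option (Option (Fin n))) →L[ℝ] DoubleSpace l →L[ℝ] DoubleSpace l :=
  operatorFamily (cliffordOperator E)

/-- The unit vector that the Clifford system represents by the reflection `(u, v) ↦ (u, -v)`. -/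
def reflectionVector (n : ℕ) : EuclideanSpace ℝ (Option (Option (Fin n))) :=
  EuclideanSpace.single none 1

theorem cliffordSystem_reflectionVector (p : DoubleSpace l) :
    cliffordSystem E (reflectionVector n) p = WithLp.toLp 2 (p.fst, -p.snd) :=
  operatorFamily_single (cliffordOperator E) none p

theorem isCliffordSystem_cliffordSystem (hE : IsCliffordRepresentation E) :
    IsCliffordSystem (cliffordSystem E) := by
  refine isCliffordSystem_operatorFamily ?symm ?sq ?anticomm
  case symm =>
    rintro (_ | i) u v
    · rw [cliffordOperator_none, cliffordOperator_none, inner_doubleSpace, inner_doubleSpace]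
      simp only [WithLp.toLp_fst, WithLp.toLp_snd, inner_neg_left, inner_neg_right]
    · have hadjoint : ⟪u.fst, stiefelAdjoint E i v.snd⟫ = ⟪stiefelOperator E i u.fst, v.snd⟫ := by
        rw [real_inner_comm, hE.inner_stiefelAdjoint, real_inner_comm]
      simp only [cliffordOperator_some, inner_doubleSpace, WithLp.toLp_fst, WithLp.toLp_snd,
        hE.inner_stiefelAdjoint, hadjoint]
      exact add_comm _ _
  case sq =>
    rintro (_ | i) u
    · exact doubleSpace_ext rfl (neg_neg _)
    · exact doubleSpace_ext (hE.stiefelAdjoint_stiefelOperator i _)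
        (hE.stiefelOperator_stiefelAdjoint i _)
  case anticomm =>
    rintro (_ | i) (_ | j) hij u
    · exact absurd rfl hij
    · refine doubleSpace_ext ?_ ?_ <;> simp [cliffordOperator_none, cliffordOperator_some]
    · refine doubleSpace_ext ?_ ?_ <;> simp [cliffordOperator_none, cliffordOperator_some]
    · have hij' : i ≠ j := fun h => hij (congrArg some h)
      exact doubleSpace_ext (hE.stiefelAdjoint_stiefelOperator_add hij' _)
        (hE.stiefelOperator_stiefelAdjoint_add hij' _)

end Representations

section StiefelManifolds

variable {n l : ℕ} {E : Fin n → Matrix (Fin l) (Fin l) ℝ}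

theorem norm_eq_one_div_sqrt_two_iff {X : Type*} [NormedAddCommGroup X] [InnerProductSpace ℝ X]
    (u : X) : ‖u‖ = 1 / √2 ↔ ⟪u, u⟫ = 1 / 2 := by
  rw [real_inner_self_eq_norm_sq, ← sq_eq_sq₀ (norm_nonneg _) (by positivity), div_pow,
    Real.sq_sqrt (by norm_num), one_pow]

theorem mem_cliffordStiefel_iff {p : DoubleSpace l} :
    p ∈ cliffordStiefel E ↔ ⟪p.fst, p.fst⟫ = 1 / 2 ∧ ⟪p.snd, p.snd⟫ = 1 / 2 ∧
      ∀ i, ⟪stiefelOperator E i p.fst, p.snd⟫ = 0 := by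
  have hnorm : ‖p‖ = 1 ↔ ⟪p.fst, p.fst⟫ + ⟪p.snd, p.snd⟫ = 1 := by
    rw [← inner_doubleSpace, real_inner_self_eq_norm_sq,
      pow_eq_one_iff_of_nonneg (norm_nonneg _) two_ne_zero]
  rw [cliffordStiefel, Set.mem_ofPred_eq, norm_eq_one_div_sqrt_two_iff,
    norm_eq_one_div_sqrt_two_iff, hnorm, Option.forall]
  refine ⟨And.right, fun h => ⟨?_, h⟩⟩
  rw [h.1, h.2.1]
  norm_num

theorem cliffordStiefel_eq_focalSet (hE : IsCliffordRepresentation E) :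
    cliffordStiefel E = focalSet (cliffordSystem E) := by
  ext p
  have hsome (i) : ⟪cliffordOperator E (some i) p, p⟫ =
      2 * ⟪stiefelOperator E i p.fst, p.snd⟫ := by
    simp only [cliffordOperator_some, inner_doubleSpace, WithLp.toLp_fst, WithLp.toLp_snd]
    rw [hE.inner_stiefelAdjoint, real_inner_comm, two_mul]
  have hnone : ⟪cliffordOperator E none p, p⟫ = ⟪p.fst, p.fst⟫ - ⟪p.snd, p.snd⟫ := by
    simp only [cliffordOperator_none, inner_doubleSpace, WithLp.toLp_fst, WithLp.toLp_snd,
      inner_neg_left, sub_eq_add_neg]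
  rw [cliffordSystem, mem_focalSet_operatorFamily, Option.forall, hnone, inner_doubleSpace p p,
    mem_cliffordStiefel_iff]
  simp only [hsome, mul_eq_zero, OfNat.ofNat_ne_zero, false_or]
  constructor
  · rintro ⟨hfst, hsnd, horth⟩
    exact ⟨by linarith, by linarith, horth⟩
  · rintro ⟨hsum, hdiff, horth⟩
    exact ⟨by linarith, by linarith, horth⟩

theorem exists_ne_zero_inner_stiefelOperator_eq_zero (hl : n + 1 < l)
    (u : EuclideanSpace ℝ (Fin l)) : ∃ v ≠ 0, ∀ i, ⟪stiefelOperator E i u, v⟫ = 0 := by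
  set S := Submodule.span ℝ (Set.range fun i => stiefelOperator E i u)
  have hS : Module.finrank ℝ S ≤ n + 1 :=
    (finrank_range_le_card (R := ℝ) fun i => stiefelOperator E i u).trans (by simp)
  have hSperp : Sᗮ ≠ ⊥ := by
    intro hbot
    have hfinrank := S.finrank_add_finrank_orthogonal
    rw [hbot, finrank_bot, finrank_euclideanSpace_fin] at hfinrank
    omega
  obtain ⟨v, hvS, hv⟩ := Submodule.exists_mem_ne_zero_of_ne_bot hSperp
  exact ⟨v, hv, fun i => hvS _ (Submodule.subset_span ⟨i, rfl⟩)⟩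

theorem exists_inner_self_smul_eq {X : Type*} [NormedAddCommGroup X] [InnerProductSpace ℝ X]
    {v : X} (hv : v ≠ 0) {r : ℝ} (hr : 0 ≤ r) : ∃ c : ℝ, ⟪c • v, c • v⟫ = r := by
  refine ⟨√r / ‖v‖, ?_⟩
  rw [real_inner_self_eq_norm_sq, norm_smul, Real.norm_of_nonneg (by positivity),
    div_mul_cancel₀ _ (norm_ne_zero_iff.2 hv), Real.sq_sqrt hr]

theorem nonempty_cliffordStiefel (hl : n + 1 < l) : (cliffordStiefel E).Nonempty := by
  have : Nonempty (Fin l) := ⟨⟨0, by omega⟩⟩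
  obtain ⟨u, hu⟩ := exists_ne (0 : EuclideanSpace ℝ (Fin l))
  obtain ⟨a, ha⟩ := exists_inner_self_smul_eq hu (r := 1 / 2) (by norm_num)
  obtain ⟨v, hv, horth⟩ := exists_ne_zero_inner_stiefelOperator_eq_zero (E := E) hl (a • u)
  obtain ⟨b, hb⟩ := exists_inner_self_smul_eq hv (r := 1 / 2) (by norm_num)
  refine ⟨WithLp.toLp 2 (a • u, b • v), mem_cliffordStiefel_iff.2 ⟨ha, hb, fun i => ?_⟩⟩
  rw [WithLp.toLp_fst, WithLp.toLp_snd, real_inner_smul_right, horth, mul_zero]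

end StiefelManifolds

section Stretch

variable {n l : ℕ} {E : Fin n → Matrix (Fin l) (Fin l) ℝ} {α β : ℝ}

theorem stretch_fst (p : DoubleSpace l) : (stretch α β p).fst = (√2 * α) • p.fst := by
  simp [stretch, smul_smul]

theorem stretch_snd (p : DoubleSpace l) : (stretch α β p).snd = (√2 * β) • p.snd := by
  simp [stretch, smul_smul]

theorem sqrt_two_mul_mul_sqrt_two_mul (a b : ℝ) : √2 * a * (√2 * b) = 2 * a * b := by
  rw [mul_mul_mul_comm, Real.mul_self_sqrt zero_le_two, mul_assoc]

theorem stretch_stretch (α' β' : ℝ) (p : DoubleSpace l) : stretch α β (stretch α' β' p) =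
    WithLp.toLp 2 ((2 * α * α') • p.fst, (2 * β * β') • p.snd) :=
  doubleSpace_ext
    (by rw [stretch_fst, stretch_fst, smul_smul, sqrt_two_mul_mul_sqrt_two_mul]; rfl)
    (by rw [stretch_snd, stretch_snd, smul_smul, sqrt_two_mul_mul_sqrt_two_mul]; rfl)

theorem stretch_stretch_eq_self {α' β' : ℝ} (hα : 2 * α * α' = 1) (hβ : 2 * β * β' = 1)
    (p : DoubleSpace l) : stretch α β (stretch α' β' p) = p := by
  rw [stretch_stretch, hα, hβ, one_smul, one_smul]
  rfl

/-- `stretch α β` as a continuous linear map. -/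
def stretchMap (l : ℕ) (α β : ℝ) : DoubleSpace l →L[ℝ] DoubleSpace l :=
  doubleMap (((√2 * α) • ContinuousLinearMap.fst ℝ _ _).prod
    ((√2 * β) • ContinuousLinearMap.snd ℝ _ _))

theorem stretchMap_apply (p : DoubleSpace l) : stretchMap l α β p = stretch α β p :=
  doubleSpace_ext (stretch_fst p).symm (stretch_snd p).symm

/-- `stretch α β` as a linear automorphism. -/
def stretchEquiv (l : ℕ) (hα : α ≠ 0) (hβ : β ≠ 0) : DoubleSpace l ≃L[ℝ] DoubleSpace l :=
  ContinuousLinearEquiv.equivOfInverse (stretchMap l α β)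
    (stretchMap l (1 / (2 * α)) (1 / (2 * β)))
    (fun p => by
      rw [stretchMap_apply, stretchMap_apply,
        stretch_stretch_eq_self (by field_simp) (by field_simp)])
    (fun p => by
      rw [stretchMap_apply, stretchMap_apply,
        stretch_stretch_eq_self (by field_simp) (by field_simp)])

theorem stretchEquiv_apply (hα : α ≠ 0) (hβ : β ≠ 0) (p : DoubleSpace l) :
    stretchEquiv l hα hβ p = stretch α β p := stretchMap_apply p

theorem stretchEquiv_symm_apply (hα : α ≠ 0) (hβ : β ≠ 0) (p : DoubleSpace l) :
    (stretchEquiv l hα hβ).symm p = stretch (1 / (2 * α)) (1 / (2 * β)) p := stretchMap_apply p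

theorem stretchEquiv_image_focalSet (hE : IsCliffordRepresentation E) (hα : α ≠ 0) (hβ : β ≠ 0) :
    stretchEquiv l hα hβ '' focalSet (cliffordSystem E) = stretchedStiefel E α β := by
  rw [stretchedStiefel, cliffordStiefel_eq_focalSet hE]
  exact Set.image_congr fun x _ => stretchEquiv_apply hα hβ x

theorem isStretching_stretchEquiv (hα : α ≠ 0) (hβ : β ≠ 0) (hαβ : α ^ 2 + β ^ 2 = 1) :
    IsStretching (cliffordSystem E) (stretchEquiv l hα hβ) (reflectionVector n)
      (α ^ 2 - β ^ 2) where
  symm u v := by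
    simp only [stretchEquiv_apply, inner_doubleSpace, stretch_fst, stretch_snd,
      real_inner_smul_left, real_inner_smul_right]
  sq u := by
    have hα2 : 2 * α * α = 1 + (α ^ 2 - β ^ 2) := by linear_combination hαβ
    have hβ2 : 2 * β * β = 1 - (α ^ 2 - β ^ 2) := by linear_combination hαβ
    rw [cliffordSystem_reflectionVector, stretchEquiv_apply, stretchEquiv_apply, stretch_stretch,
      hα2, hβ2]
    refine doubleSpace_ext ?_ ?_
    · simp only [WithLp.add_fst, WithLp.smul_fst, WithLp.toLp_fst, add_smul, one_smul]
    · change (1 - (α ^ 2 - β ^ 2)) • u.snd = u.snd + (α ^ 2 - β ^ 2) • -u.snd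
      rw [sub_smul, one_smul, smul_neg, sub_eq_add_neg]
  inner_self := by simp [reflectionVector]
  sq_lt_one := by
    have hpos : 0 < (α * β) ^ 2 := by positivity
    nlinarith

theorem norm_stretch (hαβ : α ^ 2 + β ^ 2 = 1) {x : DoubleSpace l} (hx : x ∈ cliffordStiefel E) :
    ‖stretch α β x‖ = 1 := by
  obtain ⟨hfst, hsnd, -⟩ := mem_cliffordStiefel_iff.1 hx
  rw [← pow_eq_one_iff_of_nonneg (norm_nonneg _) two_ne_zero, ← real_inner_self_eq_norm_sq,
    inner_doubleSpace, stretch_fst, stretch_snd, real_inner_smul_left, real_inner_smul_right,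
    real_inner_smul_left, real_inner_smul_right, hfst, hsnd]
  linear_combination (α ^ 2 + β ^ 2) / 2 * Real.mul_self_sqrt zero_le_two + hαβ

theorem normalMap_reflectionVector (hα : α ≠ 0) (hβ : β ≠ 0) (c : ℝ) (x : DoubleSpace l) :
    normalMap (cliffordSystem E) (stretchEquiv l hα hβ)
      (x, -(c * (2 * α * β)) • reflectionVector n) =
      (stretch α β x, c • specialNormal α β (stretch α β x)) := by
  refine Prod.ext (stretchEquiv_apply hα hβ x) ?_
  simp only [normalMap, map_smul, smul_apply, cliffordSystem_reflectionVector,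
    stretchEquiv_symm_apply]
  refine doubleSpace_ext ?_ ?_
  · simp only [WithLp.smul_fst, stretch_fst, specialNormal, WithLp.toLp_fst, smul_smul]
    congr 1
    field_simp
  · simp only [WithLp.smul_snd, stretch_snd, specialNormal, WithLp.toLp_snd, smul_smul, smul_neg,
      ← neg_smul]
    congr 1
    field_simp

theorem one_sub_sq_sub_sq_sq (hαβ : α ^ 2 + β ^ 2 = 1) :
    1 - (α ^ 2 - β ^ 2) ^ 2 = (2 * α * β) ^ 2 := by
  linear_combination (-(α ^ 2 + β ^ 2) - 1) * hαβ

theorem mem_focalProduct_reflectionVector (hα : α ≠ 0) (hβ : β ≠ 0) (hαβ : α ^ 2 + β ^ 2 = 1)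
    {c : ℝ} (hc : c ^ 2 = 1) {x : DoubleSpace l} (hx : x ∈ focalSet (cliffordSystem E)) :
    (x, -(c * (2 * α * β)) • reflectionVector n) ∈
      focalProduct (cliffordSystem E) (1 - (α ^ 2 - β ^ 2) ^ 2) := by
  have hT := isStretching_stretchEquiv (E := E) (l := l) hα hβ hαβ
  refine ⟨hx, ?_⟩
  rw [Set.mem_ofPred_eq, real_inner_smul_left, real_inner_smul_right, hT.inner_self,
    one_sub_sq_sub_sq_sq hαβ]
  linear_combination (2 * α * β) ^ 2 * hc

theorem smul_specialNormal_mem_unitNormalBundle (hE : IsCliffordRepresentation E) (hα : α ≠ 0)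
    (hβ : β ≠ 0) (hαβ : α ^ 2 + β ^ 2 = 1) {c : ℝ} (hc : c ^ 2 = 1) {p : DoubleSpace l}
    (hp : p ∈ stretchedStiefel E α β) :
    (p, c • specialNormal α β p) ∈ unitNormalBundle (stretchedStiefel E α β) := by
  obtain ⟨x, hx, rfl⟩ := hp
  rw [cliffordStiefel_eq_focalSet hE] at hx
  rw [← normalMap_reflectionVector hα hβ, ← stretchEquiv_image_focalSet hE hα hβ]
  exact normalMap_mem_unitNormalBundle (isCliffordSystem_cliffordSystem hE)
    (isStretching_stretchEquiv hα hβ hαβ) (mem_focalProduct_reflectionVector hα hβ hαβ hc hx)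

theorem halfSum_smul_specialNormal (hE : IsCliffordRepresentation E) (hα : α ≠ 0) (hβ : β ≠ 0)
    (hαβ : α ^ 2 + β ^ 2 = 1) (c : ℝ) {p : DoubleSpace l} (hp : p ∈ stretchedStiefel E α β) :
    halfSum (cliffordSystem E) (stretchEquiv l hα hβ) (reflectionVector n) (α ^ 2 - β ^ 2)
      (p, c • specialNormal α β p) = c * ((β / α - α / β) / 2) := by
  have hT := isStretching_stretchEquiv (E := E) (l := l) hα hβ hαβ
  obtain ⟨x, hx, rfl⟩ := hp
  rw [cliffordStiefel_eq_focalSet hE] at hx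
  rw [← normalMap_reflectionVector (E := E) hα hβ,
    halfSum_normalMap (isCliffordSystem_cliffordSystem hE) hx, real_inner_smul_right,
    hT.inner_self, one_sub_sq_sub_sq_sq hαβ]
  field_simp
  ring

end Stretch

section LieCurvature

theorem insert_four_injective {A : Type*} [LinearOrder A] {a b c d a' b' c' d' : A} (hab : a < b)
    (hbc : b < c) (hcd : c < d) (hab' : a' < b') (hbc' : b' < c') (hcd' : c' < d')
    (h : ({a, b, c, d} : Set A) = {a', b', c', d'}) : a = a' ∧ b = b' ∧ c = c' ∧ d = d' := by
  have hmono : StrictMono ![a, b, c, d] := by simp [hab, hbc, hcd]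
  have hmono' : StrictMono ![a', b', c', d'] := by simp [hab', hbc', hcd']
  have hrange : Set.range ![a, b, c, d] = Set.range ![a', b', c', d'] := by
    simpa only [Matrix.range_cons, Matrix.range_empty, Set.singleton_union, Set.union_empty] using h
  simpa using (hmono.range_inj hmono').1 hrange

variable {F : Type*} [NormedAddCommGroup F] [InnerProductSpace ℝ F] {B : Set (F × F)} {p : F × F}

theorem hasLieCurvature_iff_of_lt {κ₁ κ₂ κ₃ κ₄ : WithTop ℝ} (h₁₂ : κ₁ < κ₂) (h₂₃ : κ₂ < κ₃)
    (h₃₄ : κ₃ < κ₄) (h : principalCurvatures B p = {κ₁, κ₂, κ₃, κ₄}) {ψ : ℝ} :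
    HasLieCurvature B p ψ ↔ crossRatio κ₁ κ₂ κ₃ κ₄ = ψ := by
  refine ⟨?_, fun hψ => ⟨κ₁, κ₂, κ₃, κ₄, h₁₂, h₂₃, h₃₄, h, hψ⟩⟩
  rintro ⟨μ₁, μ₂, μ₃, μ₄, hμ₁₂, hμ₂₃, hμ₃₄, hμ, hψ⟩
  obtain ⟨rfl, rfl, rfl, rfl⟩ :=
    insert_four_injective hμ₁₂ hμ₂₃ hμ₃₄ h₁₂ h₂₃ h₃₄ (hμ.symm.trans h)
  exact hψ

theorem crossRatio_coe_coe_coe_top (a b c : ℝ) :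
    crossRatio (a : WithTop ℝ) (b : WithTop ℝ) (c : WithTop ℝ) ⊤ = (a - b) / (a - c) := by
  simp [crossRatio, homDiff]

theorem hasLieCurvature_iff_of_neg_inv {a ψ : ℝ} (ha : 0 < a) (h : principalCurvatures B p =
      {((-a⁻¹ : ℝ) : WithTop ℝ), ((0 : ℝ) : WithTop ℝ), (a : WithTop ℝ), ⊤}) :
    HasLieCurvature B p ψ ↔ ψ = 1 / (1 + a ^ 2) := by
  have hneg : -a⁻¹ < 0 := neg_lt_zero.2 (inv_pos.2 ha)
  have hratio : (-a⁻¹ - 0) / (-a⁻¹ - a) = 1 / (1 + a ^ 2) := by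
    rw [div_eq_div_iff (by linarith) (by positivity)]
    field_simp
    ring
  rw [hasLieCurvature_iff_of_lt (WithTop.coe_lt_coe.2 hneg) (WithTop.coe_lt_coe.2 ha)
    (WithTop.coe_lt_top a) h, crossRatio_coe_coe_coe_top, hratio, eq_comm]

end LieCurvature

section StretchedFocalSets

variable {F Y : Type*} [NormedAddCommGroup F] [InnerProductSpace ℝ F] [FiniteDimensional ℝ F]
  [NormedAddCommGroup Y] [InnerProductSpace ℝ Y] [FiniteDimensional ℝ Y]
  {P : Y →L[ℝ] F →L[ℝ] F} {T : F ≃L[ℝ] F} {e : Y} {δ : ℝ} {q : F × F}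

theorem isSubmanifold_stretched (hP : IsCliffordSystem P) {k : ℕ}
    (hk : k + (1 + Module.finrank ℝ Y) = Module.finrank ℝ F) (T : F ≃L[ℝ] F) :
    IsSubmanifold k (T '' focalSet P) := by
  refine (isSubmanifold_focalSet hP hk).image T.contDiff
    (isEmbedding_of_isCompact isCompact_focalSet T.continuous.continuousOn T.injective.injOn)
    fun p _ w _ h => ?_
  rw [T.fderiv] at h
  exact T.map_eq_zero_iff.1 h

theorem isProperDupin_stretched (hP : IsCliffordSystem P) (hT : IsStretching P T e δ)
    (hY : 2 ≤ Module.finrank ℝ Y) (hF : 2 * Module.finrank ℝ Y < Module.finrank ℝ F)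
    (hunit : ∀ x ∈ focalSet P, ‖T x‖ = 1) :
    IsProperDupin 4 (unitNormalBundle (T '' focalSet P)) :=
  (isLegendreSubmanifold_unitNormalBundle hP hT (by omega) hunit).isProperDupin fun q _ =>
    ⟨Set.univ, isOpen_univ, Set.mem_univ q, _, curvatureSystemOn_stretched hP hT hY hF⟩

theorem principalCurvatures_stretched_of_halfSum_eq (hP : IsCliffordSystem P)
    (hT : IsStretching P T e δ) (hY : 2 ≤ Module.finrank ℝ Y)
    (hF : 2 * Module.finrank ℝ Y < Module.finrank ℝ F)
    (hq : q ∈ unitNormalBundle (T '' focalSet P)) {a : ℝ} (ha : 0 < a)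
    (h : halfSum P T e δ q = (a - a⁻¹) / 2) :
    principalCurvatures (unitNormalBundle (T '' focalSet P)) q =
      {((-a⁻¹ : ℝ) : WithTop ℝ), ((0 : ℝ) : WithTop ℝ), (a : WithTop ℝ), ⊤} := by
  rw [principalCurvatures_stretched hP hT hY hF hq, h,
    rootNeg_eq_of_neg (κ := -a⁻¹) (neg_lt_zero.2 (inv_pos.2 ha)) (by field_simp; ring),
    rootPos_eq_of_pos (κ := a) ha (by field_simp; ring)]

theorem exists_halfSum_eq_zero (hP : IsCliffordSystem P) (hT : IsStretching P T e δ)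
    (hY : 2 ≤ Module.finrank ℝ Y) (hne : (focalSet P).Nonempty) :
    ∃ p ∈ unitNormalBundle (T '' focalSet P), halfSum P T e δ p = 0 := by
  obtain ⟨x, hx⟩ := hne
  obtain ⟨z, hz, hez⟩ := exists_ne_zero_inner_eq_zero hY e
  obtain ⟨c, hc⟩ := exists_inner_self_smul_eq hz hT.pos.le
  refine ⟨_, normalMap_mem_unitNormalBundle hP hT (p := (x, c • z)) ⟨hx, hc⟩, ?_⟩
  rw [halfSum_normalMap hP hx, real_inner_smul_right, hez, mul_zero, mul_zero]

theorem not_lieEquivalentToIsoparametric_stretched (hP : IsCliffordSystem P)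
    (hT : IsStretching P T e δ) (hY : 2 ≤ Module.finrank ℝ Y)
    (hF : 2 * Module.finrank ℝ Y < Module.finrank ℝ F) (hunit : ∀ x ∈ focalSet P, ‖T x‖ = 1)
    {p : F × F} (hp : p ∈ unitNormalBundle (T '' focalSet P)) (hp0 : halfSum P T e δ p = 0)
    (hq : q ∈ unitNormalBundle (T '' focalSet P)) (hq0 : halfSum P T e δ q ≠ 0) :
    ¬ LieEquivalentToIsoparametric.{u} (unitNormalBundle (T '' focalSet P)) :=
  not_lieEquivalentToIsoparametric
    (isLegendreSubmanifold_unitNormalBundle hP hT (by omega) hunit) hp hq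
    ((containsHarmonic_stretched_iff hP hT hY hF hp).2 hp0)
    (mt (containsHarmonic_stretched_iff hP hT hY hF hq).1 hq0)

theorem eventually_tube_stretched (hP : IsCliffordSystem P) (hT : IsStretching P T e δ)
    (hY : 2 ≤ Module.finrank ℝ Y) (hF : 2 * Module.finrank ℝ Y < Module.finrank ℝ F)
    (hunit : ∀ x ∈ focalSet P, ‖T x‖ = 1) {p : F × F}
    (hp : p ∈ unitNormalBundle (T '' focalSet P)) (hp0 : halfSum P T e δ p = 0)
    (hq : q ∈ unitNormalBundle (T '' focalSet P)) (hq0 : halfSum P T e δ q ≠ 0) :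
    ∀ᶠ t in 𝓝[>] (0 : ℝ),
      (tube (T '' focalSet P) t ⊆ Metric.sphere 0 1 ∧ IsCompact (tube (T '' focalSet P) t) ∧
        IsSubmanifold (Module.finrank ℝ F - 2) (tube (T '' focalSet P) t)) ∧
      (∃ ν, IsUnitNormalField (tube (T '' focalSet P) t) ν) ∧
      ∀ ν, IsUnitNormalField (tube (T '' focalSet P) t) ν →
        IsProperDupin 4 (hypersurfaceLift (tube (T '' focalSet P) t) ν) ∧
        ¬ LieEquivalentToIsoparametric.{u} (hypersurfaceLift (tube (T '' focalSet P) t) ν) := by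
  filter_upwards [eventually_hasParallelHypersurface_stretched hP hT (by omega) hunit] with t ht
  rw [tube_eq_image_parallelPoint]
  obtain ⟨ν₀, hν₀, -⟩ := ht.exists_isUnitNormalField
  refine ⟨⟨ht.image_subset_sphere, ht.isCompact.image (ContinuousLinearMap.continuous _),
    ht.isSubmanifold⟩, ⟨ν₀, hν₀⟩, fun ν hν => ?_⟩
  have hdupin := ht.isProperDupin_hypersurfaceLift (by omega)
    (curvatureSystemOn_stretched hP hT hY hF) hν
  exact ⟨hdupin, ht.not_lieEquivalentToIsoparametric_hypersurfaceLift (by omega) hν hdupin.legendre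
    hp hq ((containsHarmonic_stretched_iff hP hT hY hF hp).2 hp0)
    (mt (containsHarmonic_stretched_iff hP hT hY hF hq).1 hq0)⟩

end StretchedFocalSets

section StretchedStiefel

variable {n l : ℕ} {E : Fin n → Matrix (Fin l) (Fin l) ℝ} {α β : ℝ}

theorem finrank_reflectionSpace (n : ℕ) :
    Module.finrank ℝ (EuclideanSpace ℝ (Option (Option (Fin n)))) = n + 2 := by
  simp

theorem two_mul_finrank_reflectionSpace_lt (hl : n + 2 < l) :
    2 * Module.finrank ℝ (EuclideanSpace ℝ (Option (Option (Fin n)))) <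
      Module.finrank ℝ (DoubleSpace l) := by
  rw [finrank_reflectionSpace, finrank_doubleSpace]
  omega

theorem norm_stretchEquiv (hE : IsCliffordRepresentation E) (hα : α ≠ 0) (hβ : β ≠ 0)
    (hαβ : α ^ 2 + β ^ 2 = 1) {x : DoubleSpace l} (hx : x ∈ focalSet (cliffordSystem E)) :
    ‖stretchEquiv l hα hβ x‖ = 1 := by
  rw [stretchEquiv_apply]
  exact norm_stretch hαβ (by rwa [cliffordStiefel_eq_focalSet hE])

theorem stretchedStiefel_subset_sphere (hαβ : α ^ 2 + β ^ 2 = 1) :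
    stretchedStiefel E α β ⊆ Metric.sphere 0 1 := by
  rintro _ ⟨x, hx, rfl⟩
  exact mem_sphere_zero_iff_norm.2 (norm_stretch hαβ hx)

theorem nonempty_stretchedStiefel (hl : n + 1 < l) : (stretchedStiefel E α β).Nonempty :=
  (nonempty_cliffordStiefel hl).image _

theorem isCompact_stretchedStiefel (hE : IsCliffordRepresentation E) (hα : α ≠ 0) (hβ : β ≠ 0) :
    IsCompact (stretchedStiefel E α β) := by
  rw [← stretchEquiv_image_focalSet hE hα hβ]
  exact isCompact_focalSet.image (stretchEquiv l hα hβ).continuous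

theorem isSubmanifold_stretchedStiefel (hE : IsCliffordRepresentation E) (hl : n + 2 < l)
    (hα : α ≠ 0) (hβ : β ≠ 0) :
    IsSubmanifold (2 * l - 1 - (n + 2)) (stretchedStiefel E α β) := by
  rw [← stretchEquiv_image_focalSet hE hα hβ]
  refine isSubmanifold_stretched (isCliffordSystem_cliffordSystem hE) ?_ _
  rw [finrank_reflectionSpace, finrank_doubleSpace]
  omega

theorem isProperDupin_stretchedStiefel (hE : IsCliffordRepresentation E) (hl : n + 2 < l)
    (hα : α ≠ 0) (hβ : β ≠ 0) (hαβ : α ^ 2 + β ^ 2 = 1) :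
    IsProperDupin 4 (unitNormalBundle (stretchedStiefel E α β)) := by
  rw [← stretchEquiv_image_focalSet hE hα hβ]
  exact isProperDupin_stretched (isCliffordSystem_cliffordSystem hE)
    (isStretching_stretchEquiv hα hβ hαβ) (by simp) (two_mul_finrank_reflectionSpace_lt hl)
    fun x hx => norm_stretchEquiv hE hα hβ hαβ hx

theorem top_mem_principalCurvatures_stretchedStiefel (hE : IsCliffordRepresentation E)
    (hl : n + 2 < l) (hα : α ≠ 0) (hβ : β ≠ 0) (hαβ : α ^ 2 + β ^ 2 = 1)
    {p : DoubleSpace l × DoubleSpace l} (hp : p ∈ unitNormalBundle (stretchedStiefel E α β)) :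
    ⊤ ∈ principalCurvatures (unitNormalBundle (stretchedStiefel E α β)) p := by
  rw [← stretchEquiv_image_focalSet hE hα hβ] at hp ⊢
  rw [principalCurvatures_stretched (isCliffordSystem_cliffordSystem hE)
    (isStretching_stretchEquiv hα hβ hαβ) (by simp) (two_mul_finrank_reflectionSpace_lt hl) hp]
  simp

theorem principalCurvatures_smul_specialNormal (hE : IsCliffordRepresentation E) (hl : n + 2 < l)
    (hα : α ≠ 0) (hβ : β ≠ 0) (hαβ : α ^ 2 + β ^ 2 = 1) {c a : ℝ} (hc : c ^ 2 = 1) (ha : 0 < a)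
    (hca : c * (β / α - α / β) = a - a⁻¹) {p : DoubleSpace l} (hp : p ∈ stretchedStiefel E α β) :
    principalCurvatures (unitNormalBundle (stretchedStiefel E α β)) (p, c • specialNormal α β p) =
      {((-a⁻¹ : ℝ) : WithTop ℝ), ((0 : ℝ) : WithTop ℝ), (a : WithTop ℝ), ⊤} := by
  have hmem := smul_specialNormal_mem_unitNormalBundle hE hα hβ hαβ hc hp
  have hhalf := halfSum_smul_specialNormal hE hα hβ hαβ c hp
  rw [← mul_div_assoc, hca] at hhalf
  rw [← stretchEquiv_image_focalSet hE hα hβ] at hmem ⊢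
  exact principalCurvatures_stretched_of_halfSum_eq (isCliffordSystem_cliffordSystem hE)
    (isStretching_stretchEquiv hα hβ hαβ) (by simp) (two_mul_finrank_reflectionSpace_lt hl)
    hmem ha hhalf

theorem specialNormal_mem_unitNormalBundle (hE : IsCliffordRepresentation E) (hα : α ≠ 0)
    (hβ : β ≠ 0) (hαβ : α ^ 2 + β ^ 2 = 1) {p : DoubleSpace l}
    (hp : p ∈ stretchedStiefel E α β) :
    (p, specialNormal α β p) ∈ unitNormalBundle (stretchedStiefel E α β) := by
  simpa only [one_smul] using
    smul_specialNormal_mem_unitNormalBundle hE hα hβ hαβ (one_pow 2) hp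

theorem neg_specialNormal_mem_unitNormalBundle (hE : IsCliffordRepresentation E) (hα : α ≠ 0)
    (hβ : β ≠ 0) (hαβ : α ^ 2 + β ^ 2 = 1) {p : DoubleSpace l}
    (hp : p ∈ stretchedStiefel E α β) :
    (p, -specialNormal α β p) ∈ unitNormalBundle (stretchedStiefel E α β) := by
  simpa only [neg_smul, one_smul] using
    smul_specialNormal_mem_unitNormalBundle hE hα hβ hαβ (neg_one_sq) hp

theorem principalCurvatures_specialNormal (hE : IsCliffordRepresentation E) (hl : n + 2 < l)
    (hα : 0 < α) (hβ : 0 < β) (hαβ : α ^ 2 + β ^ 2 = 1) {p : DoubleSpace l}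
    (hp : p ∈ stretchedStiefel E α β) :
    principalCurvatures (unitNormalBundle (stretchedStiefel E α β)) (p, specialNormal α β p) =
      {((-(α / β) : ℝ) : WithTop ℝ), ((0 : ℝ) : WithTop ℝ), ((β / α : ℝ) : WithTop ℝ), ⊤} := by
  simpa only [one_smul, inv_div] using principalCurvatures_smul_specialNormal hE hl hα.ne' hβ.ne'
    hαβ (one_pow 2) (div_pos hβ hα) (by rw [one_mul, inv_div]) hp

theorem principalCurvatures_neg_specialNormal (hE : IsCliffordRepresentation E) (hl : n + 2 < l)
    (hα : 0 < α) (hβ : 0 < β) (hαβ : α ^ 2 + β ^ 2 = 1) {p : DoubleSpace l}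
    (hp : p ∈ stretchedStiefel E α β) :
    principalCurvatures (unitNormalBundle (stretchedStiefel E α β)) (p, -specialNormal α β p) =
      {((-(β / α) : ℝ) : WithTop ℝ), ((0 : ℝ) : WithTop ℝ), ((α / β : ℝ) : WithTop ℝ), ⊤} := by
  simpa only [neg_smul, one_smul, inv_div] using principalCurvatures_smul_specialNormal hE hl
    hα.ne' hβ.ne' hαβ (neg_one_sq) (div_pos hα hβ) (by rw [inv_div]; ring) hp

theorem hasLieCurvature_specialNormal_iff (hE : IsCliffordRepresentation E) (hl : n + 2 < l)
    (hα : 0 < α) (hβ : 0 < β) (hαβ : α ^ 2 + β ^ 2 = 1) {p : DoubleSpace l}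
    (hp : p ∈ stretchedStiefel E α β) {ψ : ℝ} :
    HasLieCurvature (unitNormalBundle (stretchedStiefel E α β)) (p, specialNormal α β p) ψ ↔
      ψ = α ^ 2 := by
  have hψ : 1 / (1 + (β / α) ^ 2) = α ^ 2 := by
    rw [div_pow, one_add_div (by positivity), hαβ, one_div_one_div]
  rw [hasLieCurvature_iff_of_neg_inv (div_pos hβ hα)
    (by rw [inv_div, principalCurvatures_specialNormal hE hl hα hβ hαβ hp]), hψ]

theorem hasLieCurvature_neg_specialNormal_iff (hE : IsCliffordRepresentation E) (hl : n + 2 < l)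
    (hα : 0 < α) (hβ : 0 < β) (hαβ : α ^ 2 + β ^ 2 = 1) {p : DoubleSpace l}
    (hp : p ∈ stretchedStiefel E α β) {ψ : ℝ} :
    HasLieCurvature (unitNormalBundle (stretchedStiefel E α β)) (p, -specialNormal α β p) ψ ↔
      ψ = β ^ 2 := by
  have hψ : 1 / (1 + (α / β) ^ 2) = β ^ 2 := by
    rw [div_pow, one_add_div (by positivity), add_comm, hαβ, one_div_one_div]
  rw [hasLieCurvature_iff_of_neg_inv (div_pos hα hβ)
    (by rw [inv_div, principalCurvatures_neg_specialNormal hE hl hα hβ hαβ hp]), hψ]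

theorem sq_ne_sq_of_ne_one_div_sqrt_two (hα : 0 < α) (hαβ : α ^ 2 + β ^ 2 = 1)
    (hne : α ≠ 1 / √2) : α ^ 2 ≠ β ^ 2 := by
  refine fun h => hne ?_
  rw [eq_div_iff (by positivity), ← sq_eq_sq₀ (by positivity) zero_le_one, mul_pow,
    Real.sq_sqrt zero_le_two]
  linarith

theorem not_exists_forall_hasLieCurvature_stretchedStiefel (hE : IsCliffordRepresentation E)
    (hl : n + 2 < l) (hα : 0 < α) (hβ : 0 < β) (hαβ : α ^ 2 + β ^ 2 = 1) (hne : α ≠ 1 / √2) :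
    ¬ ∃ c : ℝ, ∀ p ∈ unitNormalBundle (stretchedStiefel E α β),
      HasLieCurvature (unitNormalBundle (stretchedStiefel E α β)) p c := by
  rintro ⟨c, hc⟩
  obtain ⟨p, hp⟩ := nonempty_stretchedStiefel (E := E) (α := α) (β := β) (by omega : n + 1 < l)
  have hpos := hc _ (specialNormal_mem_unitNormalBundle hE hα.ne' hβ.ne' hαβ hp)
  have hneg := hc _ (neg_specialNormal_mem_unitNormalBundle hE hα.ne' hβ.ne' hαβ hp)
  rw [hasLieCurvature_specialNormal_iff hE hl hα hβ hαβ hp] at hpos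
  rw [hasLieCurvature_neg_specialNormal_iff hE hl hα hβ hαβ hp] at hneg
  exact sq_ne_sq_of_ne_one_div_sqrt_two hα hαβ hne (hpos.symm.trans hneg)

theorem exists_halfSum_ne_zero (hE : IsCliffordRepresentation E) (hl : n + 1 < l) (hα : 0 < α)
    (hβ : 0 < β) (hαβ : α ^ 2 + β ^ 2 = 1) (hne : α ≠ 1 / √2) :
    ∃ p ∈ unitNormalBundle (stretchedStiefel E α β), halfSum (cliffordSystem E)
      (stretchEquiv l hα.ne' hβ.ne') (reflectionVector n) (α ^ 2 - β ^ 2) p ≠ 0 := by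
  obtain ⟨p, hp⟩ := nonempty_stretchedStiefel (E := E) (α := α) (β := β) hl
  refine ⟨_, smul_specialNormal_mem_unitNormalBundle hE hα.ne' hβ.ne' hαβ (one_pow 2) hp, ?_⟩
  rw [halfSum_smul_specialNormal hE hα.ne' hβ.ne' hαβ 1 hp, one_mul, ne_eq,
    div_eq_zero_iff, not_or]
  refine ⟨fun h => sq_ne_sq_of_ne_one_div_sqrt_two hα hαβ hne ?_, two_ne_zero⟩
  rw [sub_eq_zero, div_eq_div_iff hα.ne' hβ.ne'] at h
  linarith

theorem not_lieEquivalentToIsoparametric_stretchedStiefel (hE : IsCliffordRepresentation E)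
    (hl : n + 2 < l) (hα : 0 < α) (hβ : 0 < β) (hαβ : α ^ 2 + β ^ 2 = 1) (hne : α ≠ 1 / √2) :
    ¬ LieEquivalentToIsoparametric.{u} (unitNormalBundle (stretchedStiefel E α β)) := by
  have hP := isCliffordSystem_cliffordSystem hE
  have hT := isStretching_stretchEquiv (E := E) (l := l) hα.ne' hβ.ne' hαβ
  have hfocal : (focalSet (cliffordSystem E)).Nonempty :=
    cliffordStiefel_eq_focalSet hE ▸ nonempty_cliffordStiefel (by omega)
  obtain ⟨p, hp, hp0⟩ := exists_halfSum_eq_zero hP hT (by simp) hfocal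
  obtain ⟨q, hq, hq0⟩ := exists_halfSum_ne_zero hE (by omega) hα hβ hαβ hne
  rw [← stretchEquiv_image_focalSet hE hα.ne' hβ.ne'] at hq ⊢
  exact not_lieEquivalentToIsoparametric_stretched hP hT (by simp)
    (two_mul_finrank_reflectionSpace_lt hl)
    (fun x hx => norm_stretchEquiv hE hα.ne' hβ.ne' hαβ hx) hp hp0 hq hq0

theorem eventually_tube_stretchedStiefel (hE : IsCliffordRepresentation E) (hl : n + 2 < l)
    (hα : 0 < α) (hβ : 0 < β) (hαβ : α ^ 2 + β ^ 2 = 1) (hne : α ≠ 1 / √2) :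
    ∀ᶠ t in 𝓝[>] (0 : ℝ),
      (tube (stretchedStiefel E α β) t ⊆ Metric.sphere 0 1 ∧
        IsCompact (tube (stretchedStiefel E α β) t) ∧
        IsSubmanifold (2 * l - 2) (tube (stretchedStiefel E α β) t)) ∧
      (∃ ν, IsUnitNormalField (tube (stretchedStiefel E α β) t) ν) ∧
      ∀ ν, IsUnitNormalField (tube (stretchedStiefel E α β) t) ν →
        IsProperDupin 4 (hypersurfaceLift (tube (stretchedStiefel E α β) t) ν) ∧
        ¬ LieEquivalentToIsoparametric.{u}
          (hypersurfaceLift (tube (stretchedStiefel E α β) t) ν) := by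
  have hP := isCliffordSystem_cliffordSystem hE
  have hT := isStretching_stretchEquiv (E := E) (l := l) hα.ne' hβ.ne' hαβ
  have hfocal : (focalSet (cliffordSystem E)).Nonempty :=
    cliffordStiefel_eq_focalSet hE ▸ nonempty_cliffordStiefel (by omega)
  obtain ⟨p, hp, hp0⟩ := exists_halfSum_eq_zero hP hT (by simp) hfocal
  obtain ⟨q, hq, hq0⟩ := exists_halfSum_ne_zero hE (by omega) hα hβ hαβ hne
  rw [← stretchEquiv_image_focalSet hE hα.ne' hβ.ne'] at hq ⊢
  rw [← finrank_doubleSpace]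
  exact eventually_tube_stretched hP hT (by simp) (two_mul_finrank_reflectionSpace_lt hl)
    (fun x hx => norm_stretchEquiv hE hα.ne' hβ.ne' hαβ hx) hp hp0 hq hq0

end StretchedStiefel

end LieSphere

end

open LieSphere in
theorem mainTheorem1 (l m : ℕ) (hm : 1 ≤ m) (hl : m + 1 < l)
    (E : Fin (m - 1) → Matrix (Fin l) (Fin l) ℝ) (hE : IsCliffordRepresentation E)
    (α β : ℝ) (hα : 0 < α) (hβ : 0 < β) (hαβ : α ^ 2 + β ^ 2 = 1) (hne : α ≠ 1 / √2)
    (V : Set (DoubleSpace l)) (hV : V = stretchedStiefel E α β)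
    (B : Set (DoubleSpace l × DoubleSpace l)) (hB : B = unitNormalBundle V) :
    -- `V` is a compact submanifold of the unit sphere, of codimension `m + 1`
    (V ⊆ Metric.sphere 0 1 ∧ IsCompact V ∧ IsSubmanifold (2 * l - 1 - (m + 1)) V) ∧
    -- it is proper Dupin with four principal curvatures, including `∞`
    (IsProperDupin 4 B ∧ ∀ p ∈ B, ⊤ ∈ principalCurvatures B p) ∧
    -- principal curvatures and Lie curvature at `ξ(u, v)` and at `-ξ(u, v)`
    (∀ p ∈ V,
      ((p, specialNormal α β p) ∈ B ∧
        principalCurvatures B (p, specialNormal α β p) =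
          {((-(α / β) : ℝ) : WithTop ℝ), ((0 : ℝ) : WithTop ℝ), ((β / α : ℝ) : WithTop ℝ), ⊤} ∧
        HasLieCurvature B (p, specialNormal α β p) (α ^ 2)) ∧
      ((p, -specialNormal α β p) ∈ B ∧
        principalCurvatures B (p, -specialNormal α β p) =
          {((-(β / α) : ℝ) : WithTop ℝ), ((0 : ℝ) : WithTop ℝ), ((α / β : ℝ) : WithTop ℝ), ⊤} ∧
        HasLieCurvature B (p, -specialNormal α β p) (β ^ 2))) ∧
    -- the Lie curvature is not constant
    (¬ ∃ c : ℝ, ∀ p ∈ B, HasLieCurvature B p c) ∧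
    -- `V` is not Lie equivalent to an isoparametric hypersurface
    (¬ LieEquivalentToIsoparametric.{u} B) ∧
    -- every sufficiently small tube over `V` is a compact embedded proper Dupin hypersurface with
    -- four principal curvatures that is not Lie equivalent to an isoparametric hypersurface
    (∃ t₀ : ℝ, 0 < t₀ ∧ ∀ t : ℝ, 0 < t → t < t₀ →
      (tube V t ⊆ Metric.sphere 0 1 ∧ IsCompact (tube V t) ∧
        IsSubmanifold (2 * l - 2) (tube V t)) ∧
      (∃ ν, IsUnitNormalField (tube V t) ν) ∧
      ∀ ν, IsUnitNormalField (tube V t) ν →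
        IsProperDupin 4 (hypersurfaceLift (tube V t) ν) ∧
        ¬ LieEquivalentToIsoparametric.{u} (hypersurfaceLift (tube V t) ν)) := by
  obtain ⟨n, rfl⟩ : ∃ n, m = n + 1 := ⟨m - 1, by omega⟩
  subst hV hB
  have hα' := hα.ne'
  have hβ' := hβ.ne'
  refine ⟨⟨stretchedStiefel_subset_sphere hαβ, isCompact_stretchedStiefel hE hα' hβ',
      isSubmanifold_stretchedStiefel hE hl hα' hβ'⟩,
    ⟨isProperDupin_stretchedStiefel hE hl hα' hβ' hαβ,
      fun p hp => top_mem_principalCurvatures_stretchedStiefel hE hl hα' hβ' hαβ hp⟩,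
    fun p hp => ⟨⟨specialNormal_mem_unitNormalBundle hE hα' hβ' hαβ hp,
        principalCurvatures_specialNormal hE hl hα hβ hαβ hp,
        (hasLieCurvature_specialNormal_iff hE hl hα hβ hαβ hp).2 rfl⟩,
      neg_specialNormal_mem_unitNormalBundle hE hα' hβ' hαβ hp,
      principalCurvatures_neg_specialNormal hE hl hα hβ hαβ hp,
      (hasLieCurvature_neg_specialNormal_iff hE hl hα hβ hαβ hp).2 rfl⟩,
    not_exists_forall_hasLieCurvature_stretchedStiefel hE hl hα hβ hαβ hne,
    not_lieEquivalentToIsoparametric_stretchedStiefel hE hl hα hβ hαβ hne, ?_⟩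
  obtain ⟨t₀, ht₀, htube⟩ := mem_nhdsGT_iff_exists_Ioo_subset.1
    (eventually_tube_stretchedStiefel hE hl hα hβ hαβ hne)
  exact ⟨t₀, ht₀, fun t htpos htlt => htube ⟨htpos, htlt⟩⟩
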